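/- Let $E_5$ be the space of equilateral pentagons of unit perimeter: the set of $(\theta_1,\dots,\theta_5)\in(\mathbb R/2\pi\mathbb Z)^5$ with $\sum_k \tfrac15 e^{i\theta_k}=0$, modulo rigid rotation $\theta_k\mapsto\theta_k+\alpha$. It carries the bag-of-edges metric $de_5^2=\frac1{25}\sum_{i<j}(d\theta_j-d\theta_i)^2$. The vertex angles are $\tau_k=\theta_{k+1}-\theta_k$ (indices mod $5$, values mod $2\pi$). Write $t_k=\tan(\tau_k/2)$, $\xi=\tau_1$, $\eta=\tau_4$, $x=\tan(\xi/2)$, $y=\tan(\eta/2)$, and $$Q=15+22x^2+22y^2-9x^4+60x^2y^2-9y^4+6x^4y^2+6x^2y^4-x^4y^4 .$$ (1) Let $\xi,\eta\ne\pi$. If a pentagon in $E_5$ has $\tau_1=\xi$ and $\tau_4=\eta$, then $Q\ge 0$ and, for some sign, the same in both formulas, $$t_2=\frac{4x(1+y^2)\pm\sqrt Q}{(1+x^2)(y^2-3)}\quad\text{and}\quad t_3=\frac{4y(1+x^2)\pm\sqrt Q}{(1+y^2)(x^2-3)},$$ where the formula for $t_2$ is asserted (together with $\tau_2\neq\pi$)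 if $y^2\ne3$, and the formula for $t_3$ (together with $\tau_3\ne\pi$) if $x^2\neq 3$. Conversely, if $Q\ge0$ and $x^2,y^2$ are not both equal to $3$, then for each choice of the sign there is exactly one pentagon in $E_5$ with $\tau_1=\xi$, $\tau_4=\eta$ that satisfies these formulas. There are exactly two pentagons with $\tau_1=\xi$ and $\tau_4=\eta$ if $Q>0$, and exactly one if $Q=0$. (2) At every pentagon with $\xi,\eta\neq\pi$ and $Q>0$, the vertex angles $(\xi,\eta)$ are smooth local coordinates of $E_5$, and in them $de_5^2=E\,d\xi^2+2F\,d\xi\,d\eta+G\,d\eta^2$ with $$E=\frac{75+225x^2+110y^2-15x^4+490x^2y^2-45y^4+27x^6-22x^4y^2+153x^2y^4-18x^6y^2+9x^4y^4+3x^6y^4}{50\,Q},$$ $$F=\frac{xy\,(-55-50x^2-50y^2-27x^4+20x^2y^2-27y^4+6x^4y^2+6x^2y^4+x^4y^4)}{25\,Q},$$ $$G=\frac{75+110x^2+225y^2-45x^4+490x^2y^2-15y^4+153x^4y^2-22x^2y^4+27y^6+9x^4y^4-18x^2y^6+3x^4y^6}{50\,Q}.$$ (3) The Gaussian curvature $K$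 of $(E_5,e_5)$ is defined at every point of $E_5$, and its set of values is exactly $[-11/3,-1]$. Consider the $25$ loops on $E_5$ that are the fixed-point sets of the following isometries: the ten swaps of two phases, and the fifteen swaps of two disjoint pairs of phases combined with the reflection $\theta\mapsto-\theta$. A $\frac{\pi}{m}$-vertex is a point that lies on exactly $m$ of these loops ($m=4,5$). Then $K=-1$ at every $\frac\pi5$-vertex and $K=-11/3$ at every $\frac\pi4$-vertex. The $\frac\pi5$-vertices are exactly the pentagons whose five phases are arranged like the complex fifth roots of unity, and the $\frac\pi4$-vertices are exactly the pentagons with two disjoint pairs of coincident phases. -/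

import Mathlib

open scoped ContDiff

noncomputable section

namespace Pentagon

/-! ### Polygon spaces -/

/-- The phases `θ 0, …, θ (n-1)` (angles modulo `2π`) of edges with lengths `r k` close up:
`∑ k, r k * exp (I * θ k) = 0`. -/
def Closes {n : ℕ} (r : Fin n → ℝ) (θ : Fin n → Real.Angle) : Prop :=
  ∑ k, (r k : ℂ) * ((θ k).toCircle : ℂ) = 0

/-- Two phase vectors are equivalent when they differ by a rigid rotation. -/
def rotationSetoid {n : ℕ} (r : Fin n → ℝ) : Setoid {θ : Fin n → Real.Angle // Closes r θ} where
  r θ θ' := ∃ α : Real.Angle, ∀ k, θ'.1 k = θ.1 k + α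
  iseqv :=
    { refl := fun _ => ⟨0, fun _ => (add_zero _).symm⟩
      symm := fun ⟨α, h⟩ => ⟨-α, fun k => by rw [h k, add_neg_cancel_right]⟩
      trans := fun ⟨α, h⟩ ⟨β, h'⟩ => ⟨α + β, fun k => by rw [h' k, h k, add_assoc]⟩ }

/-- The polygon space of closed polygons with edge lengths `r`, modulo rotation. -/
def PolygonSpace {n : ℕ} (r : Fin n → ℝ) : Type := Quotient (rotationSetoid r)

/-- `θ` is a vector of real numbers whose classes modulo `2π` are phases of the polygon `p`. -/
def HasPhases {n : ℕ} {r : Fin n → ℝ} (p : PolygonSpace r) (θ : Fin n → ℝ) : Prop :=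
  ∃ h : Closes r (fun k => (θ k : Real.Angle)), p = Quotient.mk (rotationSetoid r) ⟨_, h⟩

/-- The bag-of-edges metric `∑_{i<j} r i * r j * (dθ j - dθ i)^2` as a bilinear form in the
phase variations `v`, `w`. -/
def bagOfEdges {n : ℕ} (r : Fin n → ℝ) (v w : Fin n → ℝ) : ℝ :=
  ∑ i, ∑ j, if i < j then r i * r j * ((v j - v i) * (w j - w i)) else 0

/-- The length vector of the equilateral pentagons of unit perimeter. -/
def fifths : Fin 5 → ℝ := fun _ => 1 / 5

/-- The space of equilateral pentagons of unit perimeter. -/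
abbrev E5 : Type := PolygonSpace fifths

/-- The vertex angle `τ (k+1) = θ (k+2) - θ (k+1)`, that is, `θ (k+1) - θ k` in the numbering of
`Fin 5`, which is cyclic and starts from `0`. -/
def vertexAngle (k : Fin 5) (p : E5) : Real.Angle :=
  Quotient.lift (s := rotationSetoid fifths) (fun θ => θ.1 (k + 1) - θ.1 k)
    (fun _ _ ⟨α, h⟩ => by simp only [h]; abel) p

/-- The half-angle tangent; this is `tan (τ / 2)` for every real representative of `τ`.
It is meaningful only for `τ ≠ π`. -/
def halfTan (τ : Real.Angle) : ℝ := Real.tan (τ.toReal / 2)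

/-! ### The explicit formulas -/

/-- The radicand. -/
def radicand (x y : ℝ) : ℝ :=
  15 + 22 * x ^ 2 + 22 * y ^ 2 - 9 * x ^ 4 + 60 * x ^ 2 * y ^ 2 - 9 * y ^ 4
    + 6 * x ^ 4 * y ^ 2 + 6 * x ^ 2 * y ^ 4 - x ^ 4 * y ^ 4

def formulaE (x y : ℝ) : ℝ :=
  (75 + 225 * x ^ 2 + 110 * y ^ 2 - 15 * x ^ 4 + 490 * x ^ 2 * y ^ 2 - 45 * y ^ 4 + 27 * x ^ 6
      - 22 * x ^ 4 * y ^ 2 + 153 * x ^ 2 * y ^ 4 - 18 * x ^ 6 * y ^ 2 + 9 * x ^ 4 * y ^ 4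
      + 3 * x ^ 6 * y ^ 4)
    / (50 * radicand x y)

def formulaF (x y : ℝ) : ℝ :=
  x * y * (-55 - 50 * x ^ 2 - 50 * y ^ 2 - 27 * x ^ 4 + 20 * x ^ 2 * y ^ 2 - 27 * y ^ 4
      + 6 * x ^ 4 * y ^ 2 + 6 * x ^ 2 * y ^ 4 + x ^ 4 * y ^ 4)
    / (25 * radicand x y)

def formulaG (x y : ℝ) : ℝ :=
  (75 + 110 * x ^ 2 + 225 * y ^ 2 - 45 * x ^ 4 + 490 * x ^ 2 * y ^ 2 - 15 * y ^ 4
      + 153 * x ^ 4 * y ^ 2 - 22 * x ^ 2 * y ^ 4 + 27 * y ^ 6 + 9 * x ^ 4 * y ^ 4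
      - 18 * x ^ 2 * y ^ 6 + 3 * x ^ 4 * y ^ 6)
    / (50 * radicand x y)

/-- The vertex angles `τ₂`, `τ₃` of `p` are given by the explicit formulas with the sign `s`
(the same in both). Each formula is asserted wherever its denominator is not zero. -/
def AnglesGivenBy (s x y : ℝ) (p : E5) : Prop :=
  (y ^ 2 ≠ 3 → vertexAngle 1 p ≠ (Real.pi : Real.Angle) ∧
    halfTan (vertexAngle 1 p)
      = (4 * x * (1 + y ^ 2) + s * √(radicand x y)) / ((1 + x ^ 2) * (y ^ 2 - 3))) ∧
  (x ^ 2 ≠ 3 → vertexAngle 2 p ≠ (Real.pi : Real.Angle) ∧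
    halfTan (vertexAngle 2 p)
      = (4 * y * (1 + x ^ 2) + s * √(radicand x y)) / ((1 + y ^ 2) * (x ^ 2 - 3)))

/-- The pentagons whose vertex angles `τ₁` and `τ₄` are `ξ` and `η`. -/
def angleFibre (ξ η : Real.Angle) : Set E5 :=
  {p | vertexAngle 0 p = ξ ∧ vertexAngle 3 p = η}

/-! ### Local parametrizations, first fundamental form, Gaussian curvature -/

/-- The partial derivative in the first variable. -/
def partial₁ {V : Type*} [NormedAddCommGroup V] [NormedSpace ℝ V] (f : ℝ × ℝ → V) : ℝ × ℝ → V :=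
  fun u => fderiv ℝ f u (1, 0)

/-- The partial derivative in the second variable. -/
def partial₂ {V : Type*} [NormedAddCommGroup V] [NormedSpace ℝ V] (f : ℝ × ℝ → V) : ℝ × ℝ → V :=
  fun u => fderiv ℝ f u (0, 1)

/-- A smooth regular parametrization of a piece of `E5`, given by a smooth choice `φ` of real
phases on the open set `U` of parameters. Regularity is linear independence of the two tangent
vectors modulo the direction `(1, …, 1)` of the rigid rotations. -/
structure IsParametrization (U : Set (ℝ × ℝ)) (φ : ℝ × ℝ → Fin 5 → ℝ) : Prop where
  isOpen : IsOpen U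
  smooth : ContDiffOn ℝ ∞ φ U
  closes : ∀ u ∈ U, Closes fifths (fun k => (φ u k : Real.Angle))
  regular : ∀ u ∈ U, LinearIndependent ℝ ![partial₁ φ u, partial₂ φ u, fun _ => (1 : ℝ)]

/-- The coefficient `E` of the first fundamental form `E du² + 2F du dv + G dv²` of the bag-of-edges
metric on equilateral pentagons, in the parametrization `φ`. -/
def metricE (φ : ℝ × ℝ → Fin 5 → ℝ) : ℝ × ℝ → ℝ :=
  fun u => bagOfEdges fifths (partial₁ φ u) (partial₁ φ u)

/-- The coefficient `F`. -/
def metricF (φ : ℝ × ℝ → Fin 5 → ℝ) : ℝ × ℝ → ℝ :=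
  fun u => bagOfEdges fifths (partial₁ φ u) (partial₂ φ u)

/-- The coefficient `G`. -/
def metricG (φ : ℝ × ℝ → Fin 5 → ℝ) : ℝ × ℝ → ℝ :=
  fun u => bagOfEdges fifths (partial₂ φ u) (partial₂ φ u)

/-- A parametrization in which the parameters are the vertex angles `τ₁` and `τ₄`. -/
structure IsAngleParametrization (U : Set (ℝ × ℝ)) (φ : ℝ × ℝ → Fin 5 → ℝ) : Prop where
  isParametrization : IsParametrization U φ
  fst_eq : ∀ u ∈ U, φ u 1 - φ u 0 = u.1
  snd_eq : ∀ u ∈ U, φ u 4 - φ u 3 = u.2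

/-- The Gaussian curvature of the metric `E du² + 2F du dv + G dv²`, by Brioschi's formula. -/
def brioschi (E F G : ℝ × ℝ → ℝ) (u : ℝ × ℝ) : ℝ :=
  (Matrix.det
      !![-(1 / 2) * partial₂ (partial₂ E) u + partial₁ (partial₂ F) u
            - (1 / 2) * partial₁ (partial₁ G) u,
          (1 / 2) * partial₁ E u, partial₁ F u - (1 / 2) * partial₂ E u;
         partial₂ F u - (1 / 2) * partial₁ G u, E u, F u;
         (1 / 2) * partial₂ G u, F u, G u]
    - Matrix.det
      !![0, (1 / 2) * partial₂ E u, (1 / 2) * partial₁ G u;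
         (1 / 2) * partial₂ E u, E u, F u;
         (1 / 2) * partial₁ G u, F u, G u])
  / (E u * G u - F u ^ 2) ^ 2

/-- `κ` is the Gaussian curvature of `E5` with its bag-of-edges metric at the pentagon `p`:
there are parametrizations around `p`, and the curvature computed in any of them is `κ`. -/
def HasGaussianCurvature (p : E5) (κ : ℝ) : Prop :=
  (∃ U φ, IsParametrization U φ ∧ ∃ u ∈ U, HasPhases p (φ u)) ∧
  ∀ U φ, IsParametrization U φ → ∀ u ∈ U, HasPhases p (φ u) →
    brioschi (metricE φ) (metricF φ) (metricG φ) u = κ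

/-! ### Tract vertices -/

theorem Closes.permute {θ : Fin 5 → Real.Angle} (h : Closes fifths θ)
    (σ : Equiv.Perm (Fin 5)) : Closes fifths (fun k => θ (σ k)) := by
  unfold Closes fifths at *
  rw [← h]
  exact Equiv.sum_comp σ (fun k => (((1 / 5 : ℝ) : ℂ)) * ((θ k).toCircle : ℂ))

theorem Closes.reflect {θ : Fin 5 → Real.Angle} (h : Closes fifths θ) :
    Closes fifths (fun k => -θ k) := by
  unfold Closes at *
  have := congrArg (starRingEnd ℂ) h
  simpa [-Circle.coe_inv, Circle.coe_inv_eq_conj] using this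

/-- Permuting the phases of the five edges. -/
def permute (σ : Equiv.Perm (Fin 5)) : E5 → E5 :=
  Quotient.map' (fun θ => ⟨fun k => θ.1 (σ k), θ.2.permute σ⟩)
    (fun _ _ ⟨α, h⟩ => ⟨α, fun k => h (σ k)⟩)

/-- Reflecting the pentagon. -/
def reflect : E5 → E5 :=
  Quotient.map' (fun θ => ⟨fun k => -θ.1 k, θ.2.reflect⟩)
    (fun _ _ ⟨α, h⟩ => ⟨-α, fun k => by simp only [h k, neg_add]⟩)

/-- The number of tract-bounding loops through `p`. The ten short-leg loops are the fixed-point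
sets of the swaps of two phases; the fifteen hypot-long-leg loops are the fixed-point sets of the
swaps of two disjoint pairs of phases combined with reflection. -/
def loopCount (p : E5) : ℕ :=
  {σ : Equiv.Perm (Fin 5) | σ.IsSwap ∧ permute σ p = p}.ncard
    + {σ : Equiv.Perm (Fin 5) | σ.cycleType = {2, 2} ∧ reflect (permute σ p) = p}.ncard

/-- `p` is a `π/m`-vertex of the partition of `E5` into tracts (`m = 2, 4, 5`): exactly `m` of the
tract-bounding loops cross at `p`, so that `2m` tracts meet there. -/
def IsTractVertex (m : ℕ) (p : E5) : Prop := loopCount p = m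

/-- The five phases of `p` are arranged like the complex fifth roots of unity. -/
def PhasesLikeFifthRoots (p : E5) : Prop :=
  ∃ (α : ℝ) (σ : Equiv.Perm (Fin 5)), HasPhases p (fun k => α + 2 * Real.pi * (σ k : ℕ) / 5)

/-- Two disjoint pairs of the phases of `p` coincide. -/
def TwoPairsCoincide (p : E5) : Prop :=
  ∃ θ : Fin 5 → ℝ, HasPhases p θ ∧ ∃ σ : Equiv.Perm (Fin 5),
    θ (σ 0) = θ (σ 1) ∧ θ (σ 2) = θ (σ 3)

end Pentagon

end

open scoped ContDiff

noncomputable section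

namespace Pentagon

/-! ### Closed systems of five unit vectors -/

/-- Five unit vectors `(A k, B k)` in the plane with vanishing sum. -/
structure UnitClosed (A B : Fin 5 → ℝ) : Prop where
  unit : ∀ k, A k ^ 2 + B k ^ 2 = 1
  sum_fst : ∑ k, A k = 0
  sum_snd : ∑ k, B k = 0

theorem UnitClosed.rotate {A B : Fin 5 → ℝ} (h : UnitClosed A B) {c s : ℝ}
    (hcs : c ^ 2 + s ^ 2 = 1) :
    UnitClosed (fun k => c * A k + s * B k) (fun k => c * B k - s * A k) where
  unit k := by linear_combination hcs * (A k ^ 2 + B k ^ 2) + h.unit k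
  sum_fst := by
    rw [Finset.sum_add_distrib, ← Finset.mul_sum, ← Finset.mul_sum, h.sum_fst, h.sum_snd]; ring
  sum_snd := by
    rw [Finset.sum_sub_distrib, ← Finset.mul_sum, ← Finset.mul_sum, h.sum_fst, h.sum_snd]; ring

theorem UnitClosed.perm {A B : Fin 5 → ℝ} (h : UnitClosed A B) (σ : Equiv.Perm (Fin 5)) :
    UnitClosed (fun k => A (σ k)) (fun k => B (σ k)) where
  unit k := h.unit (σ k)
  sum_fst := by rw [Equiv.sum_comp σ A, h.sum_fst]
  sum_snd := by rw [Equiv.sum_comp σ B, h.sum_snd]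

theorem UnitClosed.neg {A B : Fin 5 → ℝ} (h : UnitClosed A B) :
    UnitClosed (fun k => -A k) B where
  unit k := by rw [neg_sq, h.unit k]
  sum_fst := by rw [Finset.sum_neg_distrib, h.sum_fst, neg_zero]
  sum_snd := h.sum_snd

theorem lt_of_sq_sum_gt {x₃ x₄ x₅ : ℝ} (h₃ : x₃ ≤ 1) (h₄ : x₄ ≤ 1) (h₅ : 0 ≤ x₅) (h₅₃ : x₅ ≤ x₃)
    (h₅₄ : x₅ ≤ x₄) (hs : x₃ + x₄ + x₅ ≤ 2) (hq : 7 / 4 < x₃ ^ 2 + x₄ ^ 2 + x₅ ^ 2) :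
    x₅ < 3 / 20 := by
  have h1 : x₃ ^ 2 + x₄ ^ 2 ≤ 1 + (1 - (x₃ + x₄)) ^ 2 := by nlinarith
  have h2 : 1 ≤ x₃ + x₄ := by
    by_contra! hlt
    nlinarith [mul_nonneg (h₅.trans h₅₃) (h₅.trans h₅₄)]
  have h3 : (x₃ + x₄ - 1) ^ 2 ≤ (1 - x₅) ^ 2 := by
    apply pow_le_pow_left₀ <;> linarith
  by_contra! hlt
  nlinarith

theorem sq_sub_le_of_unit {x y n m : ℝ} (hxy : x ^ 2 + y ^ 2 = 1) (hnm : n ^ 2 + m ^ 2 = 1)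
    (hx : 9 / 10 ≤ x) (hn : 24 / 25 ≤ n) (hm : |m| ≤ 1 / 4) (hy : |y - m| ≤ 17 / 100) :
    (x - n) ^ 2 ≤ 7 / 50 * (y - m) ^ 2 := by
  have h1 : (x - n) * (x + n) = (m - y) * (m + y) := by linear_combination hxy - hnm
  have h2 : (x - n) ^ 2 * (x + n) ^ 2 = (y - m) ^ 2 * (m + y) ^ 2 := by
    linear_combination ((x - n) * (x + n) + (m - y) * (m + y)) * h1
  have h3 : (m + y) ^ 2 ≤ (67 / 100) ^ 2 := by
    rw [abs_le] at hm hy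
    apply sq_le_sq' <;> linarith [hm.1, hm.2, hy.1, hy.2]
  have h4 : (186 / 100) ^ 2 ≤ (x + n) ^ 2 := by
    apply pow_le_pow_left₀ <;> linarith
  nlinarith [mul_le_mul_of_nonneg_left h3 (sq_nonneg (y - m)),
    mul_le_mul_of_nonneg_left h4 (sq_nonneg (x - n)), sq_nonneg (y - m)]

theorem sum_sq_ge_of_three_right {x₁ x₂ x₃ x₄ x₅ y₁ y₂ y₃ y₄ y₅ : ℝ}
    (h₁ : x₁ ^ 2 + y₁ ^ 2 = 1) (h₂ : x₂ ^ 2 + y₂ ^ 2 = 1) (h₃ : x₃ ^ 2 + y₃ ^ 2 = 1)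
    (h₄ : x₄ ^ 2 + y₄ ^ 2 = 1) (h₅ : x₅ ^ 2 + y₅ ^ 2 = 1)
    (hx : x₁ + x₂ + x₃ + x₄ + x₅ = 0) (hy : y₁ + y₂ + y₃ + y₄ + y₅ = 0)
    (h0 : 0 ≤ x₅) (h53 : x₅ ≤ x₃) (h54 : x₅ ≤ x₄) :
    5 / 4 ≤ y₁ ^ 2 + y₂ ^ 2 + y₃ ^ 2 + y₄ ^ 2 + y₅ ^ 2 := by
  by_contra! hlt
  have habs : ∀ x y : ℝ, x ^ 2 + y ^ 2 = 1 → -1 ≤ x ∧ x ≤ 1 := fun x y h =>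
    abs_le.1 ((sq_le_one_iff_abs_le_one x).1 (by linarith [sq_nonneg y]))
  have x1 := (habs _ _ h₁).1
  have x2 := (habs _ _ h₂).1
  have x3 := (habs _ _ h₃).2
  have x4 := (habs _ _ h₄).2
  have ht : x₅ < 3 / 20 := by
    apply lt_of_sq_sum_gt x3 x4 h0 h53 h54 (by linarith)
    linarith [sq_nonneg y₁, sq_nonneg y₂]
  obtain ⟨m, hm⟩ : ∃ m, m = -y₅ / 4 := ⟨_, rfl⟩
  have hV : (y₁ - m) ^ 2 + (y₂ - m) ^ 2 + (y₃ - m) ^ 2 + (y₄ - m) ^ 2 < 5 / 4 * x₅ ^ 2 := by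
    have : y₁ + y₂ + y₃ + y₄ = 4 * m := by rw [hm]; linarith
    have h5m : y₅ = -4 * m := by rw [hm]; ring
    rw [h5m] at h₅ hlt
    have hmul : m * (y₁ + y₂ + y₃ + y₄) = m * (4 * m) := by rw [this]
    linarith
  have hx5 : x₅ ^ 2 < (3 / 20) ^ 2 := pow_lt_pow_left₀ ht h0 two_ne_zero
  have hm4 : |m| ≤ 1 / 4 := by
    have : y₅ ^ 2 ≤ 1 := by linarith [sq_nonneg x₅]
    have := abs_le.1 ((sq_le_one_iff_abs_le_one y₅).1 this)
    rw [abs_le, hm]; constructor <;> linarith [this.1, this.2]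
  have hd : ∀ d : ℝ, d ^ 2 < 5 / 4 * x₅ ^ 2 → |d| ≤ 17 / 100 := fun d h => by
    apply abs_le_of_sq_le_sq _ (by norm_num)
    linarith only [h, hx5]
  have d1 := hd (y₁ - m) (by linarith [sq_nonneg (y₂ - m), sq_nonneg (y₃ - m), sq_nonneg (y₄ - m)])
  have d2 := hd (y₂ - m) (by linarith [sq_nonneg (y₁ - m), sq_nonneg (y₃ - m), sq_nonneg (y₄ - m)])
  have d3 := hd (y₃ - m) (by linarith [sq_nonneg (y₂ - m), sq_nonneg (y₁ - m), sq_nonneg (y₄ - m)])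
  have d4 := hd (y₄ - m) (by linarith [sq_nonneg (y₂ - m), sq_nonneg (y₃ - m), sq_nonneg (y₁ - m)])
  have hbig : ∀ x y : ℝ, x ^ 2 + y ^ 2 = 1 → |y - m| ≤ 17 / 100 → 0 ≤ x → 9 / 10 ≤ x :=
    fun x y h hy hx0 => by
      rw [abs_le] at hm4 hy
      have : y ^ 2 ≤ (42 / 100) ^ 2 := by
        apply sq_le_sq' <;> linarith [hm4.1, hm4.2, hy.1, hy.2]
      clear * - this h hx0
      nlinarith
  have e3 := hbig _ _ h₃ d3 (h0.trans h53)
  have e4 := hbig _ _ h₄ d4 (h0.trans h54)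
  have e1 := hbig (-x₁) y₁ (by rw [neg_sq, h₁]) d1 (by linarith)
  have e2 := hbig (-x₂) y₂ (by rw [neg_sq, h₂]) d2 (by linarith)
  obtain ⟨n, hn0, hn⟩ : ∃ n, 0 ≤ n ∧ n ^ 2 + m ^ 2 = 1 := by
    have : m ^ 2 ≤ 1 := by
      rw [sq_le_one_iff_abs_le_one]; linarith
    exact ⟨√(1 - m ^ 2), Real.sqrt_nonneg _, by rw [Real.sq_sqrt (by linarith)]; ring⟩
  have hn' : 24 / 25 ≤ n := by
    have : m ^ 2 ≤ (1 / 4) ^ 2 := sq_le_sq' (abs_le.1 hm4).1 (abs_le.1 hm4).2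
    clear * - this hn hn0
    nlinarith
  have f1 := sq_sub_le_of_unit (by rw [neg_sq, h₁]) hn e1 hn' hm4 d1
  have f2 := sq_sub_le_of_unit (by rw [neg_sq, h₂]) hn e2 hn' hm4 d2
  have f3 := sq_sub_le_of_unit h₃ hn e3 hn' hm4 d3
  have f4 := sq_sub_le_of_unit h₄ hn e4 hn' hm4 d4
  have hx5' : x₅ = (-x₁ - n) + (-x₂ - n) - (x₃ - n) - (x₄ - n) := by linarith
  have hcs : ∀ p q r s : ℝ, (p + q - r - s) ^ 2 ≤ 4 * (p ^ 2 + q ^ 2 + r ^ 2 + s ^ 2) :=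
    fun p q r s => by
      nlinarith [sq_nonneg (p - q), sq_nonneg (p + r), sq_nonneg (p + s), sq_nonneg (q + r),
        sq_nonneg (q + s), sq_nonneg (r - s)]
  have := hcs (-x₁ - n) (-x₂ - n) (x₃ - n) (x₄ - n)
  rw [← hx5'] at this
  linarith [sq_nonneg x₅]

theorem UnitClosed.sum_snd_sq_ge {A B : Fin 5 → ℝ} (h : UnitClosed A B) :
    5 / 4 ≤ ∑ k, B k ^ 2 := by
  set σ := Tuple.sort A with hσ
  have hmono : Monotone (A ∘ σ) := Tuple.monotone_sort A
  have h01 : A (σ 0) ≤ A (σ 2) := hmono (by decide)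
  have h12 : A (σ 1) ≤ A (σ 2) := hmono (by decide)
  have h23 : A (σ 2) ≤ A (σ 3) := hmono (by decide)
  have h24 : A (σ 2) ≤ A (σ 4) := hmono (by decide)
  have hp := h.perm σ
  have s1 := hp.sum_fst
  have s2 := hp.sum_snd
  rw [← Equiv.sum_comp σ (fun k => B k ^ 2)]
  simp only [Fin.sum_univ_five] at s1 s2 ⊢
  rcases le_total 0 (A (σ 2)) with h0 | h0
  · have := sum_sq_ge_of_three_right (h.unit (σ 0)) (h.unit (σ 1)) (h.unit (σ 3)) (h.unit (σ 4))
      (h.unit (σ 2)) (by linarith) (by linarith) h0 h23 h24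
    linarith
  · have := sum_sq_ge_of_three_right (h.neg.unit (σ 3)) (h.neg.unit (σ 4)) (h.neg.unit (σ 0))
      (h.neg.unit (σ 1)) (h.neg.unit (σ 2)) (by linarith) (by linarith) (by linarith)
      (by linarith) (by linarith)
    linarith

theorem UnitClosed.sum_sq_add {A B : Fin 5 → ℝ} (h : UnitClosed A B) :
    ∑ k, A k ^ 2 + ∑ k, B k ^ 2 = 5 := by
  rw [← Finset.sum_add_distrib, Finset.sum_congr rfl fun k _ => h.unit k]; simp

theorem UnitClosed.quadratic_nonneg {A B : Fin 5 → ℝ} (h : UnitClosed A B) (c s : ℝ) :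
    0 ≤ c ^ 2 * (∑ k, A k ^ 2 - 5 / 4) + 2 * c * s * ∑ k, A k * B k
      + s ^ 2 * (∑ k, B k ^ 2 - 5 / 4) := by
  rcases (add_nonneg (sq_nonneg c) (sq_nonneg s)).eq_or_lt with h0 | h0
  · have hc : c = 0 := by nlinarith [sq_nonneg s, sq_nonneg c]
    have hs : s = 0 := by nlinarith [sq_nonneg s, sq_nonneg c]
    simp [hc, hs]
  · have hr : √(c ^ 2 + s ^ 2) ^ 2 = c ^ 2 + s ^ 2 := Real.sq_sqrt h0.le
    have hr0 : √(c ^ 2 + s ^ 2) ≠ 0 := (Real.sqrt_pos.2 h0).ne'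
    set r := √(c ^ 2 + s ^ 2)
    have hrot := (h.rotate (c := s / r) (s := -(c / r))
      (by field_simp; linarith)).sum_snd_sq_ge
    have hexp : ∑ k, (s / r * B k - -(c / r) * A k) ^ 2
        = (c ^ 2 * ∑ k, A k ^ 2 + 2 * c * s * ∑ k, A k * B k + s ^ 2 * ∑ k, B k ^ 2)
          / r ^ 2 := by
      rw [eq_div_iff (pow_ne_zero 2 hr0), Finset.sum_mul, Finset.mul_sum, Finset.mul_sum,
        Finset.mul_sum, ← Finset.sum_add_distrib, ← Finset.sum_add_distrib]
      refine Finset.sum_congr rfl fun k _ => ?_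
      field_simp
      ring
    rw [hexp, le_div_iff₀ (by positivity), hr] at hrot
    linarith

theorem UnitClosed.det_ge {A B : Fin 5 → ℝ} (h : UnitClosed A B) :
    75 / 16 ≤ (∑ k, A k ^ 2) * (∑ k, B k ^ 2) - (∑ k, A k * B k) ^ 2 := by
  have h5 := h.sum_sq_add
  have q := h.quadratic_nonneg
  set P := ∑ k, A k ^ 2
  set S := ∑ k, B k ^ 2
  set R := ∑ k, A k * B k
  have hS : S = 5 - P := by linarith
  rw [hS] at q ⊢
  by_contra! hlt
  have hD : (P - 5 / 4) * (5 - P - 5 / 4) - R ^ 2 < 0 := by linarith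
  have q1 := q (5 - P - 5 / 4) (-R)
  have q2 := q (-R) (P - 5 / 4)
  nlinarith

end Pentagon

namespace Pentagon

/-! ### Power sums of five unit vectors with vanishing sum -/

theorem sum_pow_four_of_sum_eq_zero {z₀ z₁ z₂ z₃ z₄ w₀ w₁ w₂ w₃ w₄ : ℂ} (h₀ : z₀ * w₀ = 1)
    (h₁ : z₁ * w₁ = 1) (h₂ : z₂ * w₂ = 1) (h₃ : z₃ * w₃ = 1) (h₄ : z₄ * w₄ = 1)
    (hz : z₀ + z₁ + z₂ + z₃ + z₄ = 0) (hw : w₀ + w₁ + w₂ + w₃ + w₄ = 0) :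
    2 * (z₀ ^ 4 + z₁ ^ 4 + z₂ ^ 4 + z₃ ^ 4 + z₄ ^ 4)
      = (z₀ ^ 2 + z₁ ^ 2 + z₂ ^ 2 + z₃ ^ 2 + z₄ ^ 2) ^ 2 := by
  have e4 : z₁ * z₂ * z₃ * z₄ + z₀ * z₂ * z₃ * z₄ + z₀ * z₁ * z₃ * z₄ + z₀ * z₁ * z₂ * z₄
      + z₀ * z₁ * z₂ * z₃ = 0 := by
    linear_combination -(z₁ * z₂ * z₃ * z₄) * h₀ - z₀ * z₂ * z₃ * z₄ * h₁
      - z₀ * z₁ * z₃ * z₄ * h₂ - z₀ * z₁ * z₂ * z₄ * h₃ - z₀ * z₁ * z₂ * z₃ * h₄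
      + z₀ * z₁ * z₂ * z₃ * z₄ * hw
  obtain rfl : z₄ = -(z₀ + z₁ + z₂ + z₃) := by linear_combination hz
  linear_combination -8 * e4

theorem sum_cube_of_sum_eq_zero {z₀ z₁ z₂ z₃ z₄ w₀ w₁ w₂ w₃ w₄ : ℂ} (h₀ : z₀ * w₀ = 1)
    (h₁ : z₁ * w₁ = 1) (h₂ : z₂ * w₂ = 1) (h₃ : z₃ * w₃ = 1) (h₄ : z₄ * w₄ = 1)
    (hz : z₀ + z₁ + z₂ + z₃ + z₄ = 0) (hw : w₀ + w₁ + w₂ + w₃ + w₄ = 0) :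
    2 * (z₀ ^ 3 + z₁ ^ 3 + z₂ ^ 3 + z₃ ^ 3 + z₄ ^ 3)
      = -3 * (z₀ * z₁ * z₂ * z₃ * z₄) * (w₀ ^ 2 + w₁ ^ 2 + w₂ ^ 2 + w₃ ^ 2 + w₄ ^ 2) := by
  have key : ∀ {a b c d e d' e' : ℂ}, d * d' = 1 → e * e' = 1 →
      a * b * c = a * b * c * d * e * (d' * e') := fun {a b c d e d' e'} h h' => by
    linear_combination -(a * b * c) * h - a * b * c * d * d' * h'
  have e3 : z₀ * z₁ * z₂ + z₀ * z₁ * z₃ + z₀ * z₁ * z₄ + z₀ * z₂ * z₃ + z₀ * z₂ * z₄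
      + z₀ * z₃ * z₄ + z₁ * z₂ * z₃ + z₁ * z₂ * z₄ + z₁ * z₃ * z₄ + z₂ * z₃ * z₄
      = z₀ * z₁ * z₂ * z₃ * z₄ * (w₃ * w₄ + w₂ * w₄ + w₂ * w₃ + w₁ * w₄ + w₁ * w₃ + w₁ * w₂
        + w₀ * w₄ + w₀ * w₃ + w₀ * w₂ + w₀ * w₁) := by
    linear_combination key (a := z₀) (b := z₁) (c := z₂) h₃ h₄
      + key (a := z₀) (b := z₁) (c := z₃) h₂ h₄ + key (a := z₀) (b := z₁) (c := z₄) h₂ h₃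
      + key (a := z₀) (b := z₂) (c := z₃) h₁ h₄ + key (a := z₀) (b := z₂) (c := z₄) h₁ h₃
      + key (a := z₀) (b := z₃) (c := z₄) h₁ h₂ + key (a := z₁) (b := z₂) (c := z₃) h₀ h₄
      + key (a := z₁) (b := z₂) (c := z₄) h₀ h₃ + key (a := z₁) (b := z₃) (c := z₄) h₀ h₂
      + key (a := z₂) (b := z₃) (c := z₄) h₀ h₁
  set Z := z₀ * z₁ * z₂ * z₃ * z₄
  obtain rfl : w₄ = -(w₀ + w₁ + w₂ + w₃) := by linear_combination hw
  have : 2 * (z₀ ^ 3 + z₁ ^ 3 + z₂ ^ 3 + z₃ ^ 3 + z₄ ^ 3)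
      = 6 * (z₀ * z₁ * z₂ + z₀ * z₁ * z₃ + z₀ * z₁ * z₄ + z₀ * z₂ * z₃ + z₀ * z₂ * z₄
      + z₀ * z₃ * z₄ + z₁ * z₂ * z₃ + z₁ * z₂ * z₄ + z₁ * z₃ * z₄ + z₂ * z₃ * z₄) := by
    obtain h : z₄ = -(z₀ + z₁ + z₂ + z₃) := by linear_combination hz
    rw [h]; ring
  rw [this, e3]
  ring

variable {A B : Fin 5 → ℝ}

theorem UnitClosed.mul_conj (h : UnitClosed A B) (k : Fin 5) :
    ((A k : ℂ) + B k * Complex.I) * ((A k : ℂ) - B k * Complex.I) = 1 := by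
  have := congrArg (fun r : ℝ => (r : ℂ)) (h.unit k)
  push_cast at this
  linear_combination this - (B k : ℂ) ^ 2 * Complex.I_sq

theorem UnitClosed.sum_add_mul_I (h : UnitClosed A B) :
    ∑ k, ((A k : ℂ) + B k * Complex.I) = 0 := by
  have h1 := congrArg (fun r : ℝ => (r : ℂ)) h.sum_fst
  have h2 := congrArg (fun r : ℝ => (r : ℂ)) h.sum_snd
  push_cast at h1 h2
  rw [Finset.sum_add_distrib, ← Finset.sum_mul, h1, h2]; simp

theorem UnitClosed.sum_sub_mul_I (h : UnitClosed A B) :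
    ∑ k, ((A k : ℂ) - B k * Complex.I) = 0 := by
  have h1 := congrArg (fun r : ℝ => (r : ℂ)) h.sum_fst
  have h2 := congrArg (fun r : ℝ => (r : ℂ)) h.sum_snd
  push_cast at h1 h2
  rw [Finset.sum_sub_distrib, ← Finset.sum_mul, h1, h2]; simp

theorem UnitClosed.sum_snd_sq (h : UnitClosed A B) : ∑ k, B k ^ 2 = 5 - ∑ k, A k ^ 2 := by
  linarith [h.sum_sq_add]

theorem UnitClosed.sum_fst_mul_snd_sq (h : UnitClosed A B) :
    ∑ k, A k * B k ^ 2 = -∑ k, A k ^ 3 := by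
  rw [eq_neg_iff_add_eq_zero, ← Finset.sum_add_distrib, ← h.sum_fst]
  exact Finset.sum_congr rfl fun k _ => by linear_combination A k * h.unit k

theorem UnitClosed.sum_fst_sq_mul_snd (h : UnitClosed A B) :
    ∑ k, A k ^ 2 * B k = -∑ k, B k ^ 3 := by
  rw [eq_neg_iff_add_eq_zero, ← Finset.sum_add_distrib, ← h.sum_snd]
  exact Finset.sum_congr rfl fun k _ => by linear_combination B k * h.unit k

theorem UnitClosed.sum_fst_sq_mul_snd_sq (h : UnitClosed A B) :
    ∑ k, A k ^ 2 * B k ^ 2 = ∑ k, A k ^ 2 - ∑ k, A k ^ 4 := by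
  rw [← Finset.sum_sub_distrib]
  exact Finset.sum_congr rfl fun k _ => by linear_combination A k ^ 2 * h.unit k

theorem UnitClosed.sum_snd_pow_four (h : UnitClosed A B) :
    ∑ k, B k ^ 4 = 5 - 2 * ∑ k, A k ^ 2 + ∑ k, A k ^ 4 := by
  have : ∑ k, B k ^ 4 = ∑ k, (1 - 2 * A k ^ 2 + A k ^ 4) :=
    Finset.sum_congr rfl fun k _ => by
      linear_combination (1 - A k ^ 2 + B k ^ 2) * h.unit k
  rw [this, Finset.sum_add_distrib, Finset.sum_sub_distrib, ← Finset.mul_sum]; simp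

theorem UnitClosed.sum_fst_mul_snd_cube (h : UnitClosed A B) :
    ∑ k, A k * B k ^ 3 = ∑ k, A k * B k - ∑ k, A k ^ 3 * B k := by
  rw [← Finset.sum_sub_distrib]
  exact Finset.sum_congr rfl fun k _ => by linear_combination A k * B k * h.unit k

theorem sum_sq_add_mul_I (h : UnitClosed A B) :
    ∑ k, ((A k : ℂ) + B k * Complex.I) ^ 2
      = ((2 * ∑ k, A k ^ 2 - 5 : ℝ) : ℂ) + ((2 * ∑ k, A k * B k : ℝ) : ℂ) * Complex.I := by
  have h2 := h.sum_snd_sq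
  have : ∑ k, ((A k : ℂ) + B k * Complex.I) ^ 2
      = ((∑ k, A k ^ 2 - ∑ k, B k ^ 2 : ℝ) : ℂ) + ((2 * ∑ k, A k * B k : ℝ) : ℂ) * Complex.I := by
    push_cast
    rw [Finset.mul_sum, Finset.sum_mul, ← Finset.sum_sub_distrib, ← Finset.sum_add_distrib]
    exact Finset.sum_congr rfl fun k _ => by
      linear_combination (B k : ℂ) ^ 2 * Complex.I_sq
  rw [this, h2]; push_cast; ring

theorem sum_cube_add_mul_I (h : UnitClosed A B) :
    ∑ k, ((A k : ℂ) + B k * Complex.I) ^ 3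
      = ((4 * ∑ k, A k ^ 3 : ℝ) : ℂ) - ((4 * ∑ k, B k ^ 3 : ℝ) : ℂ) * Complex.I := by
  have h1 := h.sum_fst_mul_snd_sq
  have h2 := h.sum_fst_sq_mul_snd
  have : ∑ k, ((A k : ℂ) + B k * Complex.I) ^ 3
      = ((∑ k, A k ^ 3 - 3 * ∑ k, A k * B k ^ 2 : ℝ) : ℂ)
        + ((3 * ∑ k, A k ^ 2 * B k - ∑ k, B k ^ 3 : ℝ) : ℂ) * Complex.I := by
    push_cast
    rw [Finset.mul_sum, Finset.mul_sum, ← Finset.sum_sub_distrib, ← Finset.sum_sub_distrib,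
      Finset.sum_mul, ← Finset.sum_add_distrib]
    exact Finset.sum_congr rfl fun k _ => by
      linear_combination (3 * (A k : ℂ) * (B k : ℂ) ^ 2 + (B k : ℂ) ^ 3 * Complex.I)
        * Complex.I_sq
  rw [this, h1, h2]; push_cast; ring

theorem sum_pow_four_add_mul_I (h : UnitClosed A B) :
    ∑ k, ((A k : ℂ) + B k * Complex.I) ^ 4
      = ((8 * ∑ k, A k ^ 4 - 8 * ∑ k, A k ^ 2 + 5 : ℝ) : ℂ)
        + ((8 * ∑ k, A k ^ 3 * B k - 4 * ∑ k, A k * B k : ℝ) : ℂ) * Complex.I := by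
  have h1 := h.sum_fst_sq_mul_snd_sq
  have h2 := h.sum_snd_pow_four
  have h3 := h.sum_fst_mul_snd_cube
  have : ∑ k, ((A k : ℂ) + B k * Complex.I) ^ 4
      = ((∑ k, A k ^ 4 - 6 * ∑ k, A k ^ 2 * B k ^ 2 + ∑ k, B k ^ 4 : ℝ) : ℂ)
        + ((4 * ∑ k, A k ^ 3 * B k - 4 * ∑ k, A k * B k ^ 3 : ℝ) : ℂ) * Complex.I := by
    push_cast
    rw [Finset.mul_sum, Finset.mul_sum, Finset.mul_sum, ← Finset.sum_sub_distrib,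
      ← Finset.sum_sub_distrib, ← Finset.sum_add_distrib, Finset.sum_mul,
      ← Finset.sum_add_distrib]
    exact Finset.sum_congr rfl fun k _ => by
      linear_combination (6 * (A k : ℂ) ^ 2 * (B k : ℂ) ^ 2
        + 4 * A k * (B k : ℂ) ^ 3 * Complex.I + (B k : ℂ) ^ 4 * (Complex.I ^ 2 - 1))
        * Complex.I_sq
  rw [this, h1, h2, h3]; push_cast; ring

theorem UnitClosed.third_moments (h : UnitClosed A B) :
    64 * ((∑ k, A k ^ 3) ^ 2 + (∑ k, B k ^ 3) ^ 2)
      = 9 * ((2 * ∑ k, A k ^ 2 - 5) ^ 2 + 4 * (∑ k, A k * B k) ^ 2) := by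
  have hz := h.sum_add_mul_I
  have hw := h.sum_sub_mul_I
  have hz2 := sum_sq_add_mul_I h
  have hz3 := sum_cube_add_mul_I h
  have hconj : ∀ k, (starRingEnd ℂ) ((A k : ℂ) + B k * Complex.I) = A k - B k * Complex.I :=
    fun k => by simp [sub_eq_add_neg]
  have hw2 := congrArg (starRingEnd ℂ) hz2
  have hw3 := congrArg (starRingEnd ℂ) hz3
  simp only [map_sum, map_pow, hconj] at hw2 hw3
  simp only [map_add, map_sub, map_mul, Complex.conj_ofReal, Complex.conj_I] at hw2 hw3
  rw [Fin.sum_univ_five] at hz hw hz2 hz3 hw2 hw3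
  have m := h.mul_conj
  have m' := fun k => (mul_comm _ _).trans (h.mul_conj k)
  have k1 := sum_cube_of_sum_eq_zero (m 0) (m 1) (m 2) (m 3) (m 4) hz hw
  have k2 := sum_cube_of_sum_eq_zero (m' 0) (m' 1) (m' 2) (m' 3) (m' 4) hw hz
  have k3 := congrArg₂ (· * ·) k1 k2
  have hprod : (((A 0 : ℂ) + B 0 * Complex.I) * (A 1 + B 1 * Complex.I) * (A 2 + B 2 * Complex.I)
      * (A 3 + B 3 * Complex.I) * (A 4 + B 4 * Complex.I))
      * (((A 0 : ℂ) - B 0 * Complex.I) * (A 1 - B 1 * Complex.I) * (A 2 - B 2 * Complex.I)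
      * (A 3 - B 3 * Complex.I) * (A 4 - B 4 * Complex.I)) = 1 := by
    calc _ = (((A 0 : ℂ) + B 0 * Complex.I) * (A 0 - B 0 * Complex.I))
          * (((A 1 : ℂ) + B 1 * Complex.I) * (A 1 - B 1 * Complex.I))
          * (((A 2 : ℂ) + B 2 * Complex.I) * (A 2 - B 2 * Complex.I))
          * (((A 3 : ℂ) + B 3 * Complex.I) * (A 3 - B 3 * Complex.I))
          * (((A 4 : ℂ) + B 4 * Complex.I) * (A 4 - B 4 * Complex.I)) := by ring
      _ = 1 := by simp only [m, one_mul]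
  rw [hz2, hz3, hw2, hw3] at k3
  have k4 : (((64 * ((∑ k, A k ^ 3) ^ 2 + (∑ k, B k ^ 3) ^ 2) : ℝ)) : ℂ)
      = ((9 * ((2 * ∑ k, A k ^ 2 - 5) ^ 2 + 4 * (∑ k, A k * B k) ^ 2) : ℝ) : ℂ) := by
    push_cast at k3 ⊢
    generalize (∑ k, (A k : ℂ) ^ 3) = a at *
    generalize (∑ k, (B k : ℂ) ^ 3) = b at *
    generalize (∑ k, (A k : ℂ) ^ 2) = P at *
    generalize (∑ k, (A k : ℂ) * (B k : ℂ)) = R at *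
    linear_combination k3 + 64 * b ^ 2 * Complex.I_sq - 36 * R ^ 2 * Complex.I_sq
      + 9 * ((2 * P - 5) ^ 2 - 4 * R ^ 2 * Complex.I ^ 2) * hprod
  exact_mod_cast k4

theorem UnitClosed.fourth_moments (h : UnitClosed A B) :
    16 * ∑ k, A k ^ 4 = 16 * ∑ k, A k ^ 2 - 10 + (2 * ∑ k, A k ^ 2 - 5) ^ 2
        - 4 * (∑ k, A k * B k) ^ 2 ∧
      4 * ∑ k, A k ^ 3 * B k = 2 * ∑ k, A k * B k
        + (∑ k, A k * B k) * (2 * ∑ k, A k ^ 2 - 5) := by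
  have hz := h.sum_add_mul_I
  have hw := h.sum_sub_mul_I
  have hz2 := sum_sq_add_mul_I h
  have hz4 := sum_pow_four_add_mul_I h
  have m := h.mul_conj
  rw [Fin.sum_univ_five] at hz hw hz2 hz4
  have k1 := sum_pow_four_of_sum_eq_zero (m 0) (m 1) (m 2) (m 3) (m 4) hz hw
  rw [hz2, hz4] at k1
  have hre := congrArg Complex.re k1
  have him := congrArg Complex.im k1
  simp only [pow_two, Complex.mul_re, Complex.mul_im, Complex.add_re, Complex.add_im,
    Complex.ofReal_re, Complex.ofReal_im, Complex.I_re, Complex.I_im, Complex.re_ofNat,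
    Complex.im_ofNat] at hre him
  simp only [← pow_two] at hre him
  constructor
  · linear_combination hre
  · linear_combination him / 4

end Pentagon

namespace Pentagon

variable {A B : Fin 5 → ℝ}

theorem UnitClosed.sum_quadratic (h : UnitClosed A B) (c d e : ℝ) :
    ∑ k, (c * A k ^ 2 + d * (A k * B k) + e * B k ^ 2)
      = c * ∑ k, A k ^ 2 + d * ∑ k, A k * B k + e * (5 - ∑ k, A k ^ 2) := by
  rw [← h.sum_snd_sq, Finset.sum_add_distrib, Finset.sum_add_distrib, Finset.mul_sum,
    Finset.mul_sum, Finset.mul_sum]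

theorem UnitClosed.sum_cubic (h : UnitClosed A B) (c d e f : ℝ) :
    ∑ k, (c * A k ^ 3 + d * (A k ^ 2 * B k) + e * (A k * B k ^ 2) + f * B k ^ 3)
      = (c - e) * ∑ k, A k ^ 3 + (f - d) * ∑ k, B k ^ 3 := by
  simp only [Finset.sum_add_distrib, ← Finset.mul_sum, h.sum_fst_mul_snd_sq,
    h.sum_fst_sq_mul_snd]
  ring

theorem UnitClosed.sum_quartic (h : UnitClosed A B) (c d e f g : ℝ) :
    ∑ k, (c * A k ^ 4 + d * (A k ^ 3 * B k) + e * (A k ^ 2 * B k ^ 2) + f * (A k * B k ^ 3)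
        + g * B k ^ 4)
      = c * ∑ k, A k ^ 4 + d * ∑ k, A k ^ 3 * B k + e * (∑ k, A k ^ 2 - ∑ k, A k ^ 4)
        + f * (∑ k, A k * B k - ∑ k, A k ^ 3 * B k)
        + g * (5 - 2 * ∑ k, A k ^ 2 + ∑ k, A k ^ 4) := by
  simp only [Finset.sum_add_distrib, ← Finset.mul_sum, h.sum_snd_pow_four,
    h.sum_fst_mul_snd_cube, h.sum_fst_sq_mul_snd_sq]

/-- The bilinear form of the Gram matrix `!![p, r; r, 5 - p]`, evaluated at two of the vectors. -/
def gramForm (A B : Fin 5 → ℝ) (p r : ℝ) (k l : Fin 5) : ℝ :=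
  p * (A k * A l) + r * (A k * B l + B k * A l) + (5 - p) * (B k * B l)

/-- The bilinear form of the adjugate of `!![p, r; r, 5 - p]`, evaluated at two of the vectors. -/
def adjForm (A B : Fin 5 → ℝ) (p r : ℝ) (k l : Fin 5) : ℝ :=
  (5 - p) * (A k * A l) - r * (A k * B l + B k * A l) + p * (B k * B l)

/-- The matrix of the projection to the tangent plane, times `p * (5 - p) - r ^ 2`. -/
def projForm (A B : Fin 5 → ℝ) (p r : ℝ) (k l : Fin 5) : ℝ :=
  (p * (5 - p) - r ^ 2) * ((if k = l then 1 else 0) - 1 / 5) - adjForm A B p r k l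

theorem UnitClosed.sum_gramForm_mul_sq (h : UnitClosed A B) {p r : ℝ} (hp : ∑ k, A k ^ 2 = p)
    (hr : ∑ k, A k * B k = r) (c : ℝ) (k : Fin 5) :
    ∑ l, gramForm A B p r k l * (c + adjForm A B p r k l) ^ 2
      = 2 * c * ((p * A k + r * B k) * ((5 - p) * A k - r * B k) * p
        + ((p * A k + r * B k) * (p * B k - r * A k)
          + (r * A k + (5 - p) * B k) * ((5 - p) * A k - r * B k)) * r
        + (r * A k + (5 - p) * B k) * (p * B k - r * A k) * (5 - p))
      + ((p * A k + r * B k) * ((5 - p) * A k - r * B k) ^ 2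
        - ((p * A k + r * B k) * (p * B k - r * A k) ^ 2
          + 2 * (r * A k + (5 - p) * B k) * ((5 - p) * A k - r * B k) * (p * B k - r * A k)))
          * ∑ l, A l ^ 3
      + ((r * A k + (5 - p) * B k) * (p * B k - r * A k) ^ 2
        - ((r * A k + (5 - p) * B k) * ((5 - p) * A k - r * B k) ^ 2
          + 2 * (p * A k + r * B k) * ((5 - p) * A k - r * B k) * (p * B k - r * A k)))
          * ∑ l, B l ^ 3 := by
  set a := p * A k + r * B k with ha
  set b := r * A k + (5 - p) * B k with hb
  set u := (5 - p) * A k - r * B k with hu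
  set v := p * B k - r * A k with hv
  have key : ∀ l, gramForm A B p r k l * (c + adjForm A B p r k l) ^ 2
      = c ^ 2 * a * A l + c ^ 2 * b * B l
        + (2 * c * a * u * A l ^ 2 + 2 * c * (a * v + b * u) * (A l * B l)
          + 2 * c * b * v * B l ^ 2)
        + (a * u ^ 2 * A l ^ 3 + (2 * a * u * v + b * u ^ 2) * (A l ^ 2 * B l)
          + (a * v ^ 2 + 2 * b * u * v) * (A l * B l ^ 2) + b * v ^ 2 * B l ^ 3) := fun l => by
    have h1 : gramForm A B p r k l = a * A l + b * B l := by rw [gramForm, ha, hb]; ring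
    have h2 : adjForm A B p r k l = u * A l + v * B l := by rw [adjForm, hu, hv]; ring
    rw [h1, h2]; ring
  rw [Finset.sum_congr rfl fun l _ => key l, Finset.sum_add_distrib, Finset.sum_add_distrib,
    Finset.sum_add_distrib, h.sum_quadratic, h.sum_cubic, ← Finset.mul_sum, ← Finset.mul_sum,
    h.sum_fst, h.sum_snd, hp, hr]
  ring

theorem UnitClosed.sum_mul_projForm (h : UnitClosed A B) {p r : ℝ} :
    ∑ k, ∑ l, gramForm A B p r k l * (projForm A B p r k k * projForm A B p r l l)
      = p * ((5 - 2 * p) * ∑ k, A k ^ 3 + 2 * r * ∑ k, B k ^ 3) ^ 2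
        + 2 * r * ((5 - 2 * p) * ∑ k, A k ^ 3 + 2 * r * ∑ k, B k ^ 3)
          * (2 * r * ∑ k, A k ^ 3 - (5 - 2 * p) * ∑ k, B k ^ 3)
        + (5 - p) * (2 * r * ∑ k, A k ^ 3 - (5 - 2 * p) * ∑ k, B k ^ 3) ^ 2 := by
  have hA : ∑ k, A k * projForm A B p r k k
      = -((5 - 2 * p) * ∑ k, A k ^ 3 + 2 * r * ∑ k, B k ^ 3) := by
    have : ∀ k, A k * projForm A B p r k k = (p * (5 - p) - r ^ 2) * (4 / 5) * A k
        + (-(5 - p) * A k ^ 3 + 2 * r * (A k ^ 2 * B k) + -p * (A k * B k ^ 2)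
          + 0 * B k ^ 3) := fun k => by
      rw [projForm, adjForm, if_pos rfl]; ring
    rw [Finset.sum_congr rfl fun k _ => this k, Finset.sum_add_distrib, ← Finset.mul_sum,
      h.sum_fst, h.sum_cubic]
    ring
  have hB : ∑ k, B k * projForm A B p r k k
      = -(2 * r * ∑ k, A k ^ 3 - (5 - 2 * p) * ∑ k, B k ^ 3) := by
    have : ∀ k, B k * projForm A B p r k k = (p * (5 - p) - r ^ 2) * (4 / 5) * B k
        + (0 * A k ^ 3 + -(5 - p) * (A k ^ 2 * B k) + 2 * r * (A k * B k ^ 2)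
          + -p * B k ^ 3) := fun k => by
      rw [projForm, adjForm, if_pos rfl]; ring
    rw [Finset.sum_congr rfl fun k _ => this k, Finset.sum_add_distrib, ← Finset.mul_sum,
      h.sum_snd, h.sum_cubic]
    ring
  have key : ∀ k l, gramForm A B p r k l * (projForm A B p r k k * projForm A B p r l l)
      = p * ((A k * projForm A B p r k k) * (A l * projForm A B p r l l))
        + r * ((A k * projForm A B p r k k) * (B l * projForm A B p r l l))
        + r * ((B k * projForm A B p r k k) * (A l * projForm A B p r l l))
        + (5 - p) * ((B k * projForm A B p r k k) * (B l * projForm A B p r l l)) :=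
    fun k l => by rw [gramForm]; ring
  simp only [key, Finset.sum_add_distrib, ← Finset.mul_sum, ← Finset.sum_mul, hA, hB]
  ring

theorem UnitClosed.sum_gramForm_mul_projForm_sq (h : UnitClosed A B) {p r : ℝ}
    (hp : ∑ k, A k ^ 2 = p) (hr : ∑ k, A k * B k = r) :
    ∑ k, ∑ l, gramForm A B p r k l * projForm A B p r k l ^ 2
      = (p * (5 - p) - r ^ 2) ^ 2 * 3 / 5 * (p ^ 2 + 2 * r ^ 2 + (5 - p) ^ 2)
        - 2 * (p * (5 - p) - r ^ 2) * ∑ k, gramForm A B p r k k * adjForm A B p r k k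
        + ∑ k, ∑ l, gramForm A B p r k l
          * ((p * (5 - p) - r ^ 2) / 5 + adjForm A B p r k l) ^ 2 := by
  set D := p * (5 - p) - r ^ 2 with hD
  have key : ∀ k l, gramForm A B p r k l * projForm A B p r k l ^ 2
      = (if k = l then gramForm A B p r k k * (D ^ 2 * (3 / 5) - 2 * D * adjForm A B p r k k)
          else 0)
        + gramForm A B p r k l * (D / 5 + adjForm A B p r k l) ^ 2 := fun k l => by
    rw [projForm, ← hD]
    split_ifs with hkl
    · subst hkl; ring
    · ring
  have hdiag : ∑ k, gramForm A B p r k k = p ^ 2 + 2 * r ^ 2 + (5 - p) ^ 2 := by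
    have : ∀ k, gramForm A B p r k k = p * A k ^ 2 + 2 * r * (A k * B k) + (5 - p) * B k ^ 2 :=
      fun k => by rw [gramForm]; ring
    rw [Finset.sum_congr rfl fun k _ => this k, h.sum_quadratic, hp, hr]
    ring
  simp only [key, Finset.sum_add_distrib, Finset.sum_ite_eq, Finset.mem_univ, if_true]
  rw [add_left_inj, ← hdiag, Finset.mul_sum, Finset.mul_sum, ← Finset.sum_sub_distrib]
  exact Finset.sum_congr rfl fun k _ => by ring

theorem UnitClosed.sum_gramForm_mul_adjForm (h : UnitClosed A B) {p r : ℝ}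
    (hp : ∑ k, A k ^ 2 = p) (hr : ∑ k, A k * B k = r) :
    ∑ k, gramForm A B p r k k * adjForm A B p r k k
      = p * (5 - p) * ∑ k, A k ^ 4 + 2 * r * (5 - 2 * p) * ∑ k, A k ^ 3 * B k
        + (p ^ 2 + (5 - p) ^ 2 - 4 * r ^ 2) * (p - ∑ k, A k ^ 4)
        + 2 * r * (2 * p - 5) * (r - ∑ k, A k ^ 3 * B k)
        + p * (5 - p) * (5 - 2 * p + ∑ k, A k ^ 4) := by
  have key : ∀ k, gramForm A B p r k k * adjForm A B p r k k
      = p * (5 - p) * A k ^ 4 + 2 * r * (5 - 2 * p) * (A k ^ 3 * B k)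
        + (p ^ 2 + (5 - p) ^ 2 - 4 * r ^ 2) * (A k ^ 2 * B k ^ 2)
        + 2 * r * (2 * p - 5) * (A k * B k ^ 3) + p * (5 - p) * B k ^ 4 := fun k => by
    rw [gramForm, adjForm]; ring
  rw [Finset.sum_congr rfl fun k _ => key k, h.sum_quartic, hp, hr]

theorem UnitClosed.sum_linear_mul (h : UnitClosed A B) {p r : ℝ}
    (hp : ∑ k, A k ^ 2 = p) (hr : ∑ k, A k * B k = r) (a b c d : ℝ) :
    ∑ k, (a * A k + b * B k) * (c * A k + d * B k)
      = a * c * p + (a * d + b * c) * r + b * d * (5 - p) := by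
  rw [← hp, ← hr, ← h.sum_quadratic]
  exact Finset.sum_congr rfl fun k _ => by ring

theorem UnitClosed.sum_linear_mul_mul (h : UnitClosed A B) (a b c d e f : ℝ) :
    ∑ k, (a * A k + b * B k) * (c * A k + d * B k) * (e * A k + f * B k)
      = (a * c * e - (a * d * f + b * c * f + b * d * e)) * ∑ k, A k ^ 3
        + (b * d * f - (b * c * e + a * d * e + a * c * f)) * ∑ k, B k ^ 3 := by
  rw [← h.sum_cubic]
  exact Finset.sum_congr rfl fun k _ => by ring

theorem UnitClosed.sum_sum_gramForm_mul_sq (h : UnitClosed A B) {p r : ℝ}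
    (hp : ∑ k, A k ^ 2 = p) (hr : ∑ k, A k * B k = r) (c : ℝ) :
    ∑ k, ∑ l, gramForm A B p r k l * (c + adjForm A B p r k l) ^ 2
      = 2 * c * (p * (5 - p) - r ^ 2) * (p ^ 2 + 2 * r ^ 2 + (5 - p) ^ 2)
        + (3 * p * (5 - p) ^ 2 + p ^ 3 + r ^ 2 * (30 - 12 * p)) * (∑ l, A l ^ 3) ^ 2
        + (3 * (5 - p) * p ^ 2 + (5 - p) ^ 3 + r ^ 2 * (12 * p - 30)) * (∑ l, B l ^ 3) ^ 2
        + r * (120 * p - 24 * p ^ 2 - 150 + 8 * r ^ 2) * (∑ l, A l ^ 3) * (∑ l, B l ^ 3) := by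
  have e : ∀ k, ∑ l, gramForm A B p r k l * (c + adjForm A B p r k l) ^ 2
      = 2 * c * p * ((p * A k + r * B k) * ((5 - p) * A k + -r * B k))
        + 2 * c * r * ((p * A k + r * B k) * (-r * A k + p * B k))
        + 2 * c * r * ((r * A k + (5 - p) * B k) * ((5 - p) * A k + -r * B k))
        + 2 * c * (5 - p) * ((r * A k + (5 - p) * B k) * (-r * A k + p * B k))
        + (∑ l, A l ^ 3) * ((p * A k + r * B k) * ((5 - p) * A k + -r * B k)
          * ((5 - p) * A k + -r * B k))
        - (∑ l, A l ^ 3) * ((p * A k + r * B k) * (-r * A k + p * B k) * (-r * A k + p * B k))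
        - 2 * (∑ l, A l ^ 3) * ((r * A k + (5 - p) * B k) * ((5 - p) * A k + -r * B k)
          * (-r * A k + p * B k))
        + (∑ l, B l ^ 3) * ((r * A k + (5 - p) * B k) * (-r * A k + p * B k)
          * (-r * A k + p * B k))
        - (∑ l, B l ^ 3) * ((r * A k + (5 - p) * B k) * ((5 - p) * A k + -r * B k)
          * ((5 - p) * A k + -r * B k))
        - 2 * (∑ l, B l ^ 3) * ((p * A k + r * B k) * ((5 - p) * A k + -r * B k)
          * (-r * A k + p * B k)) := fun k => by
    rw [h.sum_gramForm_mul_sq hp hr]; ring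
  simp only [e, Finset.sum_add_distrib, Finset.sum_sub_distrib, ← Finset.mul_sum,
    h.sum_linear_mul hp hr, h.sum_linear_mul_mul]
  ring

theorem UnitClosed.sum_gramForm_mul_minor (h : UnitClosed A B) {p r : ℝ}
    (hp : ∑ k, A k ^ 2 = p) (hr : ∑ k, A k * B k = r) :
    ∑ k, ∑ l, gramForm A B p r k l
        * (projForm A B p r k k * projForm A B p r l l - projForm A B p r k l ^ 2)
      = -(p * (5 - p) - r ^ 2) * (125 / 8 + 85 / 32 * ((2 * p - 5) ^ 2 + 4 * r ^ 2)) := by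
  have h3 := h.third_moments
  obtain ⟨h4, h4'⟩ := h.fourth_moments
  rw [hp, hr] at h3 h4 h4'
  simp only [mul_sub, Finset.sum_sub_distrib]
  rw [h.sum_mul_projForm, h.sum_gramForm_mul_projForm_sq hp hr,
    h.sum_gramForm_mul_adjForm hp hr, h.sum_sum_gramForm_mul_sq hp hr]
  generalize ∑ k, A k ^ 3 = a at *
  generalize ∑ k, B k ^ 3 = b at *
  generalize ∑ k, A k ^ 4 = m at *
  generalize ∑ k, A k ^ 3 * B k = n at *
  obtain rfl : m = (16 * p - 10 + (2 * p - 5) ^ 2 - 4 * r ^ 2) / 16 := by linarith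
  obtain rfl : n = (2 * r + r * (2 * p - 5)) / 4 := by linarith
  linear_combination -(10 / 64) * (p * (5 - p) - r ^ 2) * h3

end Pentagon

namespace Pentagon

variable {A B : Fin 5 → ℝ}

/-! ### Gauss equation for the space of pentagons -/

theorem UnitClosed.eq_zero_of_orthogonal (h : UnitClosed A B) {a b v : Fin 5 → ℝ}
    (hAa : ∑ k, A k * a k = 0) (hBa : ∑ k, B k * a k = 0) (hAb : ∑ k, A k * b k = 0)
    (hBb : ∑ k, B k * b k = 0) (hli : LinearIndependent ℝ ![a, b, fun _ => (1 : ℝ)])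
    (hA : ∑ k, v k * A k = 0) (hB : ∑ k, v k * B k = 0) (ha : ∑ k, v k * a k = 0)
    (hb : ∑ k, v k * b k = 0) (h1 : ∑ k, v k = 0) : v = 0 := by
  have hdet := h.det_ge
  have hli5 : LinearIndependent ℝ ![A, B, a, b, fun _ => (1 : ℝ)] := by
    rw [Fintype.linearIndependent_iff] at hli ⊢
    intro g hg
    have hk : ∀ k, g 0 * A k + g 1 * B k + g 2 * a k + g 3 * b k + g 4 = 0 := fun k => by
      have := congrFun hg k
      simpa [Fin.sum_univ_five] using this
    have e1 : g 0 * ∑ k, A k ^ 2 + g 1 * ∑ k, A k * B k = 0 := by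
      have : ∑ k, A k * (g 0 * A k + g 1 * B k + g 2 * a k + g 3 * b k + g 4) = 0 := by simp [hk]
      have e : ∀ k, A k * (g 0 * A k + g 1 * B k + g 2 * a k + g 3 * b k + g 4)
        = g 0 * A k ^ 2 + g 1 * (A k * B k) + g 2 * (A k * a k) + g 3 * (A k * b k)
          + g 4 * A k := fun k => by ring
      simp only [e, Finset.sum_add_distrib, ← Finset.mul_sum, hAa, hAb, h.sum_fst] at this
      linarith
    have e2 : g 0 * ∑ k, A k * B k + g 1 * ∑ k, B k ^ 2 = 0 := by
      have : ∑ k, B k * (g 0 * A k + g 1 * B k + g 2 * a k + g 3 * b k + g 4) = 0 := by simp [hk]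
      have e : ∀ k, B k * (g 0 * A k + g 1 * B k + g 2 * a k + g 3 * b k + g 4)
        = g 0 * (A k * B k) + g 1 * B k ^ 2 + g 2 * (B k * a k) + g 3 * (B k * b k)
          + g 4 * B k := fun k => by ring
      simp only [e, Finset.sum_add_distrib, ← Finset.mul_sum, hBa, hBb, h.sum_snd] at this
      linarith
    set P := ∑ k, A k ^ 2
    set S := ∑ k, B k ^ 2
    set R := ∑ k, A k * B k
    have hD : P * S - R ^ 2 ≠ 0 := by linarith
    have g0 : g 0 = 0 := (mul_eq_zero.1 (by linear_combination S * e1 - R * e2 :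
      g 0 * (P * S - R ^ 2) = 0)).resolve_right hD
    have g1 : g 1 = 0 := (mul_eq_zero.1 (by linear_combination P * e2 - R * e1 :
      g 1 * (P * S - R ^ 2) = 0)).resolve_right hD
    have := hli ![g 2, g 3, g 4] (by
      ext k
      have := hk k
      simp only [g0, g1] at this
      simp [Fin.sum_univ_three]
      linarith)
    intro i
    fin_cases i
    · exact g0
    · exact g1
    · exact this 0
    · exact this 1
    · exact this 2
  have hspan := hli5.span_eq_top_of_card_eq_finrank (by simp)
  have hall : ∀ w : Fin 5 → ℝ, v ⬝ᵥ w = 0 := fun w => by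
    have hw : w ∈ Submodule.span ℝ (Set.range ![A, B, a, b, fun _ => (1 : ℝ)]) := by
      rw [hspan]; trivial
    induction hw using Submodule.span_induction with
    | mem x hx =>
      obtain ⟨i, rfl⟩ := hx
      fin_cases i
      · exact hA
      · exact hB
      · exact ha
      · exact hb
      · simpa [dotProduct] using h1
    | zero => simp
    | add x y _ _ hx hy => rw [dotProduct_add, hx, hy, add_zero]
    | smul c x _ hx => rw [dotProduct_smul, hx, smul_zero]
  exact dotProduct_self_eq_zero.1 (hall v)

theorem sum_sq_mul_sum_sq_sub_sq_ne_zero {a b : Fin 5 → ℝ}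
    (hli : LinearIndependent ℝ ![a, b, fun _ => (1 : ℝ)]) :
    (∑ k, a k * a k) * (∑ k, b k * b k) - (∑ k, a k * b k) ^ 2 ≠ 0 := by
  intro h0
  have hne : ∑ k, a k * a k ≠ 0 := fun h => by
    have : a = 0 := dotProduct_self_eq_zero.1 h
    exact hli.ne_zero 0 this
  set aa := ∑ k, a k * a k with haa
  set ab := ∑ k, a k * b k with hab
  set bb := ∑ k, b k * b k with hbb
  have hz : (fun k => aa * b k - ab * a k) = 0 := by
    apply dotProduct_self_eq_zero.1
    have e : ∀ k, (aa * b k - ab * a k) * (aa * b k - ab * a k)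
      = aa ^ 2 * (b k * b k) - 2 * aa * ab * (a k * b k) + ab ^ 2 * (a k * a k) :=
      fun k => by ring
    simp only [dotProduct, e, Finset.sum_add_distrib, Finset.sum_sub_distrib, ← Finset.mul_sum,
      ← haa, ← hab, ← hbb]
    linear_combination aa * h0
  rw [Fintype.linearIndependent_iff] at hli
  have := hli ![-ab, aa, 0] (by
    ext k
    have := congrFun hz k
    simp [Fin.sum_univ_three] at this ⊢
    linarith) 1
  exact hne this

theorem UnitClosed.mul_projForm_eq (h : UnitClosed A B) {a b : Fin 5 → ℝ}
    (hAa : ∑ k, A k * a k = 0) (hBa : ∑ k, B k * a k = 0) (hAb : ∑ k, A k * b k = 0)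
    (hBb : ∑ k, B k * b k = 0) (hli : LinearIndependent ℝ ![a, b, fun _ => (1 : ℝ)])
    (ha : ∑ k, a k = 0) (hb : ∑ k, b k = 0) {p r aa ab bb : ℝ} (hp : ∑ k, A k ^ 2 = p)
    (hr : ∑ k, A k * B k = r) (haa : ∑ k, a k * a k = aa) (hab : ∑ k, a k * b k = ab)
    (hbb : ∑ k, b k * b k = bb) (k l : Fin 5) :
    (aa * bb - ab ^ 2) * projForm A B p r k l
      = (p * (5 - p) - r ^ 2)
        * (bb * (a k * a l) - ab * (a k * b l + b k * a l) + aa * (b k * b l)) := by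
  set D := p * (5 - p) - r ^ 2 with hD
  set G := aa * bb - ab ^ 2 with hG
  obtain ⟨v, hv⟩ : ∃ v : Fin 5 → ℝ, v = fun l => G * D * (if k = l then 1 else 0) - G * D / 5
      - G * ((5 - p) * A k - r * B k) * A l - G * (p * B k - r * A k) * B l
      - D * (bb * a k - ab * b k) * a l - D * (aa * b k - ab * a k) * b l := ⟨_, rfl⟩
  have hsum : ∀ X : Fin 5 → ℝ, ∑ l, v l * X l = G * D * X k - G * D / 5 * ∑ l, X l
      - G * ((5 - p) * A k - r * B k) * ∑ l, A l * X l
      - G * (p * B k - r * A k) * ∑ l, B l * X l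
      - D * (bb * a k - ab * b k) * ∑ l, a l * X l
      - D * (aa * b k - ab * a k) * ∑ l, b l * X l := fun X => by
    simp only [hv, sub_mul, Finset.sum_sub_distrib, mul_assoc, ← Finset.mul_sum, ite_mul, one_mul,
      zero_mul, Finset.sum_ite_eq, Finset.mem_univ, if_true]
  have hAA : ∑ k, A k * A k = p := by rw [← hp]; exact Finset.sum_congr rfl fun k _ => by ring
  have hBB : ∑ k, B k * B k = 5 - p := by
    rw [← hp, ← h.sum_snd_sq]; exact Finset.sum_congr rfl fun k _ => by ring
  have hBA : ∑ k, B k * A k = r := by rw [← hr]; exact Finset.sum_congr rfl fun k _ => by ring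
  have haA : ∑ k, a k * A k = 0 := by rw [← hAa]; exact Finset.sum_congr rfl fun k _ => by ring
  have haB : ∑ k, a k * B k = 0 := by rw [← hBa]; exact Finset.sum_congr rfl fun k _ => by ring
  have hbA : ∑ k, b k * A k = 0 := by rw [← hAb]; exact Finset.sum_congr rfl fun k _ => by ring
  have hbB : ∑ k, b k * B k = 0 := by rw [← hBb]; exact Finset.sum_congr rfl fun k _ => by ring
  have hba : ∑ k, b k * a k = ab := by rw [← hab]; exact Finset.sum_congr rfl fun k _ => by ring
  have hz : v = 0 := by
    apply h.eq_zero_of_orthogonal hAa hBa hAb hBb hli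
    · rw [hsum, h.sum_fst, hAA, hBA, haA, hbA, hD]; ring
    · rw [hsum, h.sum_snd, hr, hBB, haB, hbB, hD]; ring
    · rw [hsum, ha, hAa, hBa, haa, hba, hG]; ring
    · rw [hsum, hb, hAb, hBb, hab, hbb, hG]; ring
    · have := hsum 1
      simp only [Pi.one_apply, mul_one, h.sum_fst, h.sum_snd, ha, hb] at this
      rw [this]; simp
  have := congrFun hz l
  rw [hv] at this
  simp only [Pi.zero_apply] at this
  rw [projForm, adjForm, ← hD]
  linear_combination this

/-- The bilinear form `5 * bagOfEdges fifths`. -/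
def cov (v w : Fin 5 → ℝ) : ℝ := ∑ k, v k * w k - (∑ k, v k) * (∑ k, w k) / 5

/-- The curvature of the space of equilateral pentagons as a function of the edge directions. -/
def curvatureOf (t : ℝ) : ℝ := -(2500 + 425 * t) / (4 * (25 - t) ^ 2)

theorem UnitClosed.mul_cov_sub (h : UnitClosed A B) {a b : Fin 5 → ℝ}
    (hAa : ∑ k, A k * a k = 0) (hBa : ∑ k, B k * a k = 0) (hAb : ∑ k, A k * b k = 0)
    (hBb : ∑ k, B k * b k = 0) (hli : LinearIndependent ℝ ![a, b, fun _ => (1 : ℝ)])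
    (ha : ∑ k, a k = 0) (hb : ∑ k, b k = 0) {p r aa ab bb : ℝ} (hp : ∑ k, A k ^ 2 = p)
    (hr : ∑ k, A k * B k = r) (haa : ∑ k, a k * a k = aa) (hab : ∑ k, a k * b k = ab)
    (hbb : ∑ k, b k * b k = bb) (c e : Fin 5 → ℝ) :
    (aa * bb - ab ^ 2) * ((p * (5 - p) - r ^ 2) * cov c e
        - ((5 - p) * ((∑ k, A k * c k) * ∑ k, A k * e k)
          - r * ((∑ k, A k * c k) * (∑ k, B k * e k) + (∑ k, B k * c k) * ∑ k, A k * e k)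
          + p * ((∑ k, B k * c k) * ∑ k, B k * e k)))
      = (p * (5 - p) - r ^ 2)
        * (bb * ((∑ k, a k * c k) * ∑ k, a k * e k)
          - ab * ((∑ k, a k * c k) * (∑ k, b k * e k) + (∑ k, b k * c k) * ∑ k, a k * e k)
          + aa * ((∑ k, b k * c k) * ∑ k, b k * e k)) := by
  have key : ∑ k, ∑ l, c k * e l * ((aa * bb - ab ^ 2) * projForm A B p r k l)
      = ∑ k, ∑ l, c k * e l * ((p * (5 - p) - r ^ 2)
        * (bb * (a k * a l) - ab * (a k * b l + b k * a l) + aa * (b k * b l))) :=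
    Finset.sum_congr rfl fun k _ => Finset.sum_congr rfl fun l _ => by
      rw [h.mul_projForm_eq hAa hBa hAb hBb hli ha hb hp hr haa hab hbb]
  have e1 : ∀ k l, c k * e l * ((aa * bb - ab ^ 2) * projForm A B p r k l)
      = (if k = l then (aa * bb - ab ^ 2) * (p * (5 - p) - r ^ 2) * (c k * e k) else 0)
        - (aa * bb - ab ^ 2) * (p * (5 - p) - r ^ 2) / 5 * (c k * e l)
        - (aa * bb - ab ^ 2) * (5 - p) * ((A k * c k) * (A l * e l))
        + (aa * bb - ab ^ 2) * r * ((A k * c k) * (B l * e l))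
        + (aa * bb - ab ^ 2) * r * ((B k * c k) * (A l * e l))
        - (aa * bb - ab ^ 2) * p * ((B k * c k) * (B l * e l)) := fun k l => by
    rw [projForm, adjForm]
    split_ifs with hkl
    · subst hkl; ring
    · ring
  have e2 : ∀ k l, c k * e l * ((p * (5 - p) - r ^ 2)
        * (bb * (a k * a l) - ab * (a k * b l + b k * a l) + aa * (b k * b l)))
      = (p * (5 - p) - r ^ 2) * bb * ((a k * c k) * (a l * e l))
        - (p * (5 - p) - r ^ 2) * ab * ((a k * c k) * (b l * e l))
        - (p * (5 - p) - r ^ 2) * ab * ((b k * c k) * (a l * e l))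
        + (p * (5 - p) - r ^ 2) * aa * ((b k * c k) * (b l * e l)) := fun k l => by ring
  simp only [e1, e2, Finset.sum_add_distrib, Finset.sum_sub_distrib, Finset.sum_ite_eq,
    Finset.mem_univ, if_true, ← Finset.mul_sum, ← Finset.sum_mul] at key
  rw [cov]
  linear_combination key

theorem UnitClosed.second_form_det (h : UnitClosed A B) {a b : Fin 5 → ℝ}
    (hAa : ∑ k, A k * a k = 0) (hBa : ∑ k, B k * a k = 0) (hAb : ∑ k, A k * b k = 0)
    (hBb : ∑ k, B k * b k = 0) (hli : LinearIndependent ℝ ![a, b, fun _ => (1 : ℝ)])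
    (ha : ∑ k, a k = 0) (hb : ∑ k, b k = 0) {p r aa ab bb : ℝ} (hp : ∑ k, A k ^ 2 = p)
    (hr : ∑ k, A k * B k = r) (haa : ∑ k, a k * a k = aa) (hab : ∑ k, a k * b k = ab)
    (hbb : ∑ k, b k * b k = bb) :
    (p * (5 - p) - r ^ 2) * (2 * (p * ((∑ k, A k * (a k * a k)) * ∑ k, A k * (b k * b k))
        + r * ((∑ k, A k * (a k * a k)) * (∑ k, B k * (b k * b k))
          + (∑ k, B k * (a k * a k)) * ∑ k, A k * (b k * b k))
        + (5 - p) * ((∑ k, B k * (a k * a k)) * ∑ k, B k * (b k * b k)))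
      - 2 * (p * (∑ k, A k * (a k * b k)) ^ 2
        + 2 * r * ((∑ k, A k * (a k * b k)) * ∑ k, B k * (a k * b k))
        + (5 - p) * (∑ k, B k * (a k * b k)) ^ 2))
      = -(aa * bb - ab ^ 2) * (125 / 8 + 85 / 32 * ((2 * p - 5) ^ 2 + 4 * r ^ 2)) := by
  have hG : aa * bb - ab ^ 2 ≠ 0 := by
    rw [← haa, ← hab, ← hbb]; exact sum_sq_mul_sum_sq_sub_sq_ne_zero hli
  have hD : p * (5 - p) - r ^ 2 ≠ 0 := by
    have := h.det_ge
    rw [h.sum_snd_sq, hp, hr] at this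
    linarith
  have hm := h.mul_projForm_eq hAa hBa hAb hBb hli ha hb hp hr haa hab hbb
  have hW := h.sum_gramForm_mul_minor hp hr
  set D := p * (5 - p) - r ^ 2 with hDdef
  set G := aa * bb - ab ^ 2 with hGdef
  have hminor : ∀ k l, D ^ 2 * (a k * b l - a l * b k) ^ 2
      = G * (projForm A B p r k k * projForm A B p r l l - projForm A B p r k l ^ 2) :=
    fun k l => mul_left_cancel₀ hG (by
      have e : G * (G * (projForm A B p r k k * projForm A B p r l l - projForm A B p r k l ^ 2))
          = (G * projForm A B p r k k) * (G * projForm A B p r l l)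
            - (G * projForm A B p r k l) ^ 2 := by ring
      rw [e, hm, hm, hm, hGdef]; ring)
  have hsum : D ^ 2 * ∑ k, ∑ l, gramForm A B p r k l * (a k * b l - a l * b k) ^ 2
      = G * ∑ k, ∑ l, gramForm A B p r k l
        * (projForm A B p r k k * projForm A B p r l l - projForm A B p r k l ^ 2) := by
    simp only [Finset.mul_sum]
    exact Finset.sum_congr rfl fun k _ => Finset.sum_congr rfl fun l _ => by
      linear_combination gramForm A B p r k l * hminor k l
  rw [hW] at hsum
  have e1 : ∀ k l, gramForm A B p r k l * (a k * b l - a l * b k) ^ 2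
      = p * ((A k * (a k * a k)) * (A l * (b l * b l)))
        + r * ((A k * (a k * a k)) * (B l * (b l * b l)))
        + r * ((B k * (a k * a k)) * (A l * (b l * b l)))
        + (5 - p) * ((B k * (a k * a k)) * (B l * (b l * b l)))
        + p * ((A k * (b k * b k)) * (A l * (a l * a l)))
        + r * ((A k * (b k * b k)) * (B l * (a l * a l)))
        + r * ((B k * (b k * b k)) * (A l * (a l * a l)))
        + (5 - p) * ((B k * (b k * b k)) * (B l * (a l * a l)))
        - 2 * p * ((A k * (a k * b k)) * (A l * (a l * b l)))
        - 2 * r * ((A k * (a k * b k)) * (B l * (a l * b l)))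
        - 2 * r * ((B k * (a k * b k)) * (A l * (a l * b l)))
        - 2 * (5 - p) * ((B k * (a k * b k)) * (B l * (a l * b l))) := fun k l => by
    rw [gramForm]; ring
  simp only [e1, Finset.sum_add_distrib, Finset.sum_sub_distrib, ← Finset.mul_sum,
    ← Finset.sum_mul] at hsum
  apply mul_left_cancel₀ hD
  linear_combination hsum

theorem bagOfEdges_fifths (v w : Fin 5 → ℝ) : bagOfEdges fifths v w = cov v w / 5 := by
  simp only [bagOfEdges, fifths, cov, Fin.sum_univ_five]
  simp
  ring

theorem cov_comm (v w : Fin 5 → ℝ) : cov v w = cov w v := by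
  simp only [cov, mul_comm]

theorem cov_sub_const (v w : Fin 5 → ℝ) (m : ℝ) : cov (fun k => v k - m) w = cov v w := by
  simp only [cov, sub_mul, Finset.sum_sub_distrib, ← Finset.mul_sum]
  simp
  ring

theorem linearIndependent_sub_const {a b : Fin 5 → ℝ}
    (hli : LinearIndependent ℝ ![a, b, fun _ => (1 : ℝ)]) (m n : ℝ) :
    LinearIndependent ℝ ![fun k => a k - m, fun k => b k - n, fun _ => (1 : ℝ)] := by
  rw [Fintype.linearIndependent_iff] at hli ⊢
  intro g hg
  have := hli ![g 0, g 1, g 2 - g 0 * m - g 1 * n] (by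
    ext k
    have := congrFun hg k
    simp [Fin.sum_univ_three] at this ⊢
    linarith)
  have h0 : g 0 = 0 := this 0
  have h1 : g 1 = 0 := this 1
  have h2 : g 2 - g 0 * m - g 1 * n = 0 := this 2
  intro i
  fin_cases i
  · exact h0
  · exact h1
  · simpa [h0, h1] using h2

theorem sum_mul_shift {A a b : Fin 5 → ℝ} (hA : ∑ k, A k = 0) (ha : ∑ k, A k * a k = 0)
    (hb : ∑ k, A k * b k = 0) (m n : ℝ) :
    ∑ k, A k * ((a k - m) * (b k - n)) = ∑ k, A k * (a k * b k) := by
  have e : ∀ k, A k * ((a k - m) * (b k - n))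
      = A k * (a k * b k) - n * (A k * a k) - m * (A k * b k) + m * n * A k := fun k => by ring
  simp only [e, Finset.sum_add_distrib, Finset.sum_sub_distrib, ← Finset.mul_sum, hA, ha, hb]
  ring

theorem sum_mul_sub_const {A a : Fin 5 → ℝ} (hA : ∑ k, A k = 0) (ha : ∑ k, A k * a k = 0)
    (m : ℝ) : ∑ k, A k * (a k - m) = 0 := by
  simp only [mul_sub, Finset.sum_sub_distrib, ← Finset.sum_mul, hA, ha]; ring

theorem cov_eq_of_sum_eq_zero {a : Fin 5 → ℝ} (ha : ∑ k, a k = 0) (x : Fin 5 → ℝ) :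
    cov a x = ∑ k, a k * x k := by
  rw [cov, ha]; ring

theorem UnitClosed.gauss_of_sum_eq_zero (h : UnitClosed A B) {a b c d e : Fin 5 → ℝ}
    (hAa : ∑ k, A k * a k = 0) (hBa : ∑ k, B k * a k = 0) (hAb : ∑ k, A k * b k = 0)
    (hBb : ∑ k, B k * b k = 0) (hli : LinearIndependent ℝ ![a, b, fun _ => (1 : ℝ)])
    (ha : ∑ k, a k = 0) (hb : ∑ k, b k = 0)
    (hAc : ∑ k, A k * c k = ∑ k, B k * (a k * a k))
    (hBc : ∑ k, B k * c k = -∑ k, A k * (a k * a k))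
    (hAd : ∑ k, A k * d k = ∑ k, B k * (a k * b k))
    (hBd : ∑ k, B k * d k = -∑ k, A k * (a k * b k))
    (hAe : ∑ k, A k * e k = ∑ k, B k * (b k * b k))
    (hBe : ∑ k, B k * e k = -∑ k, A k * (b k * b k)) :
    5 * (((cov c e - cov d d) * (cov a a * cov b b - cov a b ^ 2)
        - (cov c a * cov e a * cov b b - cov a b * (cov c a * cov e b + cov c b * cov e a)
          + cov c b * cov e b * cov a a))
        + (cov d a ^ 2 * cov b b - 2 * cov a b * cov d a * cov d b + cov d b ^ 2 * cov a a))
      / (cov a a * cov b b - cov a b ^ 2) ^ 2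
      = curvatureOf ((2 * ∑ k, A k ^ 2 - 5) ^ 2 + 4 * (∑ k, A k * B k) ^ 2) := by
  obtain ⟨p, hp⟩ : ∃ p, ∑ k, A k ^ 2 = p := ⟨_, rfl⟩
  obtain ⟨r, hr⟩ : ∃ r, ∑ k, A k * B k = r := ⟨_, rfl⟩
  have hG := sum_sq_mul_sum_sq_sub_sq_ne_zero hli
  have hdet := h.det_ge
  have hce := h.mul_cov_sub hAa hBa hAb hBb hli ha hb hp hr rfl rfl rfl c e
  have hdd := h.mul_cov_sub hAa hBa hAb hBb hli ha hb hp hr rfl rfl rfl d d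
  have hII := h.second_form_det hAa hBa hAb hBb hli ha hb hp hr rfl rfl rfl
  rw [h.sum_snd_sq, hp, hr] at hdet
  rw [hp, hr, cov_comm c a, cov_comm c b, cov_comm d a, cov_comm d b, cov_comm e a,
    cov_comm e b]
  simp only [cov_eq_of_sum_eq_zero ha, cov_eq_of_sum_eq_zero hb]
  rw [hAc, hBc, hAe, hBe] at hce
  rw [hAd, hBd] at hdd
  generalize ∑ k, a k * a k = aa at *
  generalize ∑ k, a k * b k = ab at *
  generalize ∑ k, b k * b k = bb at *
  generalize ∑ k, A k * (a k * a k) = α₁ at *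
  generalize ∑ k, A k * (a k * b k) = α₂ at *
  generalize ∑ k, A k * (b k * b k) = α₃ at *
  generalize ∑ k, B k * (a k * a k) = β₁ at *
  generalize ∑ k, B k * (a k * b k) = β₂ at *
  generalize ∑ k, B k * (b k * b k) = β₃ at *
  generalize ∑ k, a k * c k = ac at *
  generalize ∑ k, b k * c k = bc at *
  generalize ∑ k, a k * d k = ad at *
  generalize ∑ k, b k * d k = bd at *
  generalize ∑ k, a k * e k = ae at *
  generalize ∑ k, b k * e k = be at *
  have ht : 25 - ((2 * p - 5) ^ 2 + 4 * r ^ 2) = 4 * (p * (5 - p) - r ^ 2) := by ring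
  have hD : p * (5 - p) - r ^ 2 ≠ 0 := by linarith
  rw [curvatureOf, ht, div_eq_div_iff (pow_ne_zero 2 hG) (by positivity)]
  apply mul_left_cancel₀ hD
  linear_combination 320 * (p * (5 - p) - r ^ 2) ^ 2 * (hce - hdd)
    + 160 * (aa * bb - ab ^ 2) * (p * (5 - p) - r ^ 2) * hII

theorem UnitClosed.gauss (h : UnitClosed A B) {a b c d e : Fin 5 → ℝ}
    (hAa : ∑ k, A k * a k = 0) (hBa : ∑ k, B k * a k = 0) (hAb : ∑ k, A k * b k = 0)
    (hBb : ∑ k, B k * b k = 0) (hli : LinearIndependent ℝ ![a, b, fun _ => (1 : ℝ)])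
    (hAc : ∑ k, A k * c k = ∑ k, B k * (a k * a k))
    (hBc : ∑ k, B k * c k = -∑ k, A k * (a k * a k))
    (hAd : ∑ k, A k * d k = ∑ k, B k * (a k * b k))
    (hBd : ∑ k, B k * d k = -∑ k, A k * (a k * b k))
    (hAe : ∑ k, A k * e k = ∑ k, B k * (b k * b k))
    (hBe : ∑ k, B k * e k = -∑ k, A k * (b k * b k)) :
    5 * (((cov c e - cov d d) * (cov a a * cov b b - cov a b ^ 2)
        - (cov c a * cov e a * cov b b - cov a b * (cov c a * cov e b + cov c b * cov e a)
          + cov c b * cov e b * cov a a))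
        + (cov d a ^ 2 * cov b b - 2 * cov a b * cov d a * cov d b + cov d b ^ 2 * cov a a))
      / (cov a a * cov b b - cov a b ^ 2) ^ 2
      = curvatureOf ((2 * ∑ k, A k ^ 2 - 5) ^ 2 + 4 * (∑ k, A k * B k) ^ 2) := by
  obtain ⟨m, hm⟩ : ∃ m, m = (∑ k, a k) / 5 := ⟨_, rfl⟩
  obtain ⟨n, hn⟩ : ∃ n, n = (∑ k, b k) / 5 := ⟨_, rfl⟩
  have key := h.gauss_of_sum_eq_zero (a := fun k => a k - m) (b := fun k => b k - n) (c := c)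
    (d := d) (e := e) (sum_mul_sub_const h.sum_fst hAa m) (sum_mul_sub_const h.sum_snd hBa m)
    (sum_mul_sub_const h.sum_fst hAb n) (sum_mul_sub_const h.sum_snd hBb n)
    (linearIndependent_sub_const hli m n)
    (by rw [Finset.sum_sub_distrib, hm]; simp; ring)
    (by rw [Finset.sum_sub_distrib, hn]; simp; ring)
    (by rw [hAc, sum_mul_shift h.sum_snd hBa hBa])
    (by rw [hBc, sum_mul_shift h.sum_fst hAa hAa])
    (by rw [hAd, sum_mul_shift h.sum_snd hBa hBb])
    (by rw [hBd, sum_mul_shift h.sum_fst hAa hAb])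
    (by rw [hAe, sum_mul_shift h.sum_snd hBb hBb])
    (by rw [hBe, sum_mul_shift h.sum_fst hAb hAb])
  have hr : ∀ (x v : Fin 5 → ℝ) (m : ℝ), cov x (fun k => v k - m) = cov x v := fun x v m => by
    rw [cov_comm, cov_sub_const, cov_comm]
  simpa only [hr, cov_sub_const] using key

end Pentagon

namespace Pentagon

/-! ### Derivatives of the first fundamental form -/

theorem closes_coe_iff (θ : Fin 5 → ℝ) :
    Closes fifths (fun k => (θ k : Real.Angle))
      ↔ ∑ k, Real.cos (θ k) = 0 ∧ ∑ k, Real.sin (θ k) = 0 := by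
  have e : ∀ k, ((fifths k : ℝ) : ℂ) * (((θ k : Real.Angle)).toCircle : ℂ)
      = (1 / 5 : ℂ) * (((Real.cos (θ k) : ℝ) : ℂ) + ((Real.sin (θ k) : ℝ) : ℂ) * Complex.I) :=
    fun k => by
      rw [Real.Angle.toCircle_coe, Circle.coe_exp, Complex.exp_mul_I, ← Complex.ofReal_cos,
        ← Complex.ofReal_sin, fifths]
      push_cast; ring
  simp only [Closes, e, ← Finset.mul_sum, Finset.sum_add_distrib, ← Finset.sum_mul,
    ← Complex.ofReal_sum]
  generalize ∑ k, Real.cos (θ k) = x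
  generalize ∑ k, Real.sin (θ k) = y
  constructor
  · intro h
    have h' := (mul_eq_zero.1 h).resolve_left (by norm_num)
    exact ⟨by simpa using congrArg Complex.re h', by simpa using congrArg Complex.im h'⟩
  · rintro ⟨h1, h2⟩
    rw [h1, h2]; simp

theorem UnitClosed.of_closes {θ : Fin 5 → ℝ} (h : Closes fifths (fun k => (θ k : Real.Angle))) :
    UnitClosed (fun k => Real.cos (θ k)) (fun k => Real.sin (θ k)) where
  unit _ := Real.cos_sq_add_sin_sq _
  sum_fst := ((closes_coe_iff θ).1 h).1
  sum_snd := ((closes_coe_iff θ).1 h).2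

theorem fderiv_cov {f g : ℝ × ℝ → Fin 5 → ℝ} {u : ℝ × ℝ} (hf : DifferentiableAt ℝ f u)
    (hg : DifferentiableAt ℝ g u) (w : ℝ × ℝ) :
    fderiv ℝ (fun v => cov (f v) (g v)) u w
      = cov (fderiv ℝ f u w) (g u) + cov (f u) (fderiv ℝ g u w) := by
  have hf' := hasFDerivAt_pi'.1 hf.hasFDerivAt
  have hg' := hasFDerivAt_pi'.1 hg.hasFDerivAt
  have h1 := HasFDerivAt.fun_sum (u := Finset.univ) fun k _ => (hf' k).mul (hg' k)
  have h2 := (HasFDerivAt.fun_sum (u := Finset.univ) fun k _ => hf' k).mul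
    (HasFDerivAt.fun_sum (u := Finset.univ) fun k _ => hg' k)
  have h3 := h1.sub (h2.mul_const (1 / 5 : ℝ))
  have e : (fun v => cov (f v) (g v)) = fun v => ∑ k, f v k * g v k
      - ((∑ k, f v k) * ∑ k, g v k) * (1 / 5 : ℝ) := by
    funext v; rw [cov]; ring
  rw [e]
  refine (congrArg (· w) (HasFDerivAt.fderiv h3)).trans ?_
  have hcomm : ∑ k, g u k * fderiv ℝ f u w k = ∑ k, fderiv ℝ f u w k * g u k :=
    Finset.sum_congr rfl fun k _ => mul_comm _ _
  simp [cov, Finset.sum_add_distrib]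
  linear_combination hcomm

theorem fderiv_sum_cos_mul {φ f : ℝ × ℝ → Fin 5 → ℝ} {u : ℝ × ℝ} (hφ : DifferentiableAt ℝ φ u)
    (hf : DifferentiableAt ℝ f u) (w : ℝ × ℝ) :
    fderiv ℝ (fun v => ∑ k, Real.cos (φ v k) * f v k) u w
      = ∑ k, Real.cos (φ u k) * fderiv ℝ f u w k
        - ∑ k, Real.sin (φ u k) * (f u k * fderiv ℝ φ u w k) := by
  have hφ' := hasFDerivAt_pi'.1 hφ.hasFDerivAt
  have hf' := hasFDerivAt_pi'.1 hf.hasFDerivAt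
  have h1 := HasFDerivAt.fun_sum (u := Finset.univ) fun k _ => (hφ' k).cos.mul (hf' k)
  refine (congrArg (· w) (HasFDerivAt.fderiv h1)).trans ?_
  simp [← Finset.sum_sub_distrib]
  exact Finset.sum_congr rfl fun k _ => by ring

theorem fderiv_sum_sin_mul {φ f : ℝ × ℝ → Fin 5 → ℝ} {u : ℝ × ℝ} (hφ : DifferentiableAt ℝ φ u)
    (hf : DifferentiableAt ℝ f u) (w : ℝ × ℝ) :
    fderiv ℝ (fun v => ∑ k, Real.sin (φ v k) * f v k) u w
      = ∑ k, Real.sin (φ u k) * fderiv ℝ f u w k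
        + ∑ k, Real.cos (φ u k) * (f u k * fderiv ℝ φ u w k) := by
  have hφ' := hasFDerivAt_pi'.1 hφ.hasFDerivAt
  have hf' := hasFDerivAt_pi'.1 hf.hasFDerivAt
  have h1 := HasFDerivAt.fun_sum (u := Finset.univ) fun k _ => (hφ' k).sin.mul (hf' k)
  refine (congrArg (· w) (HasFDerivAt.fderiv h1)).trans ?_
  simp [← Finset.sum_add_distrib]
  exact Finset.sum_congr rfl fun k _ => by ring

section Smooth

variable {U : Set (ℝ × ℝ)} {V : Type*} [NormedAddCommGroup V] [NormedSpace ℝ V]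

theorem fderiv_congr_of_eqOn (hU : IsOpen U) {f g : ℝ × ℝ → V} (h : Set.EqOn f g U) {u : ℝ × ℝ}
    (hu : u ∈ U) : fderiv ℝ f u = fderiv ℝ g u :=
  (h.eventuallyEq_of_mem (hU.mem_nhds hu)).fderiv_eq

theorem contDiffOn_partial₁ (hU : IsOpen U) {f : ℝ × ℝ → V} (hf : ContDiffOn ℝ ∞ f U) :
    ContDiffOn ℝ ∞ (partial₁ f) U :=
  (hf.fderiv_of_isOpen hU (by simp)).clm_apply contDiffOn_const

theorem contDiffOn_partial₂ (hU : IsOpen U) {f : ℝ × ℝ → V} (hf : ContDiffOn ℝ ∞ f U) :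
    ContDiffOn ℝ ∞ (partial₂ f) U :=
  (hf.fderiv_of_isOpen hU (by simp)).clm_apply contDiffOn_const

theorem differentiableAt_of_contDiffOn (hU : IsOpen U) {f : ℝ × ℝ → V}
    (hf : ContDiffOn ℝ ∞ f U) {u : ℝ × ℝ} (hu : u ∈ U) : DifferentiableAt ℝ f u :=
  (hf.contDiffAt (hU.mem_nhds hu)).differentiableAt (by simp)

theorem partial₁_partial₂ (hU : IsOpen U) {f : ℝ × ℝ → V} (hf : ContDiffOn ℝ ∞ f U)
    {u : ℝ × ℝ} (hu : u ∈ U) : partial₁ (partial₂ f) u = partial₂ (partial₁ f) u := by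
  have hd : DifferentiableAt ℝ (fderiv ℝ f) u :=
    differentiableAt_of_contDiffOn hU (hf.fderiv_of_isOpen hU (m := ∞) (by simp)) hu
  have hs : IsSymmSndFDerivAt ℝ f u :=
    (hf.contDiffAt (hU.mem_nhds hu)).isSymmSndFDerivAt (by
      rw [minSmoothness_of_isRCLikeNormedField]
      exact WithTop.coe_le_coe.2 (le_top : (2 : ℕ∞) ≤ ⊤))
  have h : ∀ w : ℝ × ℝ, fderiv ℝ (fun v => fderiv ℝ f v w) u
      = (fderiv ℝ (fderiv ℝ f) u).flip w := fun w => by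
    rw [fderiv_clm_apply hd (differentiableAt_const w)]; simp
  change fderiv ℝ (fun v => fderiv ℝ f v (0, 1)) u (1, 0)
    = fderiv ℝ (fun v => fderiv ℝ f v (1, 0)) u (0, 1)
  rw [h, h]
  exact hs (1, 0) (0, 1)

end Smooth

theorem bagOfEdges_fifths_comm (v w : Fin 5 → ℝ) :
    bagOfEdges fifths v w = bagOfEdges fifths w v := by
  rw [bagOfEdges_fifths, bagOfEdges_fifths, cov_comm]

theorem fderiv_bagOfEdges {f g : ℝ × ℝ → Fin 5 → ℝ} {u : ℝ × ℝ} (hf : DifferentiableAt ℝ f u)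
    (hg : DifferentiableAt ℝ g u) (w : ℝ × ℝ) :
    fderiv ℝ (fun v => bagOfEdges fifths (f v) (g v)) u w
      = bagOfEdges fifths (fderiv ℝ f u w) (g u) + bagOfEdges fifths (f u) (fderiv ℝ g u w) := by
  have hc : DifferentiableAt ℝ (fun v => cov (f v) (g v)) u := by
    unfold cov; fun_prop
  simp only [bagOfEdges_fifths, div_eq_mul_inv]
  rw [fderiv_mul_const hc]
  simp [fderiv_cov hf hg]
  ring

theorem IsParametrization.sum_sin_mul {U : Set (ℝ × ℝ)} {φ : ℝ × ℝ → Fin 5 → ℝ}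
    (h : IsParametrization U φ) {u : ℝ × ℝ} (hu : u ∈ U) (w : ℝ × ℝ) :
    ∑ k, Real.sin (φ u k) * fderiv ℝ φ u w k = 0 := by
  have h0 : Set.EqOn (fun v => ∑ k, Real.cos (φ v k) * (fun _ _ => (1 : ℝ) : ℝ × ℝ → Fin 5 → ℝ)
      v k) (fun _ => 0) U := fun v hv => by
    simpa using ((closes_coe_iff (φ v)).1 (h.closes v hv)).1
  have h1 := fderiv_congr_of_eqOn h.isOpen h0 hu
  have h2 := fderiv_sum_cos_mul (differentiableAt_of_contDiffOn h.isOpen h.smooth hu)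
    (differentiableAt_const (fun _ => (1 : ℝ))) w
  rw [h1] at h2
  simpa using h2

theorem IsParametrization.sum_cos_mul {U : Set (ℝ × ℝ)} {φ : ℝ × ℝ → Fin 5 → ℝ}
    (h : IsParametrization U φ) {u : ℝ × ℝ} (hu : u ∈ U) (w : ℝ × ℝ) :
    ∑ k, Real.cos (φ u k) * fderiv ℝ φ u w k = 0 := by
  have h0 : Set.EqOn (fun v => ∑ k, Real.sin (φ v k) * (fun _ _ => (1 : ℝ) : ℝ × ℝ → Fin 5 → ℝ)
      v k) (fun _ => 0) U := fun v hv => by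
    simpa using ((closes_coe_iff (φ v)).1 (h.closes v hv)).2
  have h1 := fderiv_congr_of_eqOn h.isOpen h0 hu
  have h2 := fderiv_sum_sin_mul (differentiableAt_of_contDiffOn h.isOpen h.smooth hu)
    (differentiableAt_const (fun _ => (1 : ℝ))) w
  rw [h1] at h2
  simpa using h2.symm

theorem IsParametrization.brioschi_eq {U : Set (ℝ × ℝ)} {φ : ℝ × ℝ → Fin 5 → ℝ}
    (h : IsParametrization U φ) {u : ℝ × ℝ} (hu : u ∈ U) :
    brioschi (metricE φ) (metricF φ) (metricG φ) u
      = curvatureOf ((2 * ∑ k, Real.cos (φ u k) ^ 2 - 5) ^ 2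
        + 4 * (∑ k, Real.cos (φ u k) * Real.sin (φ u k)) ^ 2) := by
  have hU := h.isOpen
  have sa := contDiffOn_partial₁ hU h.smooth
  have sb := contDiffOn_partial₂ hU h.smooth
  have sd := contDiffOn_partial₂ hU sa
  have se := contDiffOn_partial₂ hU sb
  have hφ := fun v hv => differentiableAt_of_contDiffOn hU h.smooth (u := v) hv
  have ha := fun v hv => differentiableAt_of_contDiffOn hU sa (u := v) hv
  have hb := fun v hv => differentiableAt_of_contDiffOn hU sb (u := v) hv
  have hd := fun v hv => differentiableAt_of_contDiffOn hU sd (u := v) hv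
  have he := fun v hv => differentiableAt_of_contDiffOn hU se (u := v) hv
  have hba : ∀ v ∈ U, partial₁ (partial₂ φ) v = partial₂ (partial₁ φ) v := fun v hv =>
    partial₁_partial₂ hU h.smooth hv
  have hthird : partial₁ (partial₂ (partial₂ φ)) u = partial₂ (partial₂ (partial₁ φ)) u := by
    rw [partial₁_partial₂ hU sb hu]
    exact congrArg (· (0, 1)) (fderiv_congr_of_eqOn hU hba hu)
  -- first derivatives of the coefficients
  have E1 : partial₁ (metricE φ) u
      = 2 * bagOfEdges fifths (partial₁ (partial₁ φ) u) (partial₁ φ u) := by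
    refine (fderiv_bagOfEdges (ha u hu) (ha u hu) (1, 0)).trans ?_
    rw [bagOfEdges_fifths_comm (partial₁ φ u)]; exact (two_mul _).symm
  have E2 : ∀ v ∈ U, partial₂ (metricE φ) v
      = 2 * bagOfEdges fifths (partial₂ (partial₁ φ) v) (partial₁ φ v) := fun v hv => by
    refine (fderiv_bagOfEdges (ha v hv) (ha v hv) (0, 1)).trans ?_
    rw [bagOfEdges_fifths_comm (partial₁ φ v)]; exact (two_mul _).symm
  have F1 : partial₁ (metricF φ) u
      = bagOfEdges fifths (partial₁ (partial₁ φ) u) (partial₂ φ u)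
        + bagOfEdges fifths (partial₁ φ u) (partial₂ (partial₁ φ) u) := by
    rw [← hba u hu]
    exact fderiv_bagOfEdges (ha u hu) (hb u hu) (1, 0)
  have F2 : ∀ v ∈ U, partial₂ (metricF φ) v
      = bagOfEdges fifths (partial₂ (partial₁ φ) v) (partial₂ φ v)
        + bagOfEdges fifths (partial₁ φ v) (partial₂ (partial₂ φ) v) := fun v hv =>
    fderiv_bagOfEdges (ha v hv) (hb v hv) (0, 1)
  have G1 : ∀ v ∈ U, partial₁ (metricG φ) v
      = 2 * bagOfEdges fifths (partial₂ (partial₁ φ) v) (partial₂ φ v) := fun v hv => by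
    rw [← hba v hv]
    refine (fderiv_bagOfEdges (hb v hv) (hb v hv) (1, 0)).trans ?_
    rw [bagOfEdges_fifths_comm (partial₂ φ v)]; exact (two_mul _).symm
  have G2 : partial₂ (metricG φ) u
      = 2 * bagOfEdges fifths (partial₂ (partial₂ φ) u) (partial₂ φ u) := by
    refine (fderiv_bagOfEdges (hb u hu) (hb u hu) (0, 1)).trans ?_
    rw [bagOfEdges_fifths_comm (partial₂ φ u)]; exact (two_mul _).symm
  -- second derivatives of the coefficients
  have dda : DifferentiableAt ℝ
      (fun v => bagOfEdges fifths (partial₂ (partial₁ φ) v) (partial₁ φ v)) u := by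
    have := hd u hu
    have := ha u hu
    simp only [bagOfEdges_fifths, cov]; fun_prop
  have ddb : DifferentiableAt ℝ
      (fun v => bagOfEdges fifths (partial₂ (partial₁ φ) v) (partial₂ φ v)) u := by
    have := hd u hu
    have := hb u hu
    simp only [bagOfEdges_fifths, cov]; fun_prop
  have dae : DifferentiableAt ℝ
      (fun v => bagOfEdges fifths (partial₁ φ v) (partial₂ (partial₂ φ) v)) u := by
    have := he u hu
    have := ha u hu
    simp only [bagOfEdges_fifths, cov]; fun_prop
  have E22 : partial₂ (partial₂ (metricE φ)) u
      = 2 * (bagOfEdges fifths (partial₂ (partial₂ (partial₁ φ)) u) (partial₁ φ u)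
        + bagOfEdges fifths (partial₂ (partial₁ φ) u) (partial₂ (partial₁ φ) u)) := by
    refine (congrArg (· (0, 1)) (fderiv_congr_of_eqOn hU E2 hu)).trans ?_
    rw [fderiv_const_mul dda]
    exact congrArg (2 * ·) (fderiv_bagOfEdges (hd u hu) (ha u hu) (0, 1))
  have F12 : partial₁ (partial₂ (metricF φ)) u
      = bagOfEdges fifths (partial₁ (partial₂ (partial₁ φ)) u) (partial₂ φ u)
        + bagOfEdges fifths (partial₂ (partial₁ φ) u) (partial₂ (partial₁ φ) u)
        + (bagOfEdges fifths (partial₁ (partial₁ φ) u) (partial₂ (partial₂ φ) u)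
        + bagOfEdges fifths (partial₁ φ u) (partial₂ (partial₂ (partial₁ φ)) u)) := by
    refine (congrArg (· (1, 0)) (fderiv_congr_of_eqOn hU F2 hu)).trans ?_
    rw [fderiv_fun_add ddb dae, ← hthird]
    nth_rw 2 [← hba u hu]
    exact congrArg₂ (· + ·) (fderiv_bagOfEdges (hd u hu) (hb u hu) (1, 0))
      (fderiv_bagOfEdges (ha u hu) (he u hu) (1, 0))
  have G11 : partial₁ (partial₁ (metricG φ)) u
      = 2 * (bagOfEdges fifths (partial₁ (partial₂ (partial₁ φ)) u) (partial₂ φ u)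
        + bagOfEdges fifths (partial₂ (partial₁ φ) u) (partial₂ (partial₁ φ) u)) := by
    refine (congrArg (· (1, 0)) (fderiv_congr_of_eqOn hU G1 hu)).trans ?_
    rw [fderiv_const_mul ddb]
    nth_rw 2 [← hba u hu]
    exact congrArg (2 * ·) (fderiv_bagOfEdges (hd u hu) (hb u hu) (1, 0))
  -- the closing condition, differentiated
  have fc := fun v hv w => h.sum_sin_mul (u := v) hv w
  have fs := fun v hv w => h.sum_cos_mul (u := v) hv w
  have ss : ∀ w w', DifferentiableAt ℝ (fun v => fderiv ℝ φ v w) u →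
      ∑ k, Real.cos (φ u k) * fderiv ℝ (fun v => fderiv ℝ φ v w) u w' k
        = ∑ k, Real.sin (φ u k) * (fderiv ℝ φ u w k * fderiv ℝ φ u w' k) := fun w w' hw => by
    have h0 : Set.EqOn (fun v => ∑ k, Real.cos (φ v k) * (fun v => fderiv ℝ φ v w) v k)
        (fun _ => 0) U := fun v hv => fs v hv w
    have h1 := fderiv_congr_of_eqOn hU h0 hu
    have h2 := fderiv_sum_cos_mul (hφ u hu) hw w'
    rw [h1] at h2
    simp at h2
    linarith
  have sc : ∀ w w', DifferentiableAt ℝ (fun v => fderiv ℝ φ v w) u →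
      ∑ k, Real.sin (φ u k) * fderiv ℝ (fun v => fderiv ℝ φ v w) u w' k
        = -∑ k, Real.cos (φ u k) * (fderiv ℝ φ u w k * fderiv ℝ φ u w' k) := fun w w' hw => by
    have h0 : Set.EqOn (fun v => ∑ k, Real.sin (φ v k) * (fun v => fderiv ℝ φ v w) v k)
        (fun _ => 0) U := fun v hv => fc v hv w
    have h1 := fderiv_congr_of_eqOn hU h0 hu
    have h2 := fderiv_sum_sin_mul (hφ u hu) hw w'
    rw [h1] at h2
    simp at h2
    linarith
  have key := (UnitClosed.of_closes (h.closes u hu)).gauss (a := partial₁ φ u)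
    (b := partial₂ φ u) (c := partial₁ (partial₁ φ) u) (d := partial₂ (partial₁ φ) u)
    (e := partial₂ (partial₂ φ) u) (fs u hu _) (fc u hu _) (fs u hu _) (fc u hu _)
    (h.regular u hu) (ss _ _ (ha u hu)) (sc _ _ (ha u hu)) (ss _ _ (ha u hu))
    (sc _ _ (ha u hu)) (ss _ _ (hb u hu)) (sc _ _ (hb u hu))
  rw [← key, brioschi, E1, E2 u hu, F1, F2 u hu, G1 u hu, G2, E22, F12, G11]
  simp only [metricE, metricF, metricG, bagOfEdges_fifths, Matrix.det_fin_three,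
    Matrix.of_apply, Matrix.cons_val', Matrix.cons_val_zero, Matrix.cons_val_one,
    Matrix.cons_val]
  have cda := cov_comm (partial₁ φ u) (partial₂ (partial₁ φ) u)
  have cae := cov_comm (partial₁ φ u) (partial₂ (partial₂ φ) u)
  have ca3 := cov_comm (partial₁ φ u) (partial₂ (partial₂ (partial₁ φ)) u)
  have hden : (cov (partial₁ φ u) (partial₁ φ u) / 5 * (cov (partial₂ φ u) (partial₂ φ u) / 5)
      - (cov (partial₁ φ u) (partial₂ φ u) / 5) ^ 2) ^ 2
      = (cov (partial₁ φ u) (partial₁ φ u) * cov (partial₂ φ u) (partial₂ φ u)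
        - cov (partial₁ φ u) (partial₂ φ u) ^ 2) ^ 2 / 625 := by ring
  rw [cda, cae, ca3, hden, div_div_eq_mul_div]
  congr 1
  ring

end Pentagon

namespace Pentagon

/-! ### Existence of parametrizations -/

theorem exists_isParametrization {θ : Fin 5 → ℝ}
    (hθ : Closes fifths (fun k => (θ k : Real.Angle))) (ℓ₁ ℓ₂ ℓ₃ : (Fin 5 → ℝ) →L[ℝ] ℝ)
    (h₁ : ℓ₁ (fun _ => 1) = 0) (h₂ : ℓ₂ (fun _ => 1) = 0) (h₃ : ℓ₃ (fun _ => 1) = 1)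
    (hinj : ∀ v : Fin 5 → ℝ, ℓ₁ v = 0 → ℓ₂ v = 0 → ℓ₃ v = 0 → ∑ k, Real.cos (θ k) * v k = 0 →
      ∑ k, Real.sin (θ k) * v k = 0 → v = 0) :
    ∃ U φ, IsParametrization U φ ∧ (∀ u ∈ U, ℓ₁ (φ u) = u.1 ∧ ℓ₂ (φ u) = u.2) ∧
      (ℓ₁ θ, ℓ₂ θ) ∈ U ∧ φ (ℓ₁ θ, ℓ₂ θ) = θ := by
  obtain ⟨Ψ, hΨ⟩ : ∃ Ψ : (Fin 5 → ℝ) → ℝ × ℝ × ℝ × ℝ × ℝ, Ψ = fun v =>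
    (ℓ₁ v, ℓ₂ v, ℓ₃ v, ∑ k, Real.cos (v k), ∑ k, Real.sin (v k)) := ⟨_, rfl⟩
  have hcd : ContDiff ℝ ω Ψ := by
    rw [hΨ]
    refine ℓ₁.contDiff.prodMk (ℓ₂.contDiff.prodMk (ℓ₃.contDiff.prodMk (ContDiff.prodMk ?_ ?_)))
    · exact ContDiff.sum fun k _ => Real.contDiff_cos.comp (contDiff_apply ℝ ℝ k)
    · exact ContDiff.sum fun k _ => Real.contDiff_sin.comp (contDiff_apply ℝ ℝ k)
  have hc : HasFDerivAt (fun v : Fin 5 → ℝ => ∑ k, Real.cos (v k))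
      (∑ k, -Real.sin (θ k) • ContinuousLinearMap.proj (R := ℝ) (φ := fun _ : Fin 5 => ℝ) k) θ :=
    HasFDerivAt.fun_sum fun k _ => (hasFDerivAt_apply k θ).cos
  have hs : HasFDerivAt (fun v : Fin 5 → ℝ => ∑ k, Real.sin (v k))
      (∑ k, Real.cos (θ k) • ContinuousLinearMap.proj (R := ℝ) (φ := fun _ : Fin 5 => ℝ) k) θ :=
    HasFDerivAt.fun_sum fun k _ => (hasFDerivAt_apply k θ).sin
  have hd := ℓ₁.hasFDerivAt (x := θ) |>.prodMk (ℓ₂.hasFDerivAt (x := θ) |>.prodMk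
    (ℓ₃.hasFDerivAt (x := θ) |>.prodMk (hc.prodMk hs)))
  obtain ⟨L, hL⟩ : ∃ L : (Fin 5 → ℝ) ≃L[ℝ] ℝ × ℝ × ℝ × ℝ × ℝ,
      HasFDerivAt Ψ (L : (Fin 5 → ℝ) →L[ℝ] ℝ × ℝ × ℝ × ℝ × ℝ) θ := by
    set D := ℓ₁.prod (ℓ₂.prod (ℓ₃.prod ((∑ k, -Real.sin (θ k) •
      ContinuousLinearMap.proj (R := ℝ) (φ := fun _ : Fin 5 => ℝ) k).prod
      (∑ k, Real.cos (θ k) • ContinuousLinearMap.proj (R := ℝ) (φ := fun _ : Fin 5 => ℝ) k))))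
      with hD
    have hDinj : Function.Injective (D : (Fin 5 → ℝ) →ₗ[ℝ] ℝ × ℝ × ℝ × ℝ × ℝ) := by
      rw [← LinearMap.ker_eq_bot, LinearMap.ker_eq_bot']
      intro v hv
      simp [hD] at hv
      obtain ⟨v1, v2, v3, v4, v5⟩ := hv
      exact hinj v v1 v2 v3 v5 v4
    refine ⟨(LinearEquiv.ofInjectiveOfFinrankEq _ hDinj (by simp)).toContinuousLinearEquiv, ?_⟩
    have hcoe : ((LinearEquiv.ofInjectiveOfFinrankEq _ hDinj (by simp)).toContinuousLinearEquiv :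
        (Fin 5 → ℝ) →L[ℝ] ℝ × ℝ × ℝ × ℝ × ℝ) = D := ContinuousLinearMap.ext fun v => rfl
    rw [hΨ, hcoe]
    exact hd
  have hcdθ : ContDiffAt ℝ ω Ψ θ := hcd.contDiffAt
  set e := hcdθ.toOpenPartialHomeomorph Ψ hL (by simp) with he
  have hecoe : ∀ v, e v = Ψ v := fun v => rfl
  have hsymm : ContDiffAt ℝ ω e.symm (Ψ θ) := hcdθ.to_localInverse hL (by simp)
  have htgt : Ψ θ ∈ e.target := hcdθ.image_mem_toOpenPartialHomeomorph_target hL (by simp)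
  obtain ⟨s, hs1, hs2, hs3⟩ := mem_nhds_iff.1 ((hsymm.eventually (by simp)).and
    (e.open_target.mem_nhds htgt))
  obtain ⟨ι, hι⟩ : ∃ ι : ℝ × ℝ → ℝ × ℝ × ℝ × ℝ × ℝ, ι = fun u => (u.1, u.2, ℓ₃ θ, 0, 0) :=
    ⟨_, rfl⟩
  have hιcd : ContDiff ℝ ω ι := by
    rw [hι]
    exact contDiff_fst.prodMk (contDiff_snd.prodMk contDiff_const)
  have hθc := (closes_coe_iff θ).1 hθ
  have hιθ : ι (ℓ₁ θ, ℓ₂ θ) = Ψ θ := by simp only [hι, hΨ, hθc.1, hθc.2]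
  have hU : IsOpen (ι ⁻¹' s) := hs2.preimage hιcd.continuous
  have hφs : ContDiffOn ℝ ∞ (fun u => e.symm (ι u)) (ι ⁻¹' s) := fun u hu => by
    have h1 : ContDiffAt ℝ ω e.symm (ι u) := (hs1 hu).1
    exact ((h1.comp u hιcd.contDiffAt).of_le (by simp)).contDiffWithinAt
  have hΨφ : ∀ u ∈ ι ⁻¹' s, ℓ₁ (e.symm (ι u)) = u.1 ∧ ℓ₂ (e.symm (ι u)) = u.2 ∧
      ℓ₃ (e.symm (ι u)) = ℓ₃ θ ∧ ∑ k, Real.cos (e.symm (ι u) k) = 0 ∧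
      ∑ k, Real.sin (e.symm (ι u) k) = 0 := fun u hu => by
    have h1 : Ψ (e.symm (ι u)) = (u.1, u.2, ℓ₃ θ, 0, 0) :=
      (e.right_inv (hs1 hu).2).trans (by rw [hι])
    rw [hΨ] at h1
    simpa only [Prod.mk.injEq] using h1
  have hlin : ∀ (ℓ : (Fin 5 → ℝ) →L[ℝ] ℝ) (g : ℝ × ℝ →L[ℝ] ℝ) (c : ℝ),
      (∀ u ∈ ι ⁻¹' s, ℓ (e.symm (ι u)) = g u + c) → ∀ u ∈ ι ⁻¹' s, ∀ w,
      ℓ (fderiv ℝ (fun u => e.symm (ι u)) u w) = g w := fun ℓ g c h u hu w => by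
    have h1 := fderiv_congr_of_eqOn hU (f := fun u => ℓ (e.symm (ι u))) (g := fun u => g u + c)
      h hu
    have h2 := ℓ.hasFDerivAt.comp u (differentiableAt_of_contDiffOn hU hφs hu).hasFDerivAt
    have h3 : fderiv ℝ (fun u => ℓ (e.symm (ι u))) u = _ := h2.fderiv
    rw [h3, (g.hasFDerivAt.add_const c).fderiv] at h1
    exact congrArg (· w) h1
  refine ⟨ι ⁻¹' s, fun u => e.symm (ι u), ⟨hU, hφs, ?_, ?_⟩, ?_, ?_, ?_⟩
  · intro u hu
    exact (closes_coe_iff _).2 (hΨφ u hu).2.2.2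
  · intro u hu
    rw [Fintype.linearIndependent_iff]
    intro g hg
    have hg' : g 0 • partial₁ (fun u => e.symm (ι u)) u + g 1 • partial₂ (fun u => e.symm (ι u)) u
        + g 2 • (fun _ => (1 : ℝ)) = 0 := by
      rw [← hg, Fin.sum_univ_three]; rfl
    have l1 := hlin ℓ₁ (ContinuousLinearMap.fst ℝ ℝ ℝ) 0
      (fun u hu => by simpa using (hΨφ u hu).1) u hu
    have l2 := hlin ℓ₂ (ContinuousLinearMap.snd ℝ ℝ ℝ) 0
      (fun u hu => by simpa using (hΨφ u hu).2.1) u hu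
    have l3 := hlin ℓ₃ 0 (ℓ₃ θ) (fun u hu => by simpa using (hΨφ u hu).2.2.1) u hu
    have a1 := congrArg ℓ₁ hg'
    have a2 := congrArg ℓ₂ hg'
    have a3 := congrArg ℓ₃ hg'
    simp only [map_add, map_smul, partial₁, partial₂, l1, l2, l3, h₁, h₂, h₃, map_zero] at a1 a2 a3
    intro i
    fin_cases i
    · simpa using a1
    · simpa using a2
    · simpa using a3
  · intro u hu
    exact ⟨(hΨφ u hu).1, (hΨφ u hu).2.1⟩
  · rw [Set.mem_preimage, hιθ]; exact hs3
  · simp only [hιθ]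
    exact hcdθ.localInverse_apply_image hL (by simp)

theorem exists_hasPhases (p : E5) : ∃ θ, HasPhases p θ := by
  induction p using Quotient.inductionOn with
  | h θ =>
    have e : (fun k => (((θ.1 k).toReal : ℝ) : Real.Angle)) = θ.1 :=
      funext fun k => Real.Angle.coe_toReal _
    exact ⟨fun k => (θ.1 k).toReal, by rw [e]; exact θ.2, by simp only [e]; rfl⟩

theorem exists_sin_sub_ne_zero {θ : Fin 5 → ℝ}
    (hθ : Closes fifths (fun k => (θ k : Real.Angle))) : ∃ j, Real.sin (θ j - θ 0) ≠ 0 := by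
  by_contra! h
  have := ((UnitClosed.of_closes hθ).rotate (Real.cos_sq_add_sin_sq (θ 0))).sum_snd_sq_ge
  have e : ∀ k, Real.cos (θ 0) * Real.sin (θ k) - Real.sin (θ 0) * Real.cos (θ k) = 0 :=
    fun k => by rw [← h k, Real.sin_sub]; ring
  norm_num [e] at this

theorem exists_isParametrization_hasPhases (p : E5) :
    ∃ U φ, IsParametrization U φ ∧ ∃ u ∈ U, HasPhases p (φ u) := by
  obtain ⟨θ, hθ, hp⟩ := exists_hasPhases p
  obtain ⟨j, hj⟩ := exists_sin_sub_ne_zero hθ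
  have h0j : 0 ≠ j := by rintro rfl; simp at hj
  obtain ⟨k, l, m, hklm⟩ : ∃ k l m : Fin 5, ∀ x, x ≠ 0 ∧ x ≠ j → x = k ∨ x = l ∨ x = m := by
    clear hj; revert j; decide
  obtain ⟨U, φ, h1, -, h2, h3⟩ := exists_isParametrization hθ
    (ContinuousLinearMap.proj (R := ℝ) (φ := fun _ : Fin 5 => ℝ) k - ContinuousLinearMap.proj m)
    (ContinuousLinearMap.proj (R := ℝ) (φ := fun _ : Fin 5 => ℝ) l - ContinuousLinearMap.proj m)
    (ContinuousLinearMap.proj m) (by simp) (by simp) (by simp) (fun v v1 v2 v3 v4 v5 => by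
      simp at v1 v2 v3
      rw [v3, sub_zero] at v1 v2
      have hz : ∀ x, x ≠ 0 ∧ x ≠ j → v x = 0 := fun x hx => by
        rcases hklm x hx with rfl | rfl | rfl <;> assumption
      rw [Fintype.sum_eq_add 0 j h0j fun x hx => by rw [hz x hx, mul_zero]] at v4 v5
      rw [Real.sin_sub] at hj
      have w0 : v 0 = 0 := (mul_eq_zero.1 (by
        linear_combination Real.sin (θ j) * v4 - Real.cos (θ j) * v5 :
        v 0 * (Real.sin (θ j) * Real.cos (θ 0) - Real.cos (θ j) * Real.sin (θ 0)) = 0)).resolve_right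
        hj
      have wj : v j = 0 := (mul_eq_zero.1 (by
        linear_combination Real.cos (θ 0) * v5 - Real.sin (θ 0) * v4 :
        v j * (Real.sin (θ j) * Real.cos (θ 0) - Real.cos (θ j) * Real.sin (θ 0)) = 0)).resolve_right
        hj
      funext x
      by_cases x0 : x = 0
      · rw [x0, w0]; rfl
      · by_cases xj : x = j
        · rw [xj, wj]; rfl
        · exact hz x ⟨x0, xj⟩)
  exact ⟨U, φ, h1, _, h2, by rw [h3]; exact ⟨hθ, hp⟩⟩

/-! ### The curvature function -/

/-- The squared modulus of the sum of the squares of the edge directions. -/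
def secondMoment (p : E5) : ℝ :=
  Quotient.lift (s := rotationSetoid fifths)
    (fun θ => Complex.normSq (∑ k, ((θ.1 k).toCircle : ℂ) ^ 2))
    (fun θ θ' ⟨α, h⟩ => by
      have e : ∀ k, ((θ'.1 k).toCircle : ℂ) ^ 2
          = (α.toCircle : ℂ) ^ 2 * ((θ.1 k).toCircle : ℂ) ^ 2 := fun k => by
        rw [h k, Real.Angle.toCircle_add, Circle.coe_mul]; ring
      simp only [e, ← Finset.mul_sum, map_mul, map_pow, Circle.normSq_coe, one_pow, one_mul]) p

theorem secondMoment_eq {p : E5} {θ : Fin 5 → ℝ} (h : HasPhases p θ) :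
    secondMoment p = (2 * ∑ k, Real.cos (θ k) ^ 2 - 5) ^ 2
      + 4 * (∑ k, Real.cos (θ k) * Real.sin (θ k)) ^ 2 := by
  obtain ⟨hθ, rfl⟩ := h
  have e : ∀ k, (((θ k : Real.Angle)).toCircle : ℂ)
      = ((Real.cos (θ k) : ℝ) : ℂ) + ((Real.sin (θ k) : ℝ) : ℂ) * Complex.I := fun k => by
    rw [Real.Angle.toCircle_coe, Circle.coe_exp, Complex.exp_mul_I, ← Complex.ofReal_cos,
        ← Complex.ofReal_sin]
  change Complex.normSq (∑ k, (((θ k : Real.Angle)).toCircle : ℂ) ^ 2) = _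
  simp only [e]
  rw [sum_sq_add_mul_I (UnitClosed.of_closes hθ), Complex.normSq_add_mul_I]
  ring

theorem hasGaussianCurvature (p : E5) : HasGaussianCurvature p (curvatureOf (secondMoment p)) :=
  ⟨exists_isParametrization_hasPhases p, fun U φ h u hu hp => by
    rw [h.brioschi_eq hu, secondMoment_eq hp]⟩

theorem secondMoment_nonneg (p : E5) : 0 ≤ secondMoment p := by
  obtain ⟨θ, hθ⟩ := exists_hasPhases p
  rw [secondMoment_eq hθ]
  positivity

theorem secondMoment_le (p : E5) : secondMoment p ≤ 25 / 4 := by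
  obtain ⟨θ, hθ⟩ := exists_hasPhases p
  have h := (UnitClosed.of_closes hθ.1)
  have := h.det_ge
  rw [h.sum_snd_sq] at this
  rw [secondMoment_eq hθ]
  linarith

theorem curvatureOf_mem {t : ℝ} (h0 : 0 ≤ t) (h1 : t ≤ 25 / 4) :
    curvatureOf t ∈ Set.Icc (-11 / 3 : ℝ) (-1) := by
  have hpos : 0 < 4 * (25 - t) ^ 2 := by
    have : 0 < 25 - t := by linarith
    positivity
  rw [curvatureOf, Set.mem_Icc, le_div_iff₀ hpos, div_le_iff₀ hpos]
  constructor <;> nlinarith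

end Pentagon

namespace Pentagon

/-! ### Symmetries of a pentagon -/

open Equiv (swap Perm)

theorem toCircle_injective : Function.Injective Real.Angle.toCircle := fun a b h => by
  rw [← Real.Angle.arg_toCircle a, h, Real.Angle.arg_toCircle]

/-- The number of swaps that preserve `z`. -/
def swapCount (z : Fin 5 → Circle) : ℕ :=
  {τ : Perm (Fin 5) | τ.IsSwap ∧ ∀ k, z (τ k) = z k}.ncard

/-- The number of double swaps that act on `z` like a reflection. -/
def reflectionCount (z : Fin 5 → Circle) : ℕ :=
  {τ : Perm (Fin 5) | τ.cycleType = {2, 2} ∧ ∃ c, ∀ k, z (τ k) * z k = c}.ncard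

theorem permute_mk_eq_iff (θ : {θ : Fin 5 → Real.Angle // Closes fifths θ}) {τ : Perm (Fin 5)}
    (hτ : ∃ m, τ m = m) :
    permute τ (Quotient.mk (rotationSetoid fifths) θ) = Quotient.mk (rotationSetoid fifths) θ
      ↔ ∀ k, (θ.1 (τ k)).toCircle = (θ.1 k).toCircle := by
  refine Quotient.eq.trans ⟨?_, fun h => ⟨0, fun k => ?_⟩⟩
  · rintro ⟨α, h⟩ k
    obtain ⟨m, hm⟩ := hτ
    have h0 := h m
    simp only [hm, left_eq_add] at h0
    rw [h k, h0]; simp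
  · rw [add_zero]; exact (toCircle_injective (h k)).symm

theorem reflect_permute_mk_eq_iff (θ : {θ : Fin 5 → Real.Angle // Closes fifths θ})
    {τ : Perm (Fin 5)} :
    reflect (permute τ (Quotient.mk (rotationSetoid fifths) θ))
        = Quotient.mk (rotationSetoid fifths) θ
      ↔ ∃ c, ∀ k, (θ.1 (τ k)).toCircle * (θ.1 k).toCircle = c := by
  refine Quotient.eq.trans ⟨?_, ?_⟩
  · rintro ⟨α, h⟩
    refine ⟨α.toCircle, fun k => ?_⟩
    rw [h k, ← Real.Angle.toCircle_add]
    simp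
  · rintro ⟨c, h⟩
    refine ⟨θ.1 (τ 0) + θ.1 0, fun k => ?_⟩
    have := (h k).trans (h 0).symm
    rw [← Real.Angle.toCircle_add, ← Real.Angle.toCircle_add] at this
    rw [← toCircle_injective this]
    simp

theorem exists_fixed_of_isSwap : ∀ τ : Perm (Fin 5), τ.IsSwap → ∃ m, τ m = m := by
  rintro τ ⟨x, y, -, rfl⟩
  obtain ⟨m, h1, h2⟩ : ∃ m, m ≠ x ∧ m ≠ y := by revert x y; decide
  exact ⟨m, Equiv.swap_apply_of_ne_of_ne h1 h2⟩

theorem loopCount_mk (θ : {θ : Fin 5 → Real.Angle // Closes fifths θ}) :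
    loopCount (Quotient.mk (rotationSetoid fifths) θ)
      = swapCount (fun k => (θ.1 k).toCircle) + reflectionCount (fun k => (θ.1 k).toCircle) := by
  unfold loopCount swapCount reflectionCount
  congr 2
  · ext τ
    exact and_congr_right fun h => permute_mk_eq_iff θ (exists_fixed_of_isSwap τ h)
  · ext τ
    exact and_congr_right fun _ => reflect_permute_mk_eq_iff θ

theorem swapCount_comp (z : Fin 5 → Circle) (π : Perm (Fin 5)) :
    swapCount (fun k => z (π k)) = swapCount z := by
  unfold swapCount
  rw [← Set.ncard_image_of_injective _ (MulAut.conj π).injective]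
  congr 1
  ext τ
  simp only [Equiv.Perm.isSwap_iff_cycleType]
  constructor
  · rintro ⟨ρ, ⟨h1, h2⟩, rfl⟩
    refine ⟨by rw [MulAut.conj_apply, Equiv.Perm.cycleType_conj, h1], fun k => ?_⟩
    have := h2 (π⁻¹ k)
    simpa using this
  · rintro ⟨h1, h2⟩
    refine ⟨π⁻¹ * τ * π, ⟨?_, fun k => ?_⟩, by simp [mul_assoc]⟩
    · have := Equiv.Perm.cycleType_conj (σ := τ) (τ := π⁻¹)
      rw [inv_inv] at this
      rw [this, h1]
    · have := h2 (π k)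
      simpa using this

theorem reflectionCount_comp (z : Fin 5 → Circle) (π : Perm (Fin 5)) :
    reflectionCount (fun k => z (π k)) = reflectionCount z := by
  unfold reflectionCount
  rw [← Set.ncard_image_of_injective _ (MulAut.conj π).injective]
  congr 1
  ext τ
  constructor
  · rintro ⟨ρ, ⟨h1, c, h2⟩, rfl⟩
    refine ⟨by rw [MulAut.conj_apply, Equiv.Perm.cycleType_conj, h1], c, fun k => ?_⟩
    have := h2 (π⁻¹ k)
    simpa using this
  · rintro ⟨h1, c, h2⟩
    refine ⟨π⁻¹ * τ * π, ⟨?_, c, fun k => ?_⟩, by simp [mul_assoc]⟩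
    · have := Equiv.Perm.cycleType_conj (σ := τ) (τ := π⁻¹)
      rw [inv_inv] at this
      rw [this, h1]
    · have := h2 (π k)
      simpa using this

theorem exists_conj_of_cycleType {τ : Perm (Fin 5)} (h : τ.cycleType = {2, 2}) :
    ∃ π : Perm (Fin 5), τ = π * (swap 0 1 * swap 2 3) * π⁻¹ := by
  have h0 : (swap 0 1 * swap 2 3 : Perm (Fin 5)).cycleType = {2, 2} :=
    Equiv.Perm.cycleType_swap_mul_swap_of_nodup (by decide)
  obtain ⟨π, hπ⟩ := isConj_iff.1 (Equiv.Perm.isConj_iff_cycleType_eq.2 (h0.trans h.symm))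
  exact ⟨π, hπ.symm⟩

theorem cycleType_eq_iff (τ : Perm (Fin 5)) : τ.cycleType = {2, 2} ↔
    τ * τ = 1 ∧ (Finset.univ.filter fun x => τ x = x).card = 1 := by
  have key : ∀ τ : Perm (Fin 5),
      (τ * τ = 1 ∧ (Finset.univ.filter fun x => τ x = x).card = 1)
        ↔ ∃ π : Perm (Fin 5), τ = π * (swap 0 1 * swap 2 3) * π⁻¹ := by decide +kernel
  rw [key]
  refine ⟨exists_conj_of_cycleType, ?_⟩
  rintro ⟨π, rfl⟩
  rw [Equiv.Perm.cycleType_conj]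
  exact Equiv.Perm.cycleType_swap_mul_swap_of_nodup (by decide)

theorem swapCount_eq_of_label {α : Type*} [DecidableEq α] {z : Fin 5 → Circle} {e : Fin 5 → α}
    (h : ∀ i j, z i = z j ↔ e i = e j) :
    swapCount z = (Finset.univ.filter fun τ : Perm (Fin 5) =>
      (∃ x y, x ≠ y ∧ τ = swap x y) ∧ ∀ k, e (τ k) = e k).card := by
  rw [swapCount, ← Set.ncard_coe_finset]
  congr 1
  ext τ
  simp only [Set.mem_ofPred_eq, Finset.coe_filter, Finset.mem_univ, true_and, Equiv.Perm.IsSwap, h]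

theorem reflectionCount_eq_of_label {α : Type*} [DecidableEq α] {z : Fin 5 → Circle}
    {e : Fin 5 → Fin 5 → α} (h : ∀ i j k l, z i * z j = z k * z l ↔ e i j = e k l) :
    reflectionCount z = (Finset.univ.filter fun τ : Perm (Fin 5) =>
      (τ * τ = 1 ∧ (Finset.univ.filter fun x => τ x = x).card = 1)
        ∧ ∀ k, e (τ k) k = e (τ 0) 0).card := by
  rw [reflectionCount, ← Set.ncard_coe_finset]
  congr 1
  ext τ
  simp only [Set.mem_ofPred_eq, Finset.coe_filter, Finset.mem_univ, true_and, cycleType_eq_iff]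
  refine and_congr_right fun _ => ⟨?_, fun h' => ⟨z (τ 0) * z 0, fun k => (h _ _ _ _).2 (h' k)⟩⟩
  rintro ⟨c, hc⟩ k
  exact (h _ _ _ _).1 ((hc k).trans (hc 0).symm)

/-! #### Two pairs of coincident phases -/

theorem mul_eq_sq_of_two_pairs {a b c : Circle} (h : (2 * a + 2 * b + c : ℂ) = 0) :
    (a * b : ℂ) = c ^ 2 := by
  have h' := congrArg (starRingEnd ℂ) h
  simp only [map_add, map_mul, map_ofNat, map_zero, ← Circle.coe_inv_eq_conj, Circle.coe_inv]
    at h'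
  have ha := a.coe_ne_zero
  have hb := b.coe_ne_zero
  have hc := c.coe_ne_zero
  field_simp at h'
  linear_combination h' - c * h

theorem zpow_ne_one_of_quadratic {w : Circle} (h : 2 * (w : ℂ) ^ 2 + w + 2 = 0) {n : ℤ}
    (hn : -4 ≤ n) (hn' : n ≤ 4) (h1 : w ^ n = 1) : n = 0 := by
  have key : ∀ m : ℕ, 1 ≤ m → m ≤ 4 → w ^ m ≠ 1 := by
    intro m hm1 hm4 hm
    have hm' : (w : ℂ) ^ m = 1 := by rw [← Circle.coe_pow, hm, Circle.coe_one]
    interval_cases m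
    · have : (5 : ℂ) = 0 := by linear_combination h - (2 * (w : ℂ) + 3) * hm'
      norm_num at this
    · have hw : (w : ℂ) = -4 := by linear_combination h - 2 * hm'
      rw [hw] at hm'; norm_num at hm'
    · have hw : (w : ℂ) = -2 / 3 := by
        linear_combination (-4 / 3) * hm' + (2 / 3 * (w : ℂ) - 1 / 3) * h
      rw [hw] at hm'; norm_num at hm'
    · have hw : (w : ℂ) = 2 / 7 := by
        linear_combination (8 / 7) * hm' - (4 / 7 * (w : ℂ) ^ 2 - 2 / 7 * w - 3 / 7) * h
      rw [hw] at hm'; norm_num at hm'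
  by_contra hne
  rcases lt_or_gt_of_ne hne with hlt | hgt
  · obtain ⟨m, rfl⟩ := Int.exists_eq_neg_ofNat hlt.le
    refine key m (by omega) (by omega) ?_
    simpa using h1
  · obtain ⟨m, rfl⟩ := Int.eq_ofNat_of_zero_le hgt.le
    refine key m (by omega) (by omega) ?_
    simpa using h1

theorem count_of_two_pairs {z : Fin 5 → Circle} (hz : ∑ k, (z k : ℂ) = 0) (h01 : z 0 = z 1)
    (h23 : z 2 = z 3) : swapCount z = 2 ∧ reflectionCount z = 2 := by
  have hs : (2 * z 1 + 2 * z 3 + z 4 : ℂ) = 0 := by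
    rw [Fin.sum_univ_five, h01, h23] at hz
    linear_combination hz
  have hab := mul_eq_sq_of_two_pairs hs
  obtain ⟨w, hw⟩ : ∃ w, w = z 1 / z 4 := ⟨_, rfl⟩
  have h1 : z 1 = w * z 4 := by rw [hw, div_mul_cancel]
  have h3 : z 3 = w⁻¹ * z 4 := by
    have : z 1 * z 3 = z 4 ^ 2 := by ext; simpa using hab
    rw [hw, inv_div, div_mul_eq_mul_div, eq_div_iff_mul_eq', mul_comm (z 3),
      this, sq]
  have hq : 2 * (w : ℂ) ^ 2 + w + 2 = 0 := by
    rw [h1, h3] at hs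
    have hc := (z 4).coe_ne_zero
    have hw0 := w.coe_ne_zero
    simp only [Circle.coe_mul, Circle.coe_inv] at hs
    field_simp at hs
    exact (mul_eq_zero.1 (by linear_combination hs :
      (z 4 : ℂ) * (2 * (w : ℂ) ^ 2 + w + 2) = 0)).resolve_left hc
  set e : Fin 5 → ℤ := ![1, 1, -1, -1, 0] with he
  have hze : ∀ k, z k = w ^ e k * z 4 := by
    intro k
    fin_cases k
    · simp [he, h01, h1]
    · simp [he, h1]
    · simp [he, h23, h3]
    · simp [he, h3]
    · simp [he]
  have hbd : ∀ k, -1 ≤ e k ∧ e k ≤ 1 := by decide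
  have hpow : ∀ m n : ℤ, -2 ≤ m → m ≤ 2 → -2 ≤ n → n ≤ 2 → (w ^ m = w ^ n ↔ m = n) :=
    fun m n m1 m2 n1 n2 => ⟨fun h => by
      have := zpow_ne_one_of_quadratic hq (n := m - n) (by omega) (by omega)
        (by rw [zpow_sub, h, mul_inv_cancel])
      omega, fun h => by rw [h]⟩
  constructor
  · rw [swapCount_eq_of_label (e := e) fun i j => ?_]
    · rw [he]; decide +kernel
    · rw [hze i, hze j, mul_left_inj]
      have := hbd i
      have := hbd j
      exact hpow _ _ (by omega) (by omega) (by omega) (by omega)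
  · rw [reflectionCount_eq_of_label (e := fun i j => e i + e j) fun i j k l => ?_]
    · rw [he]; decide +kernel
    · rw [hze i, hze j, hze k, hze l, mul_mul_mul_comm, mul_mul_mul_comm (w ^ e k), mul_left_inj,
        ← zpow_add, ← zpow_add]
      have := hbd i
      have := hbd j
      have := hbd k
      have := hbd l
      exact hpow _ _ (by omega) (by omega) (by omega) (by omega)

/-! #### Fifth roots of unity -/

/-- A primitive fifth root of unity. -/
def fifthRoot : Circle := Circle.exp (2 * Real.pi / 5)

theorem orderOf_fifthRoot : orderOf fifthRoot = 5 := by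
  have : Fact (Nat.Prime 5) := ⟨by norm_num⟩
  apply orderOf_eq_prime
  · rw [fifthRoot, ← Circle.exp_natCast_mul]
    rw [show ((5 : ℕ) : ℝ) * (2 * Real.pi / 5) = 2 * Real.pi by push_cast; ring,
      Circle.exp_two_pi]
  · rw [fifthRoot, Ne, Circle.exp_eq_one]
    rintro ⟨n, hn⟩
    have hpi := Real.pi_ne_zero
    have h5 : (5 * n : ℝ) = 1 := by
      field_simp at hn
      linarith
    have : 5 * n = 1 := by exact_mod_cast h5
    omega

theorem count_of_fifth_roots {z : Fin 5 → Circle} {c : Circle}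
    (hz : ∀ k, z k = c * fifthRoot ^ (k : ℕ)) : swapCount z = 0 ∧ reflectionCount z = 5 := by
  constructor
  · rw [swapCount_eq_of_label (e := id) fun i j => ?_]
    · decide +kernel
    · rw [hz, hz, mul_right_inj, pow_eq_pow_iff_modEq, orderOf_fifthRoot, Nat.ModEq,
        Nat.mod_eq_of_lt i.2, Nat.mod_eq_of_lt j.2, ← Fin.ext_iff]; rfl
  · rw [reflectionCount_eq_of_label (e := fun i j => ((i : ℕ) + j) % 5) fun i j k l => ?_]
    · decide +kernel
    · rw [hz i, hz j, hz k, hz l, mul_mul_mul_comm, mul_mul_mul_comm c _ c, mul_right_inj,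
        ← pow_add, ← pow_add, pow_eq_pow_iff_modEq, orderOf_fifthRoot, Nat.ModEq]

end Pentagon

namespace Pentagon

open Equiv (swap Perm)

/-! #### Pentagons with many symmetries -/

theorem not_three_eq {z : Fin 5 → Circle} (hz : ∑ k, (z k : ℂ) = 0) {i j k : Fin 5} (hij : i ≠ j)
    (hik : i ≠ k) (hjk : j ≠ k) (h1 : z i = z j) (h2 : z i = z k) : False := by
  have hnn : ∀ x, 0 ≤ ((z x : ℂ) * ((z i)⁻¹ : Circle)).re + 1 := fun x => by
    have h := Complex.abs_re_le_norm ((z x : ℂ) * ((z i)⁻¹ : Circle))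
    rw [← Circle.coe_mul, Circle.norm_coe, Circle.coe_mul] at h
    linarith [(abs_le.1 h).1]
  have hsum : ∑ x, (((z x : ℂ) * ((z i)⁻¹ : Circle)).re + 1) = 5 := by
    rw [Finset.sum_add_distrib, ← Complex.re_sum, ← Finset.sum_mul, hz]; simp
  have hsub := Finset.sum_le_univ_sum_of_nonneg hnn (s := {i, j, k})
  rw [hsum, Finset.sum_insert (by simp [hij, hik]), Finset.sum_insert (by simp [hjk]),
    Finset.sum_singleton, ← h1, ← h2, ← Circle.coe_mul, mul_inv_cancel, Circle.coe_one] at hsub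
  norm_num at hsub

theorem prod_eq_pow_five {z : Fin 5 → Circle} {τ : Perm (Fin 5)} (hτ : τ.cycleType = {2, 2})
    {c : Circle} (hc : ∀ k, z (τ k) * z k = c) {m : Fin 5} (hm : τ m = m) :
    ∏ k, z k = z m ^ 5 := by
  obtain ⟨π, rfl⟩ := exists_conj_of_cycleType hτ
  have hm4 : m = π 4 := by
    have h1 : (swap 0 1 * swap 2 3 : Perm (Fin 5)) (π⁻¹ m) = π⁻¹ m := by
      apply π.injective
      simpa using hm
    have h2 : ∀ x, (swap 0 1 * swap 2 3 : Perm (Fin 5)) x = x → x = 4 := by decide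
    rw [← h2 _ h1]; simp
  have e1 := hc (π 0)
  have e2 := hc (π 2)
  have e3 := hc (π 4)
  have hi : ∀ x, π⁻¹ (π x) = x := fun x => π.symm_apply_apply x
  have s0 : (swap 0 1 * swap 2 3 : Perm (Fin 5)) 0 = 1 := by decide
  have s2 : (swap 0 1 * swap 2 3 : Perm (Fin 5)) 2 = 3 := by decide
  have s4 : (swap 0 1 * swap 2 3 : Perm (Fin 5)) 4 = 4 := by decide
  simp only [Equiv.Perm.mul_apply (π * _), Equiv.Perm.mul_apply π, hi, s0,
    s2, s4] at e1 e2 e3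
  rw [← Equiv.prod_comp π z, Fin.prod_univ_five, hm4]
  calc z (π 0) * z (π 1) * z (π 2) * z (π 3) * z (π 4)
      = (z (π 1) * z (π 0)) * (z (π 3) * z (π 2)) * z (π 4) := by
        simp only [mul_comm, mul_left_comm]
    _ = z (π 4) ^ 5 := by rw [e1, e2, ← e3]; simp only [pow_succ, pow_zero, one_mul, mul_assoc]

theorem exists_polynomial {z : Fin 5 → Circle} (hz : ∑ k, (z k : ℂ) = 0) :
    ∃ p q : ℂ, ∀ k, (z k : ℂ) ^ 5 + p * (z k : ℂ) ^ 3 - q * (z k : ℂ) ^ 2 - ∏ j, (z j : ℂ) = 0 := by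
  have hw := congrArg (starRingEnd ℂ) hz
  simp only [map_sum, map_zero, ← Circle.coe_inv_eq_conj] at hw
  have h : ∀ k, (z k : ℂ) * ((z k)⁻¹ : Circle) = 1 := fun k => by
    rw [← Circle.coe_mul, mul_inv_cancel, Circle.coe_one]
  rw [Fin.sum_univ_five] at hz hw
  have h₀ := h 0
  have h₁ := h 1
  have h₂ := h 2
  have h₃ := h 3
  have h₄ := h 4
  have e4 : (z 0 * z 1 * z 2 * z 3 + z 0 * z 1 * z 2 * z 4 + z 0 * z 1 * z 3 * z 4
      + z 0 * z 2 * z 3 * z 4 + z 1 * z 2 * z 3 * z 4 : ℂ) = 0 := by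
    linear_combination (-(z 1 * z 2 * z 3 * z 4 : ℂ)) * h₀ - (z 0 * z 2 * z 3 * z 4 : ℂ) * h₁
      - (z 0 * z 1 * z 3 * z 4 : ℂ) * h₂ - (z 0 * z 1 * z 2 * z 4 : ℂ) * h₃
      - (z 0 * z 1 * z 2 * z 3 : ℂ) * h₄ + (z 0 * z 1 * z 2 * z 3 * z 4 : ℂ) * hw
  refine ⟨z 0 * z 1 + z 0 * z 2 + z 0 * z 3 + z 0 * z 4 + z 1 * z 2 + z 1 * z 3 + z 1 * z 4
        + z 2 * z 3 + z 2 * z 4 + z 3 * z 4,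
      z 0 * z 1 * z 2 + z 0 * z 1 * z 3 + z 0 * z 1 * z 4 + z 0 * z 2 * z 3 + z 0 * z 2 * z 4
        + z 0 * z 3 * z 4 + z 1 * z 2 * z 3 + z 1 * z 2 * z 4 + z 1 * z 3 * z 4
        + z 2 * z 3 * z 4, fun k => ?_⟩
  have hk : (z k - z 0 : ℂ) * (z k - z 1) * (z k - z 2) * (z k - z 3) * (z k - z 4) = 0 := by
    fin_cases k <;> simp
  rw [Fin.prod_univ_five]
  linear_combination hk + (z k : ℂ) ^ 4 * hz - (z k : ℂ) * e4

theorem pow_five_eq_of_two_le {z : Fin 5 → Circle} (hz : ∑ k, (z k : ℂ) = 0)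
    (hinj : Function.Injective z) (hr : 2 ≤ reflectionCount z) :
    ∀ k, (z k) ^ 5 = ∏ j, z j := by
  obtain ⟨τ, hτ, τ', hτ', hne⟩ := (Set.one_lt_ncard_iff_nontrivial).1 (Nat.lt_of_succ_le hr)
  obtain ⟨hτ, c, hc⟩ := hτ
  obtain ⟨hτ', c', hc'⟩ := hτ'
  have hfix : ∀ τ : Perm (Fin 5), τ.cycleType = {2, 2} → ∃ m, τ m = m := fun τ h => by
    obtain ⟨m, hm⟩ := Finset.card_eq_one.1 ((cycleType_eq_iff τ).1 h).2
    exact ⟨m, by simpa using (Finset.ext_iff.1 hm m).2 (Finset.mem_singleton_self m)⟩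
  obtain ⟨m, hm⟩ := hfix τ hτ
  obtain ⟨m', hm'⟩ := hfix τ' hτ'
  have hmm : m ≠ m' := by
    rintro rfl
    apply hne
    have hcc : c = c' := by rw [← hc m, ← hc' m, hm, hm']
    ext1 k
    apply hinj
    have := (hc k).trans (hcc.trans (hc' k).symm)
    exact mul_right_cancel this
  have p1 := prod_eq_pow_five hτ hc hm
  have p2 := prod_eq_pow_five hτ' hc' hm'
  obtain ⟨p, q, hpq⟩ := exists_polynomial hz
  have hprod : ((∏ j, z j : Circle) : ℂ) = ∏ j, (z j : ℂ) :=
    map_prod Circle.coeHom z Finset.univ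
  have q1 := hpq m
  have q2 := hpq m'
  rw [← hprod, p1, Circle.coe_pow] at q1
  rw [← hprod, p2, Circle.coe_pow] at q2
  have r1 : p * (z m : ℂ) - q = 0 := (mul_eq_zero.1 (by linear_combination q1 :
    (z m : ℂ) ^ 2 * (p * (z m : ℂ) - q) = 0)).resolve_left (pow_ne_zero 2 (z m).coe_ne_zero)
  have r2 : p * (z m' : ℂ) - q = 0 := (mul_eq_zero.1 (by linear_combination q2 :
    (z m' : ℂ) ^ 2 * (p * (z m' : ℂ) - q) = 0)).resolve_left (pow_ne_zero 2 (z m').coe_ne_zero)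
  have hp : p = 0 := (mul_eq_zero.1 (by linear_combination r1 - r2 :
    p * ((z m : ℂ) - z m') = 0)).resolve_right
    (sub_ne_zero.2 fun h => hmm (hinj (Circle.ext h)))
  have hq : q = 0 := by rw [hp] at r1; linear_combination -r1
  intro k
  have := hpq k
  rw [hp, hq] at this
  ext
  rw [Circle.coe_pow, hprod]
  linear_combination this

theorem swapCount_eq_zero {z : Fin 5 → Circle} (hinj : Function.Injective z) :
    swapCount z = 0 := by
  rw [swapCount, Set.ncard_eq_zero, Set.eq_empty_iff_forall_notMem]
  rintro τ ⟨⟨x, y, hxy, rfl⟩, h⟩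
  exact hxy (hinj (by simpa using (h x).symm))

theorem nodup_four {i j k l : Fin 5} (h1 : i ≠ j) (h2 : i ≠ k) (h3 : i ≠ l) (h4 : j ≠ k)
    (h5 : j ≠ l) (h6 : k ≠ l) : [i, j, k, l].Nodup := by
  simp [h1, h2, h3, h4, h5, h6]

theorem swapCount_le_one {z : Fin 5 → Circle} (hz : ∑ k, (z k : ℂ) = 0)
    (hN : ∀ i j k l, [i, j, k, l].Nodup → z i = z j → z k = z l → False) :
    swapCount z ≤ 1 := by
  rw [swapCount, Set.ncard_le_one]
  rintro τ ⟨⟨x, y, hxy, rfl⟩, h⟩ τ' ⟨⟨x', y', hxy', rfl⟩, h'⟩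
  have e : z x = z y := by simpa using (h x).symm
  have e' : z x' = z y' := by simpa using (h' x').symm
  have t := @not_three_eq z hz
  by_cases h1 : x = x'
  · subst h1
    by_cases h2 : y = y'
    · rw [h2]
    · exact (t hxy hxy' h2 e e').elim
  · by_cases h2 : x = y'
    · subst h2
      by_cases h3 : y = x'
      · rw [h3, Equiv.swap_comm]
      · exact (t hxy hxy'.symm h3 e e'.symm).elim
    · by_cases h3 : y = x'
      · subst h3
        exact (t hxy.symm hxy' h2 e.symm e').elim
      · by_cases h4 : y = y'
        · subst h4
          exact (t hxy.symm hxy'.symm h1 e.symm e'.symm).elim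
        · exact (hN x y x' y' (nodup_four hxy h1 h2 h3 h4 hxy') e e').elim

theorem eq_of_not_mem_four : ∀ i j m x a b : Fin 5, [i, j, m, x].Nodup → [i, j, m, x, a].Nodup →
    [i, j, m, x, b].Nodup → a = b := by decide +kernel

theorem reflectionCount_le_one {z : Fin 5 → Circle} (hz : ∑ k, (z k : ℂ) = 0)
    (hN : ∀ i j k l, [i, j, k, l].Nodup → z i = z j → z k = z l → False) {i j : Fin 5}
    (hij : i ≠ j) (hzij : z i = z j) : reflectionCount z ≤ 1 := by
  have t := @not_three_eq z hz
  have main : ∀ τ : Perm (Fin 5), τ.cycleType = {2, 2} → (∃ c, ∀ k, z (τ k) * z k = c) →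
      ∃ m, τ m = m ∧ τ i = j ∧ τ j = i ∧ (z m : ℂ) = -z i ∧ m ≠ i ∧ m ≠ j ∧
        (∀ x, τ x = x → x = m) ∧ ∀ x, τ (τ x) = x := by
    rintro τ hτ ⟨c, hc⟩
    obtain ⟨hsq, hcard⟩ := (cycleType_eq_iff τ).1 hτ
    obtain ⟨m, hm⟩ := Finset.card_eq_one.1 hcard
    have hfix : ∀ x, τ x = x ↔ x = m := fun x => by simpa using Finset.ext_iff.1 hm x
    have hinv : ∀ x, τ (τ x) = x := fun x => by
      rw [← Equiv.Perm.mul_apply, hsq, Equiv.Perm.one_apply]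
    have hmm := (hfix m).2 rfl
    have hcm := hc m
    rw [hmm] at hcm
    have hmi : m ≠ i := by
      rintro rfl
      have h1 := (hc j).trans hcm.symm
      rw [← hzij, mul_left_inj] at h1
      have h2 : τ j ≠ j := fun h => hij ((hfix j).1 h).symm
      have h3 : τ j ≠ m := fun h => hij (by rw [← hmm, ← h, hinv])
      exact t hij h3.symm h2.symm hzij h1.symm
    have hmj : m ≠ j := by
      rintro rfl
      have h1 := (hc i).trans hcm.symm
      rw [hzij, mul_left_inj] at h1
      have h2 : τ i ≠ i := fun h => hij ((hfix i).1 h)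
      have h3 : τ i ≠ m := fun h => hij (by rw [← hmm, ← h, hinv])
      exact t hij.symm h3.symm h2.symm hzij.symm h1.symm
    have hτi : τ i ≠ i := fun h => hmi ((hfix i).1 h).symm
    have hτj : τ j ≠ j := fun h => hmj ((hfix j).1 h).symm
    have hτij : τ i = j := by
      by_contra hne
      have h1 := (hc i).trans (hc j).symm
      rw [hzij, mul_left_inj] at h1
      have h2 : τ j ≠ i := fun h => hne (by rw [← h, hinv])
      have h3 : τ i ≠ τ j := fun h => hij (τ.injective h)
      exact hN i j (τ i) (τ j) (nodup_four hij hτi.symm h2.symm (fun h => h2 (by rw [h, hinv]))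
        hτj.symm h3) hzij h1
    have hτji : τ j = i := by rw [← hτij, hinv]
    have h1 := hcm.trans (hc i).symm
    rw [hτij, ← hzij] at h1
    have h2 : (z m : ℂ) * z m = z i * z i := by rw [← Circle.coe_mul, h1, Circle.coe_mul]
    refine ⟨m, hmm, hτij, hτji, (mul_self_eq_mul_self_iff.1 h2).resolve_left fun h => ?_, hmi, hmj,
      fun x => (hfix x).1, hinv⟩
    exact t hij hmi.symm hmj.symm hzij (Circle.ext h.symm)
  rw [reflectionCount, Set.ncard_le_one]
  rintro τ ⟨hτ, hc⟩ τ' ⟨hτ', hc'⟩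
  obtain ⟨m, h1, h2, h3, h4, h5, h6, h7, h8⟩ := main τ hτ hc
  obtain ⟨m', h1', h2', h3', h4', h5', h6', h7', h8'⟩ := main τ' hτ' hc'
  have hmm : m = m' := by
    by_contra hne
    exact hN i j m m' (nodup_four hij h5.symm h5'.symm h6.symm h6'.symm hne)
      hzij (Circle.ext (h4.trans h4'.symm))
  subst hmm
  ext1 x
  by_cases xi : x = i
  · rw [xi, h2, h2']
  by_cases xj : x = j
  · rw [xj, h3, h3']
  by_cases xm : x = m
  · rw [xm, h1, h1']
  have hd : ∀ ρ : Perm (Fin 5), ρ i = j → ρ j = i → ρ m = m → (∀ x, ρ x = x → x = m) →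
      (∀ x, ρ (ρ x) = x) → [i, j, m, x, ρ x].Nodup := fun ρ r1 r2 r3 r4 r5 => by
    have a1 : i ≠ ρ x := fun h => xj (by rw [← r5 x, ← h, r1])
    have a2 : j ≠ ρ x := fun h => xi (by rw [← r5 x, ← h, r2])
    have a3 : m ≠ ρ x := fun h => xm (by rw [← r5 x, ← h, r3])
    have a4 : x ≠ ρ x := fun h => xm (r4 x h.symm)
    simp [hij, h5.symm, h6.symm, Ne.symm xi, Ne.symm xj, Ne.symm xm, a1, a2, a3, a4]
  exact eq_of_not_mem_four i j m x _ _
    (nodup_four hij h5.symm (Ne.symm xi) h6.symm (Ne.symm xj) (Ne.symm xm)) (hd τ h2 h3 h1 h7 h8)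
    (hd τ' h2' h3' h1' h7' h8')

theorem injective_of_four_le {z : Fin 5 → Circle} (hz : ∑ k, (z k : ℂ) = 0)
    (hN : ∀ i j k l, [i, j, k, l].Nodup → z i = z j → z k = z l → False)
    (h : 4 ≤ swapCount z + reflectionCount z) : Function.Injective z := by
  by_contra hinj
  obtain ⟨i, j, hzij, hij⟩ : ∃ i j, z i = z j ∧ i ≠ j := by
    simpa [Function.Injective] using hinj
  have h1 := swapCount_le_one hz hN
  have h2 := reflectionCount_le_one hz hN hij hzij
  omega

end Pentagon

namespace Pentagon

open Equiv (swap Perm)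

theorem HasPhases.sum_exp {p : E5} {θ : Fin 5 → ℝ} (h : HasPhases p θ) :
    ∑ k, (Circle.exp (θ k) : ℂ) = 0 := by
  obtain ⟨hc, -⟩ := h
  unfold Closes fifths at hc
  rw [← Finset.mul_sum] at hc
  simpa [Real.Angle.toCircle_coe] using hc

theorem HasPhases.loopCount_eq {p : E5} {θ : Fin 5 → ℝ} (h : HasPhases p θ) :
    loopCount p = swapCount (fun k => Circle.exp (θ k))
      + reflectionCount (fun k => Circle.exp (θ k)) := by
  obtain ⟨hc, rfl⟩ := h
  exact loopCount_mk _

theorem HasPhases.secondMoment_eq_normSq {p : E5} {θ : Fin 5 → ℝ} (h : HasPhases p θ) :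
    secondMoment p = Complex.normSq (∑ k, (Circle.exp (θ k) : ℂ) ^ 2) := by
  obtain ⟨hc, rfl⟩ := h
  rfl

theorem TwoPairsCoincide.loopCount_eq {p : E5} (h : TwoPairsCoincide p) : loopCount p = 4 := by
  obtain ⟨θ, hθ, σ, h1, h2⟩ := h
  rw [hθ.loopCount_eq, ← swapCount_comp _ σ, ← reflectionCount_comp _ σ]
  have hs := hθ.sum_exp
  rw [← Equiv.sum_comp σ] at hs
  obtain ⟨a, b⟩ := count_of_two_pairs (z := fun k => Circle.exp (θ (σ k))) hs (by simp only [h1])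
    (by simp only [h2])
  rw [a, b]

theorem TwoPairsCoincide.secondMoment_eq {p : E5} (h : TwoPairsCoincide p) :
    secondMoment p = 25 / 4 := by
  obtain ⟨θ, hθ, σ, h1, h2⟩ := h
  have hs := hθ.sum_exp
  rw [← Equiv.sum_comp σ, Fin.sum_univ_five, h1, h2] at hs
  have hs' : (2 * Circle.exp (θ (σ 1)) + 2 * Circle.exp (θ (σ 3)) + Circle.exp (θ (σ 4)) : ℂ) = 0 :=
    by linear_combination hs
  have hm := mul_eq_sq_of_two_pairs hs'
  rw [hθ.secondMoment_eq_normSq, ← Equiv.sum_comp σ, Fin.sum_univ_five, h1, h2]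
  have : (Circle.exp (θ (σ 1)) ^ 2 + Circle.exp (θ (σ 1)) ^ 2 + Circle.exp (θ (σ 3)) ^ 2
      + Circle.exp (θ (σ 3)) ^ 2 + Circle.exp (θ (σ 4)) ^ 2 : ℂ)
      = (-5 / 2 : ℝ) * (Circle.exp (θ (σ 4)) : ℂ) ^ 2 := by
    simp only [Complex.ofReal_div, Complex.ofReal_neg, Complex.ofReal_ofNat]
    linear_combination (Circle.exp (θ (σ 1)) + Circle.exp (θ (σ 3))
      - Circle.exp (θ (σ 4)) / 2 : ℂ) * hs' - 4 * hm
  rw [this, map_mul, map_pow, Circle.normSq_coe, Complex.normSq_ofReal]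
  norm_num

theorem exp_fifth (α : ℝ) (n : ℕ) :
    Circle.exp (α + 2 * Real.pi * n / 5) = Circle.exp α * fifthRoot ^ n := by
  rw [fifthRoot, ← Circle.exp_natCast_mul, ← Circle.exp_add]
  congr 1
  ring

theorem PhasesLikeFifthRoots.loopCount_eq {p : E5} (h : PhasesLikeFifthRoots p) :
    loopCount p = 5 := by
  obtain ⟨α, σ, h⟩ := h
  rw [h.loopCount_eq, ← swapCount_comp _ σ⁻¹, ← reflectionCount_comp _ σ⁻¹]
  obtain ⟨a, b⟩ := count_of_fifth_roots (c := Circle.exp α)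
    (z := fun k => Circle.exp (α + 2 * Real.pi * (σ (σ⁻¹ k) : ℕ) / 5)) (fun k => by
      rw [← exp_fifth, ← Equiv.Perm.mul_apply, mul_inv_cancel, Equiv.Perm.one_apply])
  rw [a, b]

theorem PhasesLikeFifthRoots.secondMoment_eq {p : E5} (h : PhasesLikeFifthRoots p) :
    secondMoment p = 0 := by
  obtain ⟨α, σ, h⟩ := h
  have h5 : (fifthRoot : ℂ) ^ 5 = 1 := by
    rw [← Circle.coe_pow, ← orderOf_fifthRoot, pow_orderOf_eq_one, Circle.coe_one]
  have h1 : (fifthRoot : ℂ) ≠ 1 := fun h => by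
    have := orderOf_fifthRoot
    rw [show fifthRoot = 1 from Circle.ext h, orderOf_one] at this
    norm_num at this
  rw [h.secondMoment_eq_normSq, map_eq_zero]
  simp only [exp_fifth, Circle.coe_mul, Circle.coe_pow]
  rw [Equiv.sum_comp σ (fun k => ((Circle.exp α : ℂ) * (fifthRoot : ℂ) ^ (k : ℕ)) ^ 2),
    Fin.sum_univ_five]
  have h0 : (1 + fifthRoot + fifthRoot ^ 2 + fifthRoot ^ 3 + fifthRoot ^ 4 : ℂ) = 0 :=
    (mul_eq_zero.1 (by linear_combination h5 : ((fifthRoot : ℂ) - 1)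
      * (1 + fifthRoot + fifthRoot ^ 2 + fifthRoot ^ 3 + fifthRoot ^ 4) = 0)).resolve_left
      (sub_ne_zero.2 h1)
  simp [-Circle.coe_exp]
  linear_combination (Circle.exp α : ℂ) ^ 2 * (h0 + (fifthRoot + fifthRoot ^ 3 : ℂ) * h5)

theorem exists_perm_of_nodup : ∀ i j k l : Fin 5, [i, j, k, l].Nodup →
    ∃ σ : Perm (Fin 5), σ 0 = i ∧ σ 1 = j ∧ σ 2 = k ∧ σ 3 = l := by decide +kernel

theorem exists_hasPhases_toReal (p : E5) :
    ∃ θ : Fin 5 → ℝ, HasPhases p θ ∧ ∀ i j, Circle.exp (θ i) = Circle.exp (θ j) → θ i = θ j := by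
  obtain ⟨⟨θ, h⟩, rfl⟩ := Quotient.exists_rep p
  refine ⟨fun k => (θ k).toReal, ⟨by simpa only [Real.Angle.coe_toReal] using h, ?_⟩, ?_⟩
  · congr 2
    funext k
    exact (Real.Angle.coe_toReal _).symm
  · intro i j hij
    dsimp only at hij ⊢
    rw [← Real.Angle.toCircle_coe, ← Real.Angle.toCircle_coe, Real.Angle.coe_toReal,
      Real.Angle.coe_toReal] at hij
    rw [toCircle_injective hij]

theorem HasPhases.congr {p : E5} {θ θ' : Fin 5 → ℝ} (h : HasPhases p θ)
    (e : ∀ k, Circle.exp (θ k) = Circle.exp (θ' k)) : HasPhases p θ' := by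
  have : (fun k => (θ k : Real.Angle)) = fun k => (θ' k : Real.Angle) :=
    funext fun k => toCircle_injective (e k)
  unfold HasPhases at *
  simp only [← this]
  exact h

theorem exists_eq_fifthRoot_pow {w : Circle} (hw : w ^ 5 = 1) :
    ∃ n : Fin 5, w = fifthRoot ^ (n : ℕ) := by
  have hp : IsPrimitiveRoot (fifthRoot : ℂ) 5 := by
    have := (IsPrimitiveRoot.orderOf fifthRoot).map_of_injective (f := Circle.coeHom)
      Circle.coe_injective
    rwa [orderOf_fifthRoot] at this
  obtain ⟨n, hn, h⟩ := hp.eq_pow_of_pow_eq_one (ξ := (w : ℂ))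
    (by rw [← Circle.coe_pow, hw, Circle.coe_one])
  exact ⟨⟨n, hn⟩, Circle.ext (by rw [Circle.coe_pow, h])⟩

theorem phasesLikeFifthRoots_of_four_le {p : E5} (hp : ¬ TwoPairsCoincide p)
    (h4 : 4 ≤ loopCount p) : PhasesLikeFifthRoots p := by
  obtain ⟨θ, hθ, hinj⟩ := exists_hasPhases_toReal p
  have hz := hθ.sum_exp
  rw [hθ.loopCount_eq] at h4
  have hz_inj := injective_of_four_le hz (fun i j k l hn h1 h2 => by
    obtain ⟨σ, rfl, rfl, rfl, rfl⟩ := exists_perm_of_nodup i j k l hn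
    exact hp ⟨θ, hθ, σ, hinj _ _ h1, hinj _ _ h2⟩) h4
  rw [swapCount_eq_zero hz_inj] at h4
  have h5 := pow_five_eq_of_two_le hz hz_inj (by omega)
  have hroot : ∀ k, ∃ n : Fin 5, Circle.exp (θ k) = Circle.exp (θ 0) * fifthRoot ^ (n : ℕ) :=
    fun k => by
      obtain ⟨n, hn⟩ := exists_eq_fifthRoot_pow (w := Circle.exp (θ k) / Circle.exp (θ 0))
        (by rw [div_pow, h5, h5, div_self'])
      exact ⟨n, by rw [← hn, mul_div_cancel]⟩
  choose s hs using hroot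
  have hs_inj : Function.Injective s := fun i j hij => hz_inj (by
    dsimp only
    rw [hs i, hs j, hij])
  exact ⟨θ 0, Equiv.ofBijective s (Finite.injective_iff_bijective.1 hs_inj), hθ.congr fun k => by
    rw [hs k, exp_fifth, Equiv.ofBijective_apply]⟩

theorem isTractVertex_five_iff (p : E5) : IsTractVertex 5 p ↔ PhasesLikeFifthRoots p := by
  refine ⟨fun h => phasesLikeFifthRoots_of_four_le (fun h' => ?_) (by rw [h]; norm_num),
    fun h => h.loopCount_eq⟩
  have := h'.loopCount_eq.symm.trans h
  omega

theorem isTractVertex_four_iff (p : E5) : IsTractVertex 4 p ↔ TwoPairsCoincide p := by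
  refine ⟨fun h => ?_, fun h => h.loopCount_eq⟩
  by_contra hp
  have := (phasesLikeFifthRoots_of_four_le hp h.ge).loopCount_eq.symm.trans h
  omega

/-! ### The range of the curvature -/

theorem exists_secondMoment_eq {c : ℝ} (h1 : -1 / 4 ≤ c) (h2 : c ≤ 1 / 2) :
    ∃ p : E5, secondMoment p = (8 * c ^ 2 + 4 * c - 2) ^ 2 := by
  have a1 := Real.cos_arccos (x := c) (by linarith) (by linarith)
  have a2 := Real.cos_arccos (x := -1 / 2 - c) (by linarith) (by linarith)
  set α := Real.arccos c
  set β := Real.arccos (-1 / 2 - c)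
  have hc : Closes fifths (fun k => ((![α, -α, β, -β, 0] k : ℝ) : Real.Angle)) := by
    rw [closes_coe_iff]
    simp [Fin.sum_univ_five, a1, a2]
    ring
  refine ⟨Quotient.mk _ ⟨_, hc⟩, ?_⟩
  rw [secondMoment_eq ⟨hc, rfl⟩]
  simp [Fin.sum_univ_five, a1, a2]
  ring

theorem continuousOn_curvatureOf : ContinuousOn curvatureOf (Set.Icc 0 (25 / 4)) := by
  unfold curvatureOf
  refine ContinuousOn.div (by fun_prop) (by fun_prop) fun t ht => ?_
  have : 0 < 25 - t := by linarith [ht.2]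
  positivity

theorem curvatureOf_zero : curvatureOf 0 = -1 := by norm_num [curvatureOf]

theorem curvatureOf_max : curvatureOf (25 / 4) = -11 / 3 := by norm_num [curvatureOf]

theorem range_curvature :
    Set.range (fun p : E5 => curvatureOf (secondMoment p)) = Set.Icc (-11 / 3) (-1) := by
  apply Set.Subset.antisymm
  · rintro _ ⟨p, rfl⟩
    exact curvatureOf_mem (secondMoment_nonneg p) (secondMoment_le p)
  · intro κ hκ
    obtain ⟨r, hr1, hr2, hr⟩ : ∃ r : ℝ, -1 / 4 ≤ r ∧ r ≤ 1 / 2 ∧ 8 * r ^ 2 + 4 * r - 2 = 0 := by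
      have h5 := Real.sq_sqrt (show (0 : ℝ) ≤ 5 by norm_num)
      have h0 := Real.sqrt_nonneg (5 : ℝ)
      exact ⟨(√5 - 1) / 4, by linarith, by nlinarith, by linear_combination h5 / 2⟩
    have hm : ∀ c ∈ Set.Icc (-1 / 4) r, (8 * c ^ 2 + 4 * c - 2) ^ 2 ∈ Set.Icc (0 : ℝ) (25 / 4) :=
      fun c hc => ⟨sq_nonneg _, by
        obtain ⟨p, hp⟩ := exists_secondMoment_eq hc.1 (hc.2.trans hr2)
        rw [← hp]
        exact secondMoment_le p⟩
    have hcont : ContinuousOn (fun c : ℝ => curvatureOf ((8 * c ^ 2 + 4 * c - 2) ^ 2))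
        (Set.Icc (-1 / 4) r) := continuousOn_curvatureOf.comp (by fun_prop) hm
    have hivt := intermediate_value_Icc hr1 hcont
    simp only [hr] at hivt
    rw [show (8 * (-1 / 4 : ℝ) ^ 2 + 4 * (-1 / 4) - 2) ^ 2 = 25 / 4 by norm_num, curvatureOf_max,
      show (0 : ℝ) ^ 2 = 0 by norm_num, curvatureOf_zero] at hivt
    obtain ⟨c, hc, rfl⟩ := hivt hκ
    obtain ⟨p, hp⟩ := exists_secondMoment_eq hc.1 (hc.2.trans hr2)
    exact ⟨p, by simp only [hp]⟩

end Pentagon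

namespace Pentagon

/-! ### Pentagons from their vertex angles -/

theorem halfTan_eq (τ : Real.Angle) : halfTan τ = τ.sin / (1 + τ.cos) := by
  induction τ using Real.Angle.induction_on with
  | h t =>
    obtain ⟨r, hr⟩ : ∃ r, r = (t : Real.Angle).toReal := ⟨_, rfl⟩
    have hr' : (t : Real.Angle) = (r : Real.Angle) := by rw [hr, Real.Angle.coe_toReal]
    rw [halfTan, ← hr, hr', Real.Angle.sin_coe, Real.Angle.cos_coe, Real.tan_eq_sin_div_cos]
    obtain ⟨u, rfl⟩ : ∃ u, r = 2 * u := ⟨r / 2, by ring⟩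
    rw [Real.sin_two_mul, Real.cos_two_mul, mul_div_cancel_left₀ _ two_ne_zero]
    by_cases h : Real.cos u = 0
    · simp [h]
    · field_simp
      ring

theorem one_add_cos_ne_zero {τ : Real.Angle} (h : τ ≠ (Real.pi : Real.Angle)) : 1 + τ.cos ≠ 0 := by
  intro h'
  have : τ.cos = (Real.pi : Real.Angle).cos := by
    rw [Real.Angle.cos_coe, Real.cos_pi]; linarith
  rcases Real.Angle.cos_eq_iff_eq_or_eq_neg.1 this with h1 | h1
  · exact h h1
  · rw [Real.Angle.neg_coe_pi] at h1
    exact h h1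

theorem cos_eq_of_halfTan {τ : Real.Angle} (h : τ ≠ (Real.pi : Real.Angle)) :
    (1 + halfTan τ ^ 2) * τ.cos = 1 - halfTan τ ^ 2 ∧
      (1 + halfTan τ ^ 2) * τ.sin = 2 * halfTan τ := by
  have h1 := one_add_cos_ne_zero h
  have h2 := Real.Angle.cos_sq_add_sin_sq τ
  rw [halfTan_eq]
  constructor
  · field_simp
    linear_combination (1 + τ.cos) * h2
  · field_simp
    linear_combination τ.sin * h2

theorem exists_cos_sin {a b : ℝ} (h : a ^ 2 + b ^ 2 = 1) :
    ∃ τ : Real.Angle, τ.cos = a ∧ τ.sin = b := by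
  have hn : ‖(⟨a, b⟩ : ℂ)‖ = 1 := by
    rw [← sq_eq_sq₀ (norm_nonneg _) zero_le_one, ← Complex.normSq_eq_norm_sq, Complex.normSq_mk]
    linarith
  refine ⟨(Complex.arg ⟨a, b⟩ : Real.Angle), ?_, ?_⟩
  · rw [Real.Angle.cos_coe, ← one_mul (Real.cos _), ← hn, Complex.norm_mul_cos_arg]
  · rw [Real.Angle.sin_coe, ← one_mul (Real.sin _), ← hn, Complex.norm_mul_sin_arg]

/-- Phases with given vertex angles `τ₁, …, τ₄`, the third phase being `0`. -/
def phasesOfAngles (τ₁ τ₂ τ₃ τ₄ : Real.Angle) : Fin 5 → Real.Angle :=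
  ![-τ₂ - τ₁, -τ₂, 0, τ₃, τ₃ + τ₄]

theorem closes_phasesOfAngles_iff (τ₁ τ₂ τ₃ τ₄ : Real.Angle) :
    Closes fifths (phasesOfAngles τ₁ τ₂ τ₃ τ₄) ↔
      1 + τ₂.cos + (τ₁ + τ₂).cos + τ₃.cos + (τ₃ + τ₄).cos = 0 ∧
        τ₃.sin + (τ₃ + τ₄).sin = τ₂.sin + (τ₁ + τ₂).sin := by
  have e : -τ₂ - τ₁ = -(τ₁ + τ₂) := by abel
  unfold Closes fifths phasesOfAngles
  rw [← Finset.mul_sum, mul_eq_zero, or_iff_right (by norm_num), Fin.sum_univ_five]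
  simp only [Real.Angle.coe_toCircle]
  rw [Complex.ext_iff]
  simp [e, -neg_add_rev]
  constructor
  · rintro ⟨h1, h2⟩
    constructor <;> linarith
  · rintro ⟨h1, h2⟩
    constructor <;> linarith

theorem exists_eq_mk (p : E5) :
    ∃ h : Closes fifths (phasesOfAngles (vertexAngle 0 p) (vertexAngle 1 p) (vertexAngle 2 p)
      (vertexAngle 3 p)), p = Quotient.mk (rotationSetoid fifths) ⟨_, h⟩ := by
  obtain ⟨⟨θ, h⟩, rfl⟩ := Quotient.exists_rep p
  have e : phasesOfAngles (θ 1 - θ 0) (θ 2 - θ 1) (θ 3 - θ 2) (θ 4 - θ 3)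
      = fun k => θ k + -θ 2 := by
    funext k
    fin_cases k <;> simp [phasesOfAngles] <;> abel
  have hc : Closes fifths (fun k => θ k + -θ 2) := by
    unfold Closes at *
    simp only [Real.Angle.toCircle_add, Circle.coe_mul, ← mul_assoc, ← Finset.sum_mul, h, zero_mul]
  change ∃ h' : Closes fifths (phasesOfAngles (θ 1 - θ 0) (θ 2 - θ 1) (θ 3 - θ 2) (θ 4 - θ 3)), _
  refine ⟨e ▸ hc, Quotient.sound ⟨-θ 2, fun k => congrFun e k⟩⟩

theorem eq_of_vertexAngle_eq {p q : E5} (h0 : vertexAngle 0 p = vertexAngle 0 q)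
    (h1 : vertexAngle 1 p = vertexAngle 1 q) (h2 : vertexAngle 2 p = vertexAngle 2 q)
    (h3 : vertexAngle 3 p = vertexAngle 3 q) : p = q := by
  obtain ⟨hp, ep⟩ := exists_eq_mk p
  obtain ⟨hq, eq⟩ := exists_eq_mk q
  rw [ep, eq]
  congr 2
  rw [h0, h1, h2, h3]

theorem eq_of_cos_eq_of_sin_eq {a b : Real.Angle} (h1 : a.cos = b.cos) (h2 : a.sin = b.sin) :
    a = b := by
  induction a using Real.Angle.induction_on
  induction b using Real.Angle.induction_on
  exact Real.Angle.cos_sin_inj h1 h2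

/-- The number which takes the values `±√Q` on a fibre of `(τ₁, τ₄)`. -/
def fibreCoord (x y : ℝ) (p : E5) : ℝ :=
  -4 * (1 + y ^ 2) * ((vertexAngle 1 p).sin + x * (vertexAngle 1 p).cos)

theorem radicand_eq (x y : ℝ) : radicand x y = 16 * (1 + x ^ 2) * (1 + y ^ 2) ^ 2
    - (4 * (1 + x ^ 2) - 4 * (1 + y ^ 2) - (1 + x ^ 2) * (1 + y ^ 2)) ^ 2 := by
  rw [radicand]; ring

theorem radicand_comm (x y : ℝ) : radicand x y = radicand y x := by
  rw [radicand, radicand]; ring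

/-- Closing condition in terms of the half-angle tangents of `τ₁` and `τ₄`. -/
theorem closes_iff {ξ η σ τ : Real.Angle} (hξ : ξ ≠ (Real.pi : Real.Angle))
    (hη : η ≠ (Real.pi : Real.Angle)) {x y : ℝ} (hx : x = halfTan ξ) (hy : y = halfTan η) :
    Closes fifths (phasesOfAngles ξ σ τ η) ↔
      (1 + x ^ 2) * (1 + y ^ 2) + 2 * (1 + y ^ 2) * (σ.cos - x * σ.sin)
          + 2 * (1 + x ^ 2) * (τ.cos - y * τ.sin) = 0 ∧
        (1 + y ^ 2) * (σ.sin + x * σ.cos) = (1 + x ^ 2) * (τ.sin + y * τ.cos) := by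
  obtain ⟨c1, s1⟩ := cos_eq_of_halfTan hξ
  obtain ⟨c2, s2⟩ := cos_eq_of_halfTan hη
  rw [← hx] at c1 s1
  rw [← hy] at c2 s2
  have hX : 1 + x ^ 2 ≠ 0 := by positivity
  have hY : 1 + y ^ 2 ≠ 0 := by positivity
  rw [closes_phasesOfAngles_iff, Real.Angle.cos_add, Real.Angle.cos_add, Real.Angle.sin_add,
    Real.Angle.sin_add]
  refine and_congr ?_ ?_
  · rw [← mul_right_inj' hX, ← mul_right_inj' hY, mul_zero, mul_zero, ← sub_eq_zero, sub_zero]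
    refine Eq.congr ?_ rfl
    linear_combination (1 + y ^ 2) * (σ.cos * c1 - σ.sin * s1)
      + (1 + x ^ 2) * (τ.cos * c2 - τ.sin * s2)
  · have key : (1 + x ^ 2) * (1 + y ^ 2) * (σ.sin + (ξ.sin * σ.cos + ξ.cos * σ.sin)
        - (τ.sin + (τ.sin * η.cos + τ.cos * η.sin)))
        = 2 * ((1 + y ^ 2) * (σ.sin + x * σ.cos) - (1 + x ^ 2) * (τ.sin + y * τ.cos)) := by
      linear_combination (1 + y ^ 2) * (σ.cos * s1 + σ.sin * c1)
        - (1 + x ^ 2) * (τ.cos * s2 + τ.sin * c2)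
    constructor
    · intro h
      rw [h, sub_self, mul_zero] at key
      linarith
    · intro h
      rw [h, sub_self, mul_zero, mul_eq_zero] at key
      linarith [key.resolve_left (mul_ne_zero hX hY)]

theorem halfTan_of_cos_sin {x y m : ℝ} {τ : Real.Angle}
    (hm : m ^ 2 = radicand x y)
    (hc : 4 * (1 + x ^ 2) * (1 + y ^ 2) * τ.cos
      = 4 * (1 + x ^ 2) - 4 * (1 + y ^ 2) - (1 + x ^ 2) * (1 + y ^ 2) - x * m)
    (hs : 4 * (1 + x ^ 2) * (1 + y ^ 2) * τ.sin
      = -(m + x * (4 * (1 + x ^ 2) - 4 * (1 + y ^ 2) - (1 + x ^ 2) * (1 + y ^ 2))))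
    (hy : y ^ 2 ≠ 3) : τ ≠ (Real.pi : Real.Angle) ∧
      halfTan τ = (4 * x * (1 + y ^ 2) + m) / ((1 + x ^ 2) * (y ^ 2 - 3)) := by
  have hX : 1 + x ^ 2 ≠ 0 := by positivity
  have hY : 1 + y ^ 2 ≠ 0 := by positivity
  have hπ : τ ≠ (Real.pi : Real.Angle) := by
    rintro rfl
    rw [Real.Angle.cos_coe, Real.cos_pi] at hc
    rw [Real.Angle.sin_coe, Real.sin_pi] at hs
    apply hy
    have : (1 + x ^ 2) ^ 2 * (y ^ 2 - 3) = 0 := by linear_combination hc - x * hs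
    linarith [(mul_eq_zero.1 this).resolve_left (pow_ne_zero 2 hX)]
  refine ⟨hπ, ?_⟩
  rw [radicand_eq] at hm
  rw [halfTan_eq, div_eq_div_iff (one_add_cos_ne_zero hπ) (mul_ne_zero hX (sub_ne_zero.2 hy))]
  apply mul_left_cancel₀ (mul_ne_zero (mul_ne_zero four_ne_zero hX) hY)
  linear_combination (1 + x ^ 2) * (y ^ 2 - 3) * hs - (4 * x * (1 + y ^ 2) + m) * hc + x * hm

variable {ξ η : Real.Angle} {x y : ℝ}

/-- The cosines and sines of `τ₂` and `τ₃` on a fibre of `(τ₁, τ₄)`. -/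
theorem cos_sin_of_mem_angleFibre (hξ : ξ ≠ (Real.pi : Real.Angle))
    (hη : η ≠ (Real.pi : Real.Angle)) (hx : x = halfTan ξ) (hy : y = halfTan η) {p : E5}
    (hp : p ∈ angleFibre ξ η) :
    fibreCoord x y p ^ 2 = radicand x y ∧
    4 * (1 + x ^ 2) * (1 + y ^ 2) * (vertexAngle 1 p).cos
      = 4 * (1 + x ^ 2) - 4 * (1 + y ^ 2) - (1 + x ^ 2) * (1 + y ^ 2) - x * fibreCoord x y p ∧
    4 * (1 + x ^ 2) * (1 + y ^ 2) * (vertexAngle 1 p).sin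
      = -(fibreCoord x y p
          + x * (4 * (1 + x ^ 2) - 4 * (1 + y ^ 2) - (1 + x ^ 2) * (1 + y ^ 2))) ∧
    4 * (1 + y ^ 2) * (1 + x ^ 2) * (vertexAngle 2 p).cos
      = 4 * (1 + y ^ 2) - 4 * (1 + x ^ 2) - (1 + y ^ 2) * (1 + x ^ 2) - y * fibreCoord x y p ∧
    4 * (1 + y ^ 2) * (1 + x ^ 2) * (vertexAngle 2 p).sin
      = -(fibreCoord x y p
          + y * (4 * (1 + y ^ 2) - 4 * (1 + x ^ 2) - (1 + y ^ 2) * (1 + x ^ 2))) := by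
  obtain ⟨hc, -⟩ := exists_eq_mk p
  rw [hp.1, hp.2, closes_iff hξ hη hx hy] at hc
  obtain ⟨h1, h2⟩ := hc
  have hX : 1 + x ^ 2 ≠ 0 := by positivity
  have hY : 1 + y ^ 2 ≠ 0 := by positivity
  have u1 := Real.Angle.cos_sq_add_sin_sq (vertexAngle 1 p)
  have u2 := Real.Angle.cos_sq_add_sin_sq (vertexAngle 2 p)
  unfold fibreCoord
  rw [radicand_eq]
  generalize (vertexAngle 1 p).cos = c at *
  generalize (vertexAngle 1 p).sin = s at *
  generalize (vertexAngle 2 p).cos = c' at *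
  generalize (vertexAngle 2 p).sin = s' at *
  have hn : 4 * (1 + y ^ 2) * (c - x * s)
      = 4 * (1 + x ^ 2) - 4 * (1 + y ^ 2) - (1 + x ^ 2) * (1 + y ^ 2) := by
    apply mul_left_cancel₀ (mul_ne_zero hX hY)
    linear_combination ((1 + x ^ 2) * (1 + y ^ 2) + 2 * (1 + y ^ 2) * (c - x * s)
        - 2 * (1 + x ^ 2) * (c' - y * s')) * h1
      + 4 * ((1 + y ^ 2) * (s + x * c) + (1 + x ^ 2) * (s' + y * c')) * h2
      + 4 * (1 + x ^ 2) ^ 2 * (1 + y ^ 2) * u2 - 4 * (1 + y ^ 2) ^ 2 * (1 + x ^ 2) * u1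
  have hn' : 4 * (1 + x ^ 2) * (c' - y * s')
      = 4 * (1 + y ^ 2) - 4 * (1 + x ^ 2) - (1 + y ^ 2) * (1 + x ^ 2) := by
    linear_combination 2 * h1 - hn
  refine ⟨?_, ?_, ?_, ?_, ?_⟩
  · rw [← hn]
    linear_combination 16 * (1 + y ^ 2) ^ 2 * (1 + x ^ 2) * u1
  · linear_combination hn
  · linear_combination -x * hn
  · linear_combination hn' - 4 * y * h2
  · linear_combination -4 * h2 - y * hn'

theorem bijOn_fibreCoord (hξ : ξ ≠ (Real.pi : Real.Angle))
    (hη : η ≠ (Real.pi : Real.Angle)) (hx : x = halfTan ξ) (hy : y = halfTan η) :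
    Set.BijOn (fibreCoord x y) (angleFibre ξ η) {m | m ^ 2 = radicand x y} := by
  have hX : 1 + x ^ 2 ≠ 0 := by positivity
  have hY : 1 + y ^ 2 ≠ 0 := by positivity
  refine ⟨fun p hp => (cos_sin_of_mem_angleFibre hξ hη hx hy hp).1, fun p hp q hq h => ?_,
    fun m hm => ?_⟩
  · obtain ⟨-, a1, a2, a3, a4⟩ := cos_sin_of_mem_angleFibre hξ hη hx hy hp
    obtain ⟨-, b1, b2, b3, b4⟩ := cos_sin_of_mem_angleFibre hξ hη hx hy hq
    rw [h] at a1 a2 a3 a4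
    have hXY := mul_ne_zero (mul_ne_zero four_ne_zero hX) hY
    have hYX := mul_ne_zero (mul_ne_zero four_ne_zero hY) hX
    exact eq_of_vertexAngle_eq (hp.1.trans hq.1.symm)
      (eq_of_cos_eq_of_sin_eq (mul_left_cancel₀ hXY (a1.trans b1.symm))
        (mul_left_cancel₀ hXY (a2.trans b2.symm)))
      (eq_of_cos_eq_of_sin_eq (mul_left_cancel₀ hYX (a3.trans b3.symm))
        (mul_left_cancel₀ hYX (a4.trans b4.symm)))
      (hp.2.trans hq.2.symm)
  · have unit : ∀ x y : ℝ, m ^ 2 = radicand x y →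
        ((4 * (1 + x ^ 2) - 4 * (1 + y ^ 2) - (1 + x ^ 2) * (1 + y ^ 2) - x * m)
            / (4 * (1 + x ^ 2) * (1 + y ^ 2))) ^ 2
          + (-(m + x * (4 * (1 + x ^ 2) - 4 * (1 + y ^ 2) - (1 + x ^ 2) * (1 + y ^ 2)))
            / (4 * (1 + x ^ 2) * (1 + y ^ 2))) ^ 2 = 1 := fun x y hm => by
      rw [radicand_eq] at hm
      rw [div_pow, div_pow, ← add_div, div_eq_one_iff_eq (by positivity)]
      linear_combination (1 + x ^ 2) * hm
    obtain ⟨σ, c1, s1⟩ := exists_cos_sin (unit x y hm)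
    obtain ⟨τ, c2, s2⟩ := exists_cos_sin (unit y x (radicand_comm x y ▸ hm))
    rw [eq_div_iff (by positivity)] at c1 s1 c2 s2
    have hc : Closes fifths (phasesOfAngles ξ σ τ η) := by
      rw [closes_iff hξ hη hx hy]
      have hXY := mul_ne_zero hX hY
      constructor
      · apply mul_left_cancel₀ (mul_ne_zero two_ne_zero hXY)
        linear_combination (1 + y ^ 2) * (c1 - x * s1) + (1 + x ^ 2) * (c2 - y * s2)
      · apply mul_left_cancel₀ (mul_ne_zero four_ne_zero hXY)
        linear_combination (1 + y ^ 2) * (s1 + x * c1) - (1 + x ^ 2) * (s2 + y * c2)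
    refine ⟨Quotient.mk (rotationSetoid fifths) ⟨_, hc⟩, ⟨?_, ?_⟩, ?_⟩
    · change -σ - (-σ - ξ) = ξ
      abel
    · change τ + η - τ = η
      abel
    · change -4 * (1 + y ^ 2) * ((0 - -σ : Real.Angle).sin + x * (0 - -σ : Real.Angle).cos) = m
      rw [zero_sub, neg_neg]
      apply mul_left_cancel₀ hX
      linear_combination -s1 - x * c1

theorem angleFibre_ncard_of_pos (hξ : ξ ≠ (Real.pi : Real.Angle))
    (hη : η ≠ (Real.pi : Real.Angle)) (hx : x = halfTan ξ) (hy : y = halfTan η)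
    (hQ : 0 < radicand x y) : (angleFibre ξ η).ncard = 2 := by
  have h := bijOn_fibreCoord hξ hη hx hy
  rw [← h.injOn.ncard_image, h.image_eq, Set.ncard_eq_two]
  refine ⟨√(radicand x y), -√(radicand x y), ?_, ?_⟩
  · have := Real.sqrt_pos.2 hQ
    intro h'
    linarith
  · ext m
    rw [Set.mem_ofPred_eq, ← Real.sq_sqrt hQ.le, sq_eq_sq_iff_eq_or_eq_neg, Real.sqrt_sq
      (Real.sqrt_nonneg _)]
    rfl

theorem angleFibre_ncard_of_eq_zero (hξ : ξ ≠ (Real.pi : Real.Angle))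
    (hη : η ≠ (Real.pi : Real.Angle)) (hx : x = halfTan ξ) (hy : y = halfTan η)
    (hQ : radicand x y = 0) : (angleFibre ξ η).ncard = 1 := by
  have h := bijOn_fibreCoord hξ hη hx hy
  rw [← h.injOn.ncard_image, h.image_eq, Set.ncard_eq_one]
  exact ⟨0, by ext m; simp [hQ]⟩

theorem anglesGivenBy_of_fibreCoord_eq (hξ : ξ ≠ (Real.pi : Real.Angle))
    (hη : η ≠ (Real.pi : Real.Angle)) (hx : x = halfTan ξ) (hy : y = halfTan η) {p : E5}
    (hp : p ∈ angleFibre ξ η) {s : ℝ} (hs : fibreCoord x y p = s * √(radicand x y)) :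
    AnglesGivenBy s x y p := by
  obtain ⟨hm, c1, s1, c2, s2⟩ := cos_sin_of_mem_angleFibre hξ hη hx hy hp
  rw [AnglesGivenBy, ← hs]
  exact ⟨halfTan_of_cos_sin hm c1 s1,
    halfTan_of_cos_sin (hm.trans (radicand_comm x y)) c2 s2⟩

theorem fibreCoord_eq_of_anglesGivenBy (hξ : ξ ≠ (Real.pi : Real.Angle))
    (hη : η ≠ (Real.pi : Real.Angle)) (hx : x = halfTan ξ) (hy : y = halfTan η) {p : E5}
    (hp : p ∈ angleFibre ξ η) (h3 : ¬ (x ^ 2 = 3 ∧ y ^ 2 = 3)) {s : ℝ}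
    (h : AnglesGivenBy s x y p) : fibreCoord x y p = s * √(radicand x y) := by
  obtain ⟨hm, c1, s1, c2, s2⟩ := cos_sin_of_mem_angleFibre hξ hη hx hy hp
  have hX : 1 + x ^ 2 ≠ 0 := by positivity
  have hY : 1 + y ^ 2 ≠ 0 := by positivity
  by_cases hy3 : y ^ 2 = 3
  · have hx3 : x ^ 2 ≠ 3 := fun hx3 => h3 ⟨hx3, hy3⟩
    have e := (h.2 hx3).2
    rw [(halfTan_of_cos_sin (hm.trans (radicand_comm x y)) c2 s2 hx3).2,
      div_left_inj' (mul_ne_zero hY (sub_ne_zero.2 hx3))] at e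
    linarith
  · have e := (h.1 hy3).2
    rw [(halfTan_of_cos_sin hm c1 s1 hy3).2,
      div_left_inj' (mul_ne_zero hX (sub_ne_zero.2 hy3))] at e
    linarith

theorem radicand_nonneg_of_mem (hξ : ξ ≠ (Real.pi : Real.Angle))
    (hη : η ≠ (Real.pi : Real.Angle)) (hx : x = halfTan ξ) (hy : y = halfTan η) {p : E5}
    (hp : p ∈ angleFibre ξ η) : 0 ≤ radicand x y := by
  rw [← (cos_sin_of_mem_angleFibre hξ hη hx hy hp).1]
  positivity

theorem exists_sign_of_mem (hξ : ξ ≠ (Real.pi : Real.Angle))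
    (hη : η ≠ (Real.pi : Real.Angle)) (hx : x = halfTan ξ) (hy : y = halfTan η) {p : E5}
    (hp : p ∈ angleFibre ξ η) : ∃ s : ℝ, (s = 1 ∨ s = -1) ∧ AnglesGivenBy s x y p := by
  have hm := (cos_sin_of_mem_angleFibre hξ hη hx hy hp).1
  rw [← Real.sq_sqrt (radicand_nonneg_of_mem hξ hη hx hy hp), sq_eq_sq_iff_eq_or_eq_neg] at hm
  rcases hm with h | h
  · exact ⟨1, .inl rfl, anglesGivenBy_of_fibreCoord_eq hξ hη hx hy hp (by rw [h, one_mul])⟩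
  · exact ⟨-1, .inr rfl, anglesGivenBy_of_fibreCoord_eq hξ hη hx hy hp (by rw [h, neg_one_mul])⟩

theorem existsUnique_of_sign (hξ : ξ ≠ (Real.pi : Real.Angle))
    (hη : η ≠ (Real.pi : Real.Angle)) (hx : x = halfTan ξ) (hy : y = halfTan η)
    (hQ : 0 ≤ radicand x y) (h3 : ¬ (x ^ 2 = 3 ∧ y ^ 2 = 3)) {s : ℝ} (hs : s = 1 ∨ s = -1) :
    ∃! p : E5, p ∈ angleFibre ξ η ∧ AnglesGivenBy s x y p := by
  have h := bijOn_fibreCoord hξ hη hx hy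
  obtain ⟨p, hp, hps⟩ := h.surjOn (show (s * √(radicand x y)) ^ 2 = radicand x y by
    rw [mul_pow, Real.sq_sqrt hQ]
    rcases hs with rfl | rfl <;> norm_num)
  refine ⟨p, ⟨hp, anglesGivenBy_of_fibreCoord_eq hξ hη hx hy hp hps⟩, fun q hq => ?_⟩
  exact h.injOn hq.1 hp
    ((fibreCoord_eq_of_anglesGivenBy hξ hη hx hy hq.1 h3 hq.2).trans hps.symm)

end Pentagon

namespace Pentagon

/-! ### The metric in the coordinates `(τ₁, τ₄)` -/

theorem HasPhases.vertexAngle_eq {p : E5} {θ : Fin 5 → ℝ} (h : HasPhases p θ) (k : Fin 5) :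
    vertexAngle k p = ((θ (k + 1) - θ k : ℝ) : Real.Angle) := by
  obtain ⟨hc, rfl⟩ := h
  exact (Real.Angle.coe_sub _ _).symm

theorem tangent_eq {p : E5} {θ : Fin 5 → ℝ} (hp : HasPhases p θ)
    (h0 : vertexAngle 0 p ≠ (Real.pi : Real.Angle)) (h3 : vertexAngle 3 p ≠ (Real.pi : Real.Angle))
    {x y : ℝ} (hx : x = halfTan (vertexAngle 0 p)) (hy : y = halfTan (vertexAngle 3 p))
    {v : Fin 5 → ℝ} (hc : ∑ k, Real.cos (θ k) * v k = 0) (hs : ∑ k, Real.sin (θ k) * v k = 0) :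
    2 * fibreCoord x y p * (v 0 - v 2) = 8 * y * (1 + x ^ 2) * (v 4 - v 3)
        - (fibreCoord x y p + x * (4 * (1 + x ^ 2) + 4 * (1 + y ^ 2)
          - (1 + x ^ 2) * (1 + y ^ 2))) * (v 1 - v 0) ∧
      2 * fibreCoord x y p * (v 3 - v 2) = -8 * x * (1 + y ^ 2) * (v 1 - v 0)
        + (y * (4 * (1 + x ^ 2) + 4 * (1 + y ^ 2) - (1 + x ^ 2) * (1 + y ^ 2))
          - fibreCoord x y p) * (v 4 - v 3) := by
  obtain ⟨hm, c2, s2, c3, s3⟩ := cos_sin_of_mem_angleFibre h0 h3 hx hy (p := p) ⟨rfl, rfl⟩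
  obtain ⟨c1, s1⟩ := cos_eq_of_halfTan h0
  obtain ⟨c4, s4⟩ := cos_eq_of_halfTan h3
  rw [← hx] at c1 s1
  rw [← hy] at c4 s4
  rw [hp.vertexAngle_eq, Real.Angle.cos_coe] at c1 c2 c3 c4
  rw [hp.vertexAngle_eq, Real.Angle.sin_coe] at s1 s2 s3 s4
  have hX : 1 + x ^ 2 ≠ 0 := by positivity
  have hY : 1 + y ^ 2 ≠ 0 := by positivity
  change _ * Real.cos (θ 1 - θ 0) = _ at c1
  change _ * Real.sin (θ 1 - θ 0) = _ at s1
  change _ * Real.cos (θ 2 - θ 1) = _ at c2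
  change _ * Real.sin (θ 2 - θ 1) = _ at s2
  change _ * Real.cos (θ 3 - θ 2) = _ at c3
  change _ * Real.sin (θ 3 - θ 2) = _ at s3
  change _ * Real.cos (θ 4 - θ 3) = _ at c4
  change _ * Real.sin (θ 4 - θ 3) = _ at s4
  rw [radicand_eq] at hm
  rw [Fin.sum_univ_five] at hc hs
  obtain ⟨t₁, ht₁⟩ : ∃ t, t = θ 1 - θ 0 := ⟨_, rfl⟩
  obtain ⟨t₂, ht₂⟩ : ∃ t, t = θ 2 - θ 1 := ⟨_, rfl⟩
  obtain ⟨t₃, ht₃⟩ : ∃ t, t = θ 3 - θ 2 := ⟨_, rfl⟩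
  obtain ⟨t₄, ht₄⟩ : ∃ t, t = θ 4 - θ 3 := ⟨_, rfl⟩
  have hC : v 0 * Real.cos (t₁ + t₂) + v 1 * Real.cos t₂ + v 2 + v 3 * Real.cos t₃
      + v 4 * Real.cos (t₃ + t₄) = 0 := by
    rw [show t₁ + t₂ = θ 2 - θ 0 by rw [ht₁, ht₂]; ring,
      show t₃ + t₄ = θ 4 - θ 2 by rw [ht₃, ht₄]; ring, ht₂, ht₃]
    simp only [Real.cos_sub]
    linear_combination Real.cos (θ 2) * hc + Real.sin (θ 2) * hs
      - v 2 * Real.cos_sq_add_sin_sq (θ 2)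
  have hS : -(v 0 * Real.sin (t₁ + t₂)) - v 1 * Real.sin t₂ + v 3 * Real.sin t₃
      + v 4 * Real.sin (t₃ + t₄) = 0 := by
    rw [show t₁ + t₂ = θ 2 - θ 0 by rw [ht₁, ht₂]; ring,
      show t₃ + t₄ = θ 4 - θ 2 by rw [ht₃, ht₄]; ring, ht₂, ht₃]
    simp only [Real.sin_sub]
    linear_combination Real.cos (θ 2) * hs - Real.sin (θ 2) * hc
  rw [← ht₁] at c1 s1
  rw [← ht₂] at c2 s2
  rw [← ht₃] at c3 s3
  rw [← ht₄] at c4 s4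
  have c12 : 4 * (1 + x ^ 2) * (1 + y ^ 2) * Real.cos (t₁ + t₂)
      = 4 * (1 + x ^ 2) - 4 * (1 + y ^ 2) - (1 + x ^ 2) * (1 + y ^ 2) + x * fibreCoord x y p := by
    apply mul_left_cancel₀ hX
    rw [Real.cos_add]
    linear_combination 4 * (1 + x ^ 2) * (1 + y ^ 2) * (Real.cos t₂ * c1 - Real.sin t₂ * s1)
      + (1 - x ^ 2) * c2 - 2 * x * s2
  have s12 : 4 * (1 + x ^ 2) * (1 + y ^ 2) * Real.sin (t₁ + t₂)
      = x * (4 * (1 + x ^ 2) - 4 * (1 + y ^ 2) - (1 + x ^ 2) * (1 + y ^ 2))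
        - fibreCoord x y p := by
    apply mul_left_cancel₀ hX
    rw [Real.sin_add]
    linear_combination 4 * (1 + x ^ 2) * (1 + y ^ 2) * (Real.cos t₂ * s1 + Real.sin t₂ * c1)
      + (1 - x ^ 2) * s2 + 2 * x * c2
  have c34 : 4 * (1 + y ^ 2) * (1 + x ^ 2) * Real.cos (t₃ + t₄)
      = 4 * (1 + y ^ 2) - 4 * (1 + x ^ 2) - (1 + y ^ 2) * (1 + x ^ 2) + y * fibreCoord x y p := by
    apply mul_left_cancel₀ hY
    rw [Real.cos_add]
    linear_combination 4 * (1 + x ^ 2) * (1 + y ^ 2) * (Real.cos t₃ * c4 - Real.sin t₃ * s4)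
      + (1 - y ^ 2) * c3 - 2 * y * s3
  have s34 : 4 * (1 + y ^ 2) * (1 + x ^ 2) * Real.sin (t₃ + t₄)
      = y * (4 * (1 + y ^ 2) - 4 * (1 + x ^ 2) - (1 + y ^ 2) * (1 + x ^ 2))
        - fibreCoord x y p := by
    apply mul_left_cancel₀ hY
    rw [Real.sin_add]
    linear_combination 4 * (1 + x ^ 2) * (1 + y ^ 2) * (Real.cos t₃ * s4 + Real.sin t₃ * c4)
      + (1 - y ^ 2) * s3 + 2 * y * c3
  generalize fibreCoord x y p = m at *
  obtain ⟨D, hD⟩ : ∃ D, D = 4 * (1 + x ^ 2) - 4 * (1 + y ^ 2) - (1 + x ^ 2) * (1 + y ^ 2) :=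
    ⟨_, rfl⟩
  obtain ⟨D', hD'⟩ : ∃ D', D' = 4 * (1 + y ^ 2) - 4 * (1 + x ^ 2) - (1 + y ^ 2) * (1 + x ^ 2) :=
    ⟨_, rfl⟩
  rw [← hD] at c2 s2 c12 s12 hm
  rw [← hD'] at c3 s3 c34 s34
  have eC : v 0 * (D + x * m) + v 1 * (D - x * m) + 4 * (1 + x ^ 2) * (1 + y ^ 2) * v 2
      + v 3 * (D' - y * m) + v 4 * (D' + y * m) = 0 := by
    linear_combination 4 * (1 + x ^ 2) * (1 + y ^ 2) * hC - v 0 * c12 - v 1 * c2 - v 3 * c3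
      - v 4 * c34
  have eS : v 0 * (m - x * D) + v 1 * (m + x * D) - v 3 * (m + y * D') - v 4 * (m - y * D')
      = 0 := by
    linear_combination 4 * (1 + x ^ 2) * (1 + y ^ 2) * hS + v 0 * s12 + v 1 * s2 - v 3 * s3
      - v 4 * s34
  have hXY := mul_ne_zero two_ne_zero (mul_ne_zero hX hY)
  have e1 : 2 * m * (v 0 - v 2) = 8 * y * (1 + x ^ 2) * (v 4 - v 3)
        - (m + x * (4 * (1 + x ^ 2) + 4 * (1 + y ^ 2)
          - (1 + x ^ 2) * (1 + y ^ 2))) * (v 1 - v 0) := by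
    apply mul_left_cancel₀ hXY
    rw [hD] at hm eC eS
    rw [hD'] at eC eS
    linear_combination -m * eC
      - (4 * (1 + y ^ 2) - 4 * (1 + x ^ 2) - (1 + y ^ 2) * (1 + x ^ 2)) * eS
      - (x * (v 1 - v 0) - y * (v 4 - v 3)) * hm
  refine ⟨e1, ?_⟩
  rw [hD, hD'] at eS
  linear_combination e1 - eS

theorem cov_of_scaled {v w V W : Fin 5 → ℝ} {m : ℝ} (hv : ∀ k, 2 * m * (v k - v 2) = V k)
    (hw : ∀ k, 2 * m * (w k - w 2) = W k) : 4 * m ^ 2 * cov v w = cov V W := by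
  simp only [cov, Fin.sum_univ_five, ← hv, ← hw]
  ring

theorem bagOfEdges_of_tangent {x y m : ℝ} {v w : Fin 5 → ℝ} (hQ : 0 < radicand x y)
    (hm : m ^ 2 = radicand x y) (v10 : v 1 - v 0 = 1) (v43 : v 4 - v 3 = 0) (w10 : w 1 - w 0 = 0)
    (w43 : w 4 - w 3 = 1)
    (hv : 2 * m * (v 0 - v 2) = 8 * y * (1 + x ^ 2) * (v 4 - v 3)
        - (m + x * (4 * (1 + x ^ 2) + 4 * (1 + y ^ 2)
          - (1 + x ^ 2) * (1 + y ^ 2))) * (v 1 - v 0) ∧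
      2 * m * (v 3 - v 2) = -8 * x * (1 + y ^ 2) * (v 1 - v 0)
        + (y * (4 * (1 + x ^ 2) + 4 * (1 + y ^ 2) - (1 + x ^ 2) * (1 + y ^ 2))
          - m) * (v 4 - v 3))
    (hw : 2 * m * (w 0 - w 2) = 8 * y * (1 + x ^ 2) * (w 4 - w 3)
        - (m + x * (4 * (1 + x ^ 2) + 4 * (1 + y ^ 2)
          - (1 + x ^ 2) * (1 + y ^ 2))) * (w 1 - w 0) ∧
      2 * m * (w 3 - w 2) = -8 * x * (1 + y ^ 2) * (w 1 - w 0)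
        + (y * (4 * (1 + x ^ 2) + 4 * (1 + y ^ 2) - (1 + x ^ 2) * (1 + y ^ 2))
          - m) * (w 4 - w 3)) :
    bagOfEdges fifths v v = formulaE x y ∧ bagOfEdges fifths v w = formulaF x y ∧
      bagOfEdges fifths w w = formulaG x y := by
  rw [v10, v43] at hv
  rw [w10, w43] at hw
  obtain ⟨S, hS⟩ : ∃ S, S = 4 * (1 + x ^ 2) + 4 * (1 + y ^ 2) - (1 + x ^ 2) * (1 + y ^ 2) :=
    ⟨_, rfl⟩
  rw [← hS] at hv hw
  have hV : ∀ k, 2 * m * (v k - v 2)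
      = ![-(m + x * S), m - x * S, 0, -8 * x * (1 + y ^ 2), -8 * x * (1 + y ^ 2)] k := fun k => by
    fin_cases k <;> simp
    · linarith [hv.1]
    · linear_combination hv.1 + 2 * m * v10
    · linear_combination hv.2
    · linear_combination hv.2 + 2 * m * v43
  have hW : ∀ k, 2 * m * (w k - w 2)
      = ![8 * y * (1 + x ^ 2), 8 * y * (1 + x ^ 2), 0, y * S - m, y * S + m] k := fun k => by
    fin_cases k <;> simp
    · linarith [hw.1]
    · linear_combination hw.1 + 2 * m * w10
    · linear_combination hw.2
    · linear_combination hw.2 + 2 * m * w43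
  have e1 := cov_of_scaled hV hV
  have e2 := cov_of_scaled hV hW
  have e3 := cov_of_scaled hW hW
  simp only [bagOfEdges_fifths, formulaE, formulaF, formulaG]
  have h50 : 50 * radicand x y ≠ 0 := by positivity
  have h25 : 25 * radicand x y ≠ 0 := by positivity
  rw [eq_div_iff h50, eq_div_iff h25, eq_div_iff h50, ← hm]
  generalize cov v v = a at *
  generalize cov v w = b at *
  generalize cov w w = c at *
  simp [cov, Fin.sum_univ_five] at e1 e2 e3
  rw [radicand] at hm
  rw [hS] at e1 e2 e3
  refine ⟨?_, ?_, ?_⟩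
  · linear_combination 5 / 2 * e1 + 5 * hm
  · linear_combination 5 / 4 * e2
  · linear_combination 5 / 2 * e3 + 5 * hm

theorem exists_isAngleParametrization {p : E5}
    (h0 : vertexAngle 0 p ≠ (Real.pi : Real.Angle)) (h3 : vertexAngle 3 p ≠ (Real.pi : Real.Angle))
    {x y : ℝ} (hx : x = halfTan (vertexAngle 0 p)) (hy : y = halfTan (vertexAngle 3 p))
    (hQ : 0 < radicand x y) :
    ∃ U φ, IsAngleParametrization U φ ∧ ∃ u ∈ U, HasPhases p (φ u) := by
  obtain ⟨θ, hθ⟩ := exists_hasPhases p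
  have hm : 2 * fibreCoord x y p ≠ 0 := by
    refine mul_ne_zero two_ne_zero fun h => ?_
    have := (cos_sin_of_mem_angleFibre h0 h3 hx hy (p := p) ⟨rfl, rfl⟩).1
    rw [h] at this
    norm_num at this
    exact hQ.ne this
  obtain ⟨U, φ, h, hℓ, hu, hφ⟩ := exists_isParametrization hθ.1
    (ContinuousLinearMap.proj (R := ℝ) (φ := fun _ : Fin 5 => ℝ) 1 - ContinuousLinearMap.proj 0)
    (ContinuousLinearMap.proj (R := ℝ) (φ := fun _ : Fin 5 => ℝ) 4 - ContinuousLinearMap.proj 3)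
    (ContinuousLinearMap.proj 2) (by simp) (by simp) (by simp) (fun v v1 v2 v3 v4 v5 => by
      simp at v1 v2 v3
      obtain ⟨e1, e2⟩ := tangent_eq hθ h0 h3 hx hy v4 v5
      rw [v1, v2, v3, mul_zero, mul_zero, sub_zero, sub_zero, mul_eq_zero, or_iff_right hm] at e1
      rw [v1, v2, v3, mul_zero, mul_zero, sub_zero, add_zero, mul_eq_zero, or_iff_right hm] at e2
      funext k
      fin_cases k <;> simp <;> linarith)
  exact ⟨U, φ, ⟨h, fun u hu => (hℓ u hu).1, fun u hu => (hℓ u hu).2⟩, _, hu, by rwa [hφ]⟩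

theorem IsAngleParametrization.partial_sub {U : Set (ℝ × ℝ)} {φ : ℝ × ℝ → Fin 5 → ℝ}
    (h : IsAngleParametrization U φ) {u : ℝ × ℝ} (hu : u ∈ U) (w : ℝ × ℝ) :
    fderiv ℝ φ u w 1 - fderiv ℝ φ u w 0 = w.1 ∧ fderiv ℝ φ u w 4 - fderiv ℝ φ u w 3 = w.2 := by
  have hU := h.isParametrization.isOpen
  have hd := (differentiableAt_of_contDiffOn hU h.isParametrization.smooth hu).hasFDerivAt
  have hk := fun k => hasFDerivAt_pi'.1 hd k
  have e1 := fderiv_congr_of_eqOn hU (f := fun v => φ v 1 - φ v 0) (g := Prod.fst) h.fst_eq hu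
  have e2 := fderiv_congr_of_eqOn hU (f := fun v => φ v 4 - φ v 3) (g := Prod.snd) h.snd_eq hu
  rw [((hk 1).fun_sub (hk 0)).fderiv, fderiv_fst] at e1
  rw [((hk 4).fun_sub (hk 3)).fderiv, fderiv_snd] at e2
  exact ⟨congrArg (· w) e1, congrArg (· w) e2⟩

theorem IsAngleParametrization.metric_eq {U : Set (ℝ × ℝ)} {φ : ℝ × ℝ → Fin 5 → ℝ}
    (h : IsAngleParametrization U φ) {u : ℝ × ℝ} (hu : u ∈ U) {p : E5} (hp : HasPhases p (φ u))
    (h0 : vertexAngle 0 p ≠ (Real.pi : Real.Angle)) (h3 : vertexAngle 3 p ≠ (Real.pi : Real.Angle))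
    {x y : ℝ} (hx : x = halfTan (vertexAngle 0 p)) (hy : y = halfTan (vertexAngle 3 p))
    (hQ : 0 < radicand x y) :
    metricE φ u = formulaE x y ∧ metricF φ u = formulaF x y ∧ metricG φ u = formulaG x y :=
  have t := fun w => tangent_eq hp h0 h3 hx hy (h.isParametrization.sum_cos_mul hu w)
    (h.isParametrization.sum_sin_mul hu w)
  have s := h.partial_sub hu
  bagOfEdges_of_tangent hQ (cos_sin_of_mem_angleFibre h0 h3 hx hy (p := p) ⟨rfl, rfl⟩).1
    (s _).1 (s _).2 (s _).1 (s _).2 (t (1, 0)) (t (0, 1))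

end Pentagon

end

theorem mainTheorem5 :
    -- the vertex angles `τ₂` and `τ₃` in terms of `ξ = τ₁` and `η = τ₄`
    (∀ ξ η : Real.Angle, ξ ≠ (Real.pi : Real.Angle) → η ≠ (Real.pi : Real.Angle) →
      ∀ x y : ℝ, x = Pentagon.halfTan ξ → y = Pentagon.halfTan η →
        (∀ p ∈ Pentagon.angleFibre ξ η, 0 ≤ Pentagon.radicand x y ∧
          ∃ s : ℝ, (s = 1 ∨ s = -1) ∧ Pentagon.AnglesGivenBy s x y p) ∧
        (0 ≤ Pentagon.radicand x y → ¬ (x ^ 2 = 3 ∧ y ^ 2 = 3) →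
          ∀ s : ℝ, (s = 1 ∨ s = -1) →
            ∃! p : Pentagon.E5, p ∈ Pentagon.angleFibre ξ η ∧ Pentagon.AnglesGivenBy s x y p) ∧
        (0 < Pentagon.radicand x y → (Pentagon.angleFibre ξ η).ncard = 2) ∧
        (Pentagon.radicand x y = 0 → (Pentagon.angleFibre ξ η).ncard = 1)) ∧
    -- the first fundamental form in the coordinates `(ξ, η)`
    (∀ p : Pentagon.E5, Pentagon.vertexAngle 0 p ≠ (Real.pi : Real.Angle) →
      Pentagon.vertexAngle 3 p ≠ (Real.pi : Real.Angle) →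
      ∀ x y : ℝ, x = Pentagon.halfTan (Pentagon.vertexAngle 0 p) →
        y = Pentagon.halfTan (Pentagon.vertexAngle 3 p) →
        0 < Pentagon.radicand x y →
        (∃ U φ, Pentagon.IsAngleParametrization U φ ∧ ∃ u ∈ U, Pentagon.HasPhases p (φ u)) ∧
        ∀ U φ, Pentagon.IsAngleParametrization U φ → ∀ u ∈ U, Pentagon.HasPhases p (φ u) →
          Pentagon.metricE φ u = Pentagon.formulaE x y ∧
          Pentagon.metricF φ u = Pentagon.formulaF x y ∧
          Pentagon.metricG φ u = Pentagon.formulaG x y) ∧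
    -- the Gaussian curvature
    (∃ K : Pentagon.E5 → ℝ, (∀ p, Pentagon.HasGaussianCurvature p (K p)) ∧
      Set.range K = Set.Icc (-11 / 3) (-1) ∧
      (∀ p, Pentagon.IsTractVertex 5 p → K p = -1) ∧
      (∀ p, Pentagon.IsTractVertex 4 p → K p = -11 / 3)) ∧
    -- the pentagons at the two kinds of vertices
    (∀ p, Pentagon.IsTractVertex 5 p ↔ Pentagon.PhasesLikeFifthRoots p) ∧
    (∀ p, Pentagon.IsTractVertex 4 p ↔ Pentagon.TwoPairsCoincide p) := by
  refine ⟨fun ξ η hξ hη x y hx hy => ⟨fun p hp => ?_, fun hQ h3 s hs => ?_, fun hQ => ?_,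
    fun hQ => ?_⟩, fun p h0 h3 x y hx hy hQ => ⟨?_, fun U φ h u hu hp => ?_⟩,
    ⟨fun p => Pentagon.curvatureOf (Pentagon.secondMoment p), Pentagon.hasGaussianCurvature,
      Pentagon.range_curvature, fun p hp => ?_, fun p hp => ?_⟩,
    Pentagon.isTractVertex_five_iff, Pentagon.isTractVertex_four_iff⟩
  · exact ⟨Pentagon.radicand_nonneg_of_mem hξ hη hx hy hp,
      Pentagon.exists_sign_of_mem hξ hη hx hy hp⟩
  · exact Pentagon.existsUnique_of_sign hξ hη hx hy hQ h3 hs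
  · exact Pentagon.angleFibre_ncard_of_pos hξ hη hx hy hQ
  · exact Pentagon.angleFibre_ncard_of_eq_zero hξ hη hx hy hQ
  · exact Pentagon.exists_isAngleParametrization h0 h3 hx hy hQ
  · exact h.metric_eq hu hp h0 h3 hx hy hQ
  · dsimp only
    rw [((Pentagon.isTractVertex_five_iff p).1 hp).secondMoment_eq, Pentagon.curvatureOf_zero]
  · dsimp only
    rw [((Pentagon.isTractVertex_four_iff p).1 hp).secondMoment_eq, Pentagon.curvatureOf_max]
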